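/- **Model.** A team has $n\ge 2$ players. Time is discrete and players discount with $\delta\in(0,1)$. There are two tasks: on the good task $t_G$ the good game $G$ arrives with probability $a_G\in(0,1]$ in a period, on the bad task $t_B$ the bad game $B$ arrives with probability $a_B\in(0,1]$; otherwise no game is played. In a game $g$ each player chooses $C$ (cooperate) or $N$, with payoffs $\pi_g(a_i,a_{-i})$ that are symmetric (invariant under permutations of $a_{-i}$ and the same function for all players) and satisfy: $C^n$ is the unique maximizer of aggregate payoffs; $N$ is strictly dominant; $N^{n-1}$ minimizes $\max_{a_i}\pi_g(a_i,a_{-i})$ over $a_{-i}$; $N^n$ is the unique maximizer of aggregate payoffs among the profiles other than $C^n$; and $\pi_g(N,a_{-i})-\pi_g(C,a_{-i})$ is smallest at $a_{-i}=C^{n-1}$. Put $c_g=\pi_g(C,C^{n-1})-\pi_g(N,N^{n-1})$ and $d_g=\pi_g(N,C^{n-1})-\pi_g(C,C^{n-1})$. Cooperation in $g$ has social value $V_g$, where $V_G>0>V_B$. At any time a share $q_t\ge 0$ of the teams must be on task $t$, where $q_{t_G}+q_{t_B}=1$. A *reactive assignment* is, for some integer $K\ge1$, a map $m$ from states $s\in(\{t_G,t_B\}\times\{G,B,\emptyset\})^K$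 (tasks and games of the last $K$ periods, the last entry being the current one) to probability distributions over tasks. It induces a Markov chain on states. The designer does not observe whether a good game occurs: only those $m$ are available that take the same value at states which differ only in the arrivals of good games. (The statement holds both if the designer observes bad games and if she does not, in which case $m$ may depend on the tasks only.) A *reactive team structure* is a finitely supported probability distribution $\lambda$ over available reactive assignments together with, for each $m\in\operatorname{supp}\lambda$, a reshuffling rate $r_m\in[0,1]$ and a stationary distribution $\overline m$ of the induced chain, such that $\sum_m\lambda(m)\,\overline m(\{s:\text{the current task in } s \text{ is } t\})=q_t$ for both tasks $t$. A team in $m$ starts in a state drawn from $\overline m$ and plays the resulting stochastic game with discount factor $(1-r_m)\delta$; (behavior) strategies depend on the initial state and on all later tasks, games and actions of the team. A *player-optimal equilibrium* is a subgame-perfect equilibrium that maximizes the sum of the players' expected discounted payoffs among all subgame-perfect equilibria. There is *cooperation in state* $s$ if player-optimal equilibria exist and in all of them all players cooperate whenever the state is $s$ on the equilibrium path; $m$ (with $r_m,\overline m$) is *fully cooperative* (*fully non-cooperative*) if player-optimal equilibria exist and in all of them all players (no players) cooperate in every game on the equilibrium path. The social value of a structure is $\sum_m\lambda(m)\sum_s\overline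 m(s)V_{g(s)}$, where the inner sum is over the states $s$ with cooperation whose current period has a game $g(s)\in\{G,B\}$. A structure is *designer-optimal* if it maximizes the social value among all reactive team structures. **Proposition.** Suppose that $d_G>\frac{\delta}{1-\delta}a_Gc_G$, $\max_g d_g<\frac{\delta}{1-\delta}a_Bc_B$ and $d_B<\frac{\delta}{1-\delta}a_Gc_G$, and that the designer does not observe when a good game occurs. There is an integer $N_B\ge0$ such that for every designer-optimal reactive team structure $\lambda$ and every $m\in\operatorname{supp}\lambda$ that is fully cooperative: 1. In every player-optimal equilibrium, whenever a good game is played on the equilibrium path, every player is indifferent between cooperating and deviating to not cooperating. 2. Conditional on any state $s$ with $\overline m(s)>0$ whose current task is the good task, the team is assigned the bad task in the next $N_B$ periods with probability $1$; in the period after that it is assigned the good task with positive probability; and if it is not assigned the good task in that period, it is assigned the good task in the following period with probability $1$. Furthermore, for every designer-optimal $\lambda$: either there is a designer-optimal reactive team structure all of whose reactive assignments in the support are fully non-cooperative, or all fully non-cooperative $m'\in\operatorname{supp}\lambda$ assign teams only to one and the same task (there is a task $t$ such that, for each such $m'$, the current task is $t$ in every state $s$ with $\overline{m'}(s)>0$).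 -/

import Mathlib

open scoped BigOperators

noncomputable section

namespace TeamDesign

/-! ### Primitives -/

/-- The two actions: cooperate (`C`) or not (`N`). -/
inductive Action
  | C
  | N
  deriving DecidableEq

instance : Fintype Action := ⟨{.C, .N}, by intro x; cases x <;> simp⟩

/-- The two stage games: the good game `G` and the bad game `B`. -/
inductive Game
  | G
  | B
  deriving DecidableEq

instance : Fintype Game := ⟨{.G, .B}, by intro x; cases x <;> simp⟩

/-- The two tasks: the good task `t_G` and the bad task `t_B`. -/
inductive Task
  | tG
  | tB
  deriving DecidableEq

instance : Fintype Task := ⟨{.tG, .tB}, by intro x; cases x <;> simp⟩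

/-- The only game that can arrive on a task. -/
def Task.game : Task → Game
  | .tG => .G
  | .tB => .B

/-- An action profile of the `n` members of a team. -/
abbrev Profile (n : ℕ) := Fin n → Action

/-- Complete cooperation. -/
def allC (n : ℕ) : Profile n := fun _ => .C

/-- Complete non-cooperation. -/
def allN (n : ℕ) : Profile n := fun _ => .N

/-- The standing restrictions on a symmetric stage game; `π a i` is the payoff of player `i` at the
action profile `a`. -/
structure IsStageGame {n : ℕ} (π : Profile n → Fin n → ℝ) : Prop where
  /-- Payoffs do not depend on the identities of the players: they are equivariant under
  relabelling, i.e. a player's payoff is one common function of the own action and of the actions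
  of the others up to permutation. -/
  symmetric : ∀ (e : Equiv.Perm (Fin n)) (a : Profile n) (i : Fin n), π (a ∘ e) i = π a (e i)
  /-- Complete cooperation is the unique maximizer of aggregate payoffs. -/
  coop_max : ∀ a : Profile n, a ≠ allC n → ∑ i, π a i < ∑ i, π (allC n) i
  /-- Not cooperating is strictly dominant. -/
  dominant : ∀ (a : Profile n) (i : Fin n),
    π (Function.update a i .C) i < π (Function.update a i .N) i
  /-- Complete non-cooperation of the others minimizes a player's best payoff. -/
  minmax : ∀ (a : Profile n) (i : Fin n),
    max (π (Function.update (allN n) i .C) i) (π (Function.update (allN n) i .N) i) ≤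
      max (π (Function.update a i .C) i) (π (Function.update a i .N) i)
  /-- Apart from complete cooperation, complete non-cooperation is the unique maximizer of
  aggregate payoffs. -/
  noncoop_max : ∀ a : Profile n, a ≠ allC n → a ≠ allN n → ∑ i, π a i < ∑ i, π (allN n) i
  /-- The gain from not cooperating is smallest when all others cooperate. -/
  gain_min : ∀ (a : Profile n) (i : Fin n),
    π (Function.update (allC n) i .N) i - π (allC n) i ≤
      π (Function.update a i .N) i - π (Function.update a i .C) i

/-- The primitives of the organization, with teams of `n` players. -/
structure Environment (n : ℕ) where
  /-- A team has several members. -/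
  two_le : 2 ≤ n
  /-- Stage payoffs `payoff g a i`. -/
  payoff : Game → Profile n → Fin n → ℝ
  isStageGame : ∀ g, IsStageGame (payoff g)
  /-- The discount factor. -/
  δ : ℝ
  δ_pos : 0 < δ
  δ_lt_one : δ < 1
  /-- The arrival probabilities: `arr t` is the probability that the game of task `t` arrives. -/
  arr : Task → ℝ
  arr_pos : ∀ t, 0 < arr t
  arr_le_one : ∀ t, arr t ≤ 1
  /-- The social values of cooperation. -/
  V : Game → ℝ
  V_good : 0 < V .G
  V_bad : V .B < 0
  /-- The shares of teams that must cover the tasks at any time. -/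
  q : Task → ℝ
  q_nonneg : ∀ t, 0 ≤ q t
  q_sum : q .tG + q .tB = 1

namespace Environment

variable {n : ℕ} (E : Environment n)

/-- An arbitrary player; by symmetry the choice is immaterial. -/
def player : Fin n := ⟨0, lt_of_lt_of_le Nat.zero_lt_two E.two_le⟩

/-- The cooperation benefit `c_g`. -/
def c (g : Game) : ℝ := E.payoff g (allC n) E.player - E.payoff g (allN n) E.player

/-- The deviation temptation `d_g`. -/
def d (g : Game) : ℝ :=
  E.payoff g (Function.update (allC n) E.player .N) E.player - E.payoff g (allC n) E.player

/-- The probability that `o` happens on task `t` (`none` is: no game arrives). -/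
def outcomeProb (t : Task) : Option Game → ℝ
  | none => 1 - E.arr t
  | some g => if g = t.game then E.arr t else 0

/-- The stage payoff of a player; it is `0` when no game is played. -/
def stagePayoff (o : Option Game) (a : Profile n) (i : Fin n) : ℝ :=
  match o with
  | none => 0
  | some g => E.payoff g a i

/-- The social value of cooperation when `o` happens. -/
def socialValue : Option Game → ℝ
  | none => 0
  | some g => E.V g

end Environment

/-! ### Reactive assignments -/

/-- What happens to a team in one period: its task, and the game that arrives, if any. -/
abbrev Period := Task × Option Game

/-- A state with memory `K = k + 1`: the tasks and games of the last `K` periods, oldest first; the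
last entry is the current period. -/
abbrev State (k : ℕ) := Fin (k + 1) → Period

/-- The current period of a state. -/
def State.current {k : ℕ} (s : State k) : Period := s (Fin.last k)

/-- The next state: drop the oldest entry and append the new period. -/
def State.shift {k : ℕ} (s : State k) (x : Period) : State k :=
  Fin.snoc (α := fun _ => Period) (fun j : Fin k => s j.succ) x

/-- A reactive assignment: a map from the tasks and games of the last `K = k + 1` periods to
probability distributions over tasks, for some positive integer `K`. -/
structure ReactiveAssignment where
  k : ℕ
  assign : State k → stdSimplex ℝ Task

namespace ReactiveAssignment

variable {n : ℕ}

/-- The probability that task `t` is assigned after state `s`. -/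
def taskProb (m : ReactiveAssignment) (s : State m.k) (t : Task) : ℝ :=
  (m.assign s : Task → ℝ) t

/-- The probability that the period after state `s` is `x`. -/
def nextProb (E : Environment n) (m : ReactiveAssignment) (s : State m.k) (x : Period) : ℝ :=
  m.taskProb s x.1 * E.outcomeProb x.1 x.2

/-- The transition probability `m(s' | s)` of the induced Markov chain on states. -/
def trans (E : Environment n) (m : ReactiveAssignment) (s' s : State m.k) : ℝ :=
  ∑ x : Period, if s.shift x = s' then m.nextProb E s x else 0

/-- `μ` is a steady-state distribution induced by `m`. -/
def IsSteadyState (E : Environment n) (m : ReactiveAssignment) (μ : State m.k → ℝ) : Prop :=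
  μ ∈ stdSimplex ℝ (State m.k) ∧ ∀ s, μ s = ∑ s', m.trans E s s' * μ s'

/-- The probability that, from state `s` on, the tasks of the next periods are those listed. -/
def pathProb (E : Environment n) (m : ReactiveAssignment) : State m.k → List Task → ℝ
  | _, [] => 1
  | s, t :: l => ∑ o : Option Game, m.nextProb E s (t, o) * m.pathProb E (s.shift (t, o)) l

/-- `m` does not use the arrival of good games: it takes the same value at any two states with the
same tasks and the same arrivals of bad games. If bad games are not observed either, it takes the
same value at any two states with the same tasks. -/
def IgnoresGoodGames (badObserved : Prop) (m : ReactiveAssignment) : Prop :=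
  ∀ s s' : State m.k,
    (∀ j, (s j).1 = (s' j).1 ∧
      (badObserved → ((s j).2 = some Game.B ↔ (s' j).2 = some Game.B))) →
    m.assign s = m.assign s'

end ReactiveAssignment

/-! ### The stochastic game of a team -/

/-- Histories of a team up to and including the arrival in the current period: an initial state,
then alternately the action profile that was played and the period that followed. In a period in
which no game arrives nobody acts, and `allN` is recorded. -/
inductive History (n k : ℕ)
  | start (s : State k)
  | next (h : History n k) (a : Profile n) (x : Period)

/-- The state at the end of a history. -/
def History.state {n k : ℕ} : History n k → State k
  | .start s => s
  | .next h _ x => h.state.shift x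

/-- The game of the current period, if any. -/
def History.game {n k : ℕ} (h : History n k) : Option Game := h.state.current.2

/-- A (behavior) strategy: the probability of cooperating after each history. It is irrelevant
where no game arrives. -/
abbrev Strategy (n k : ℕ) := History n k → Set.Icc (0 : ℝ) 1

/-- A strategy profile. -/
abbrev StrategyProfile (n k : ℕ) := Fin n → Strategy n k

/-- The probability that the profile `a` is played after the history `h`. -/
def playProb {n k : ℕ} (σ : StrategyProfile n k) (h : History n k) (a : Profile n) : ℝ :=
  match h.game with
  | none => if a = allN n then 1 else 0
  | some _ => ∏ i, if a i = Action.C then (σ i h : ℝ) else 1 - (σ i h : ℝ)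

section Play

variable {n : ℕ} (E : Environment n) (m : ReactiveAssignment)

/-- The expected stage payoff of player `i`, `j` periods after the history `h`. -/
def expectedStage (σ : StrategyProfile n m.k) (i : Fin n) : ℕ → History n m.k → ℝ
  | 0, h => ∑ a, playProb σ h a * E.stagePayoff h.game a i
  | j + 1, h => ∑ a, playProb σ h a *
      ∑ x : Period, m.nextProb E h.state x * expectedStage σ i j (h.next a x)

/-- The expected discounted payoff of player `i` from the history `h` on, when teams are reshuffled
at rate `r`: the effective discount factor is `(1 - r) δ`. -/
def continuationPayoff (r : ℝ) (σ : StrategyProfile n m.k) (h : History n m.k) (i : Fin n) : ℝ :=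
  ∑' j : ℕ, ((1 - r) * E.δ) ^ j * expectedStage E m σ i j h

/-- The histories that can arise under some behavior of the players, when the initial state is
drawn from `μ`. -/
inductive IsHistory (μ : State m.k → ℝ) : History n m.k → Prop
  | start (s : State m.k) : 0 < μ s → IsHistory μ (.start s)
  | next (h : History n m.k) (a : Profile n) (x : Period) : IsHistory μ h →
      (h.game = none → a = allN n) → 0 < m.nextProb E h.state x → IsHistory μ (h.next a x)

/-- The histories that have positive probability under `σ`, when the initial state is drawn from
`μ`. -/
inductive OnPath (μ : State m.k → ℝ) (σ : StrategyProfile n m.k) : History n m.k → Prop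
  | start (s : State m.k) : 0 < μ s → OnPath μ σ (.start s)
  | next (h : History n m.k) (a : Profile n) (x : Period) : OnPath μ σ h →
      0 < playProb σ h a → 0 < m.nextProb E h.state x → OnPath μ σ (h.next a x)

/-- Subgame perfection: a Nash equilibrium after every history. -/
def IsSubgamePerfect (r : ℝ) (μ : State m.k → ℝ) (σ : StrategyProfile n m.k) : Prop :=
  ∀ h, IsHistory E m μ h → ∀ (i : Fin n) (ρ : Strategy n m.k),
    continuationPayoff E m r (Function.update σ i ρ) h i ≤ continuationPayoff E m r σ h i

/-- The sum of the players' expected discounted payoffs, when the initial state is drawn from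
`μ`. -/
def totalPayoff (r : ℝ) (μ : State m.k → ℝ) (σ : StrategyProfile n m.k) : ℝ :=
  ∑ s, μ s * ∑ i, continuationPayoff E m r σ (.start s) i

/-- Player-optimal subgame-perfect equilibria. -/
def IsPlayerOptimal (r : ℝ) (μ : State m.k → ℝ) (σ : StrategyProfile n m.k) : Prop :=
  IsSubgamePerfect E m r μ σ ∧
    ∀ σ', IsSubgamePerfect E m r μ σ' → totalPayoff E m r μ σ' ≤ totalPayoff E m r μ σ

/-- There is cooperation in state `s`: in player-optimal equilibria, all players cooperate whenever
the state is `s` on the equilibrium path. -/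
def Cooperation (r : ℝ) (μ : State m.k → ℝ) (s : State m.k) : Prop :=
  (∃ σ, IsPlayerOptimal E m r μ σ) ∧
    ∀ σ, IsPlayerOptimal E m r μ σ →
      ∀ h, OnPath E m μ σ h → h.state = s → ∀ i, (σ i h : ℝ) = 1

/-- In player-optimal equilibria, all players cooperate in all games on the equilibrium path. -/
def FullyCooperative (r : ℝ) (μ : State m.k → ℝ) : Prop :=
  (∃ σ, IsPlayerOptimal E m r μ σ) ∧
    ∀ σ, IsPlayerOptimal E m r μ σ →
      ∀ h, OnPath E m μ σ h → h.game ≠ none → ∀ i, (σ i h : ℝ) = 1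

/-- In player-optimal equilibria, no player cooperates in any game on the equilibrium path. -/
def FullyNonCooperative (r : ℝ) (μ : State m.k → ℝ) : Prop :=
  (∃ σ, IsPlayerOptimal E m r μ σ) ∧
    ∀ σ, IsPlayerOptimal E m r μ σ →
      ∀ h, OnPath E m μ σ h → h.game ≠ none → ∀ i, (σ i h : ℝ) = 0

open Classical in
/-- After the history `h`, player `i` is indifferent between cooperating and not cooperating in the
current game, given that everybody (including `i`, later on) follows `σ` otherwise. -/
def Indifferent (r : ℝ) (σ : StrategyProfile n m.k) (h : History n m.k) (i : Fin n) : Prop :=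
  continuationPayoff E m r (Function.update σ i (Function.update (σ i) h 1)) h i =
    continuationPayoff E m r (Function.update σ i (Function.update (σ i) h 0)) h i

open Classical in
/-- The social value generated, per unit of mass, by the teams in `m`. -/
def teamValue (r : ℝ) (μ : State m.k → ℝ) : ℝ :=
  ∑ s, if Cooperation E m r μ s then μ s * E.socialValue s.current.2 else 0

/-- The steady-state share of the teams in `m` that are on task `t`. -/
def taskShare (μ : State m.k → ℝ) (t : Task) : ℝ :=
  ∑ s, if s.current.1 = t then μ s else 0

end Play

/-! ### Reactive team structures -/

/-- The data of a reactive team structure: a finitely supported weight on reactive assignments,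
together with a reshuffling rate and a distribution over states for each reactive assignment (these
matter only on the support of the weight). -/
structure TeamStructure where
  weight : ReactiveAssignment →₀ ℝ
  rate : ReactiveAssignment → ℝ
  steady : (m : ReactiveAssignment) → State m.k → ℝ

namespace TeamStructure

variable {n : ℕ} (E : Environment n) (badObserved : Prop) (Λ : TeamStructure)

/-- Reactive team structures available to a designer who does not observe good games: the weights
are a probability distribution, the rates are probabilities, the distributions are steady states,
the assignments do not use good games, and the task constraint holds. -/
structure IsFeasible : Prop where
  weight_nonneg : ∀ m, 0 ≤ Λ.weight m
  weight_sum : ∑ m ∈ Λ.weight.support, Λ.weight m = 1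
  rate_mem : ∀ m ∈ Λ.weight.support, Λ.rate m ∈ Set.Icc (0 : ℝ) 1
  steady : ∀ m ∈ Λ.weight.support, m.IsSteadyState E (Λ.steady m)
  observable : ∀ m ∈ Λ.weight.support, m.IgnoresGoodGames badObserved
  tasks : ∀ t, ∑ m ∈ Λ.weight.support, Λ.weight m * taskShare m (Λ.steady m) t = E.q t

/-- The social value of a reactive team structure. -/
def value : ℝ :=
  ∑ m ∈ Λ.weight.support, Λ.weight m * teamValue E m (Λ.rate m) (Λ.steady m)

/-- Designer-optimal reactive team structures. -/
def IsOptimal : Prop :=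
  Λ.IsFeasible E badObserved ∧
    ∀ Λ' : TeamStructure, Λ'.IsFeasible E badObserved → Λ'.value E ≤ Λ.value E

end TeamStructure

end TeamDesign

end

namespace TeamDesign

/-! ### Sums over the primitive types -/

/-! Write `b = a_B c_B` and `g = a_G c_G`; the hypotheses force `g < b`. Under full cooperation
without reshuffling, the future is worth `δ/(1-δ) b` minus `b - g` for each discounted future period
on the good task (`futureBenefit_eq`). A deviator can be held to exactly the payoff of complete
non-cooperation, so full cooperation is sustainable precisely when the future is worth at least the
temptation in every game (`CooperatesOnPath.d_le_futureBenefit`, `fullyCooperative_of_incentives`).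
For the bad game this holds automatically without reshuffling. For the good game it says that the
discounted time on the good task, current period included, is at most `1 + κ`. As arrivals of good
games are unobserved, this bound must hold in every recurring state on the good task, not only when
a good game occurs (`IsDesignProblem.goodTime_le_of_incentives`).

This leaves an extremal problem: how large can the long-run share of the good task be under that
bound? A return after `T` periods counts `δ ^ T`, which is convex in `T`. For a given expected
discount factor, the mean return time is therefore smallest when `T` takes only two consecutive
values `N + 1` and `N + 2`: this is the cycle. For arbitrary history dependence the argument runs
through a concave piecewise affine `potential` that equals `-T` at `δ ^ T`. It satisfies a drift
inequality in every state; averaging over the steady state bounds the share, and attaining the bound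
forces equality at each step (`potential_step_eq`), which pins down the path (`extremal_cycle`).

A fully cooperative team with a smaller share would be beaten by mixing the cycle with idle teams on
the bad task: good cooperation is unchanged and harmful cooperation falls
(`TeamStructure.IsOptimal.one_le_share`). Hence fully cooperative teams in an optimum are
unreshuffled cycles with binding constraints, and binding constraints mean indifference. For the
last claim, idle teams on both tasks could be partly replaced by scaling up all other teams, which
is profitable if the value is positive; otherwise complete idleness is optimal. -/

theorem sum_task (f : Task → ℝ) : ∑ t, f t = f .tG + f .tB := by
  change ∑ t ∈ ({Task.tG, Task.tB} : Finset Task), f t = _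
  rw [Finset.sum_pair (by decide)]

theorem sum_game (f : Game → ℝ) : ∑ g, f g = f .G + f .B := by
  change ∑ g ∈ ({Game.G, Game.B} : Finset Game), f g = _
  rw [Finset.sum_pair (by decide)]

theorem Task.eq_tB_of_ne {t : Task} (h : t ≠ .tG) : t = .tB := by
  cases t <;> simp_all

variable {n : ℕ} (E : Environment n) (m : ReactiveAssignment)

theorem Environment.outcomeProb_nonneg (t : Task) (o : Option Game) : 0 ≤ E.outcomeProb t o := by
  cases o with
  | none => simpa [Environment.outcomeProb] using E.arr_le_one t
  | some g =>
    simp only [Environment.outcomeProb]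
    split_ifs
    · exact (E.arr_pos t).le
    · exact le_rfl

theorem Environment.sum_outcomeProb_mul (t : Task) (f : Option Game → ℝ) :
    ∑ o, E.outcomeProb t o * f o = (1 - E.arr t) * f none + E.arr t * f (some t.game) := by
  rw [Fintype.sum_option, sum_game]
  cases t <;> simp [Environment.outcomeProb, Task.game]

theorem Environment.sum_outcomeProb (t : Task) : ∑ o, E.outcomeProb t o = 1 := by
  have := E.sum_outcomeProb_mul t (fun _ => 1)
  simp only [mul_one] at this
  rw [this]; ring

/-! ### The Markov operator of the chain of states -/

namespace ReactiveAssignment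

theorem taskProb_nonneg (s : State m.k) (t : Task) : 0 ≤ m.taskProb s t :=
  (m.assign s).2.1 t

theorem taskProb_sum (s : State m.k) : m.taskProb s .tG + m.taskProb s .tB = 1 := by
  rw [← sum_task]; exact (m.assign s).2.2

theorem nextProb_nonneg (s : State m.k) (x : Period) : 0 ≤ m.nextProb E s x :=
  mul_nonneg (m.taskProb_nonneg s _) (E.outcomeProb_nonneg _ _)

theorem sum_nextProb_mul (s : State m.k) (f : Period → ℝ) :
    ∑ x, m.nextProb E s x * f x =
      m.taskProb s .tG * ∑ o, E.outcomeProb .tG o * f (.tG, o) +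
      m.taskProb s .tB * ∑ o, E.outcomeProb .tB o * f (.tB, o) := by
  rw [Fintype.sum_prod_type, sum_task]
  simp only [nextProb, Finset.mul_sum, mul_assoc]

theorem sum_nextProb (s : State m.k) : ∑ x, m.nextProb E s x = 1 := by
  have := m.sum_nextProb_mul E s (fun _ => 1)
  simp only [mul_one, E.sum_outcomeProb] at this
  rw [this, m.taskProb_sum]

/-- The Markov operator of the induced chain: `stepOp f s` is the expectation of `f` at the state
after `s`. -/
noncomputable def stepOp : (State m.k → ℝ) →ₗ[ℝ] (State m.k → ℝ) where
  toFun f s := ∑ x, m.nextProb E s x * f (s.shift x)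
  map_add' f g := by
    funext s; simp [mul_add, Finset.sum_add_distrib]
  map_smul' c f := by
    funext s; simp only [Pi.smul_apply, smul_eq_mul, RingHom.id_apply, Finset.mul_sum]
    exact Finset.sum_congr rfl fun x _ => by ring

theorem stepOp_apply (f : State m.k → ℝ) (s : State m.k) :
    m.stepOp E f s = ∑ x, m.nextProb E s x * f (s.shift x) := rfl

theorem stepOp_const (c : ℝ) (s : State m.k) : m.stepOp E (fun _ => c) s = c := by
  rw [stepOp_apply, ← Finset.sum_mul, sum_nextProb, one_mul]

theorem stepOp_affine (a c : ℝ) (f : State m.k → ℝ) (s : State m.k) :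
    m.stepOp E (fun s' => a + c * f s') s = a + c * m.stepOp E f s := by
  have : (fun s' => a + c * f s') = (fun _ => a) + c • f := by funext; simp
  rw [this, map_add, map_smul, Pi.add_apply, stepOp_const]; simp

theorem stepOp_le_of_succ {f g : State m.k → ℝ} {s : State m.k}
    (h : ∀ x, 0 < m.nextProb E s x → f (s.shift x) ≤ g (s.shift x)) :
    m.stepOp E f s ≤ m.stepOp E g s := by
  rw [stepOp_apply, stepOp_apply]
  refine Finset.sum_le_sum fun x _ => ?_
  rcases (m.nextProb_nonneg E s x).eq_or_lt with h0 | h0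
  · rw [← h0]; simp
  · exact mul_le_mul_of_nonneg_left (h x h0) h0.le

theorem stepOp_mono {f g : State m.k → ℝ} (h : f ≤ g) (s : State m.k) :
    m.stepOp E f s ≤ m.stepOp E g s :=
  m.stepOp_le_of_succ E fun _ _ => h _

/-- Equality case of monotonicity: nonnegative differences with zero mean vanish wherever the
probability is positive. This turns tight averaged inequalities into statements about each
successor. -/
theorem eq_of_stepOp_eq {f g : State m.k → ℝ} {s : State m.k} (hle : f ≤ g)
    (h : m.stepOp E g s ≤ m.stepOp E f s) {x : Period} (hx : 0 < m.nextProb E s x) :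
    f (s.shift x) = g (s.shift x) := by
  have h1 := (Finset.sum_eq_sum_iff_of_le (s := Finset.univ)
    (f := fun x => m.nextProb E s x * f (s.shift x))
    (g := fun x => m.nextProb E s x * g (s.shift x))
    (fun x _ => mul_le_mul_of_nonneg_left (hle _) (m.nextProb_nonneg E s x))).1
    (le_antisymm (m.stepOp_mono E hle s) h) x (Finset.mem_univ _)
  exact mul_left_cancel₀ hx.ne' h1

theorem stepOp_pow_mono {f g : State m.k → ℝ} (h : f ≤ g) (j : ℕ) :
    (m.stepOp E ^ j) f ≤ (m.stepOp E ^ j) g := by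
  induction j with
  | zero => simpa using h
  | succ j ih =>
    rw [pow_succ', Module.End.mul_apply, Module.End.mul_apply]
    exact fun s => m.stepOp_mono E ih s

theorem stepOp_pow_const (c : ℝ) (j : ℕ) :
    (m.stepOp E ^ j) (fun _ => c) = fun _ => c := by
  induction j with
  | zero => simp
  | succ j ih =>
    rw [pow_succ', Module.End.mul_apply, ih]
    funext s; exact m.stepOp_const E c s

theorem exists_abs_le (f : State m.k → ℝ) : ∃ M, ∀ s, |f s| ≤ M :=
  ⟨∑ s, |f s|, fun s => Finset.single_le_sum (f := fun s => |f s|)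
    (fun s _ => abs_nonneg (f s)) (Finset.mem_univ s)⟩

theorem abs_stepOp_pow_le {f : State m.k → ℝ} {M : ℝ} (hM : ∀ s, |f s| ≤ M) (j : ℕ)
    (s : State m.k) : |(m.stepOp E ^ j) f s| ≤ M := by
  rw [abs_le]
  constructor
  · have := m.stepOp_pow_mono E (f := fun _ => -M) (g := f) (fun s => (abs_le.1 (hM s)).1) j s
    rwa [stepOp_pow_const] at this
  · have := m.stepOp_pow_mono E (f := f) (g := fun _ => M) (fun s => (abs_le.1 (hM s)).2) j s
    rwa [stepOp_pow_const] at this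

/-- The expected discounted sum of `f` along the induced chain. -/
noncomputable def discounted (β : ℝ) (f : State m.k → ℝ) (s : State m.k) : ℝ :=
  ∑' j : ℕ, β ^ j * (m.stepOp E ^ j) f s

end ReactiveAssignment

theorem summable_discount {β M : ℝ} (h0 : 0 ≤ β) (h1 : β < 1) {u : ℕ → ℝ}
    (hu : ∀ j, |u j| ≤ M) : Summable fun j => β ^ j * u j := by
  refine Summable.of_norm_bounded ((summable_geometric_of_lt_one h0 h1).mul_right M) fun j => ?_
  rw [Real.norm_eq_abs, abs_mul, abs_of_nonneg (pow_nonneg h0 j)]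
  exact mul_le_mul_of_nonneg_left (hu j) (pow_nonneg h0 j)

/-! ### Bellman equations and the maximum principle on states -/

namespace ReactiveAssignment

theorem summable_discounted {β : ℝ} (h0 : 0 ≤ β) (h1 : β < 1) (f : State m.k → ℝ)
    (s : State m.k) : Summable fun j : ℕ => β ^ j * (m.stepOp E ^ j) f s := by
  obtain ⟨M, hM⟩ := m.exists_abs_le f
  exact summable_discount h0 h1 fun j => m.abs_stepOp_pow_le E hM j s

theorem discounted_eq {β : ℝ} (h0 : 0 ≤ β) (h1 : β < 1) (f : State m.k → ℝ) (s : State m.k) :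
    m.discounted E β f s = f s + β * m.stepOp E (m.discounted E β f) s := by
  rw [discounted, (m.summable_discounted E h0 h1 f s).tsum_eq_zero_add]
  simp only [pow_zero, one_mul, Module.End.one_apply]
  congr 1
  rw [stepOp_apply]
  simp only [discounted]
  simp_rw [← tsum_mul_left]
  rw [← Summable.tsum_finsetSum (fun x _ =>
    (m.summable_discounted E h0 h1 f (s.shift x)).mul_left _), ← tsum_mul_left]
  refine tsum_congr fun j => ?_
  rw [pow_succ' (m.stepOp E), Module.End.mul_apply, stepOp_apply, Finset.mul_sum, Finset.mul_sum]
  exact Finset.sum_congr rfl fun x _ => by ring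

/-- A set of states is closed if the induced chain cannot leave it. -/
def IsClosedSet (S : Set (State m.k)) : Prop :=
  ∀ s ∈ S, ∀ x, 0 < m.nextProb E s x → s.shift x ∈ S

theorem isClosedSet_univ : m.IsClosedSet E Set.univ := fun _ _ _ _ => Set.mem_univ _

/-- At a maximizer over the closed set the expectation of `u` is at most its maximum, so a positive
maximum would be at most `β < 1` times itself. -/
theorem nonpos_of_le_stepOp {S : Set (State m.k)} (hS : m.IsClosedSet E S) {β : ℝ} (h0 : 0 ≤ β)
    (h1 : β < 1) {u : State m.k → ℝ} (hu : ∀ s ∈ S, u s ≤ β * m.stepOp E u s) :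
    ∀ s ∈ S, u s ≤ 0 := by
  intro s₀ hs₀
  obtain ⟨s, hs, hmax⟩ := Set.exists_max_image S u S.toFinite ⟨s₀, hs₀⟩
  refine (hmax s₀ hs₀).trans ?_
  by_contra! hpos
  have h2 : m.stepOp E u s ≤ u s := by
    have := m.stepOp_le_of_succ E (f := u) (g := fun _ => u s) (s := s)
      (fun x hx => hmax _ (hS s hs x hx))
    rwa [stepOp_const] at this
  have := hu s hs
  nlinarith

theorem le_of_isFixed {β : ℝ} (h0 : 0 ≤ β) (h1 : β < 1) {f g u v : State m.k → ℝ}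
    (hu : ∀ s, u s = f s + β * m.stepOp E u s) (hv : ∀ s, v s = g s + β * m.stepOp E v s)
    (hfg : ∀ s, f s ≤ g s) (s : State m.k) : u s ≤ v s := by
  have := m.nonpos_of_le_stepOp E (m.isClosedSet_univ E) h0 h1 (u := u - v) (fun s _ => by
    rw [map_sub, Pi.sub_apply, Pi.sub_apply, hu s, hv s]
    linarith [hfg s]) s (Set.mem_univ _)
  simpa using this

/-- Bellman equations have one solution; closed forms of discounted sums are verified this way. -/
theorem eq_of_isFixed {β : ℝ} (h0 : 0 ≤ β) (h1 : β < 1) {f u v : State m.k → ℝ}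
    (hu : ∀ s, u s = f s + β * m.stepOp E u s) (hv : ∀ s, v s = f s + β * m.stepOp E v s) :
    u = v :=
  funext fun s => le_antisymm (m.le_of_isFixed E h0 h1 hu hv (fun _ => le_rfl) s)
    (m.le_of_isFixed E h0 h1 hv hu (fun _ => le_rfl) s)

theorem discounted_nonneg {β : ℝ} (h0 : 0 ≤ β) {f : State m.k → ℝ}
    (hf : ∀ s, 0 ≤ f s) (s : State m.k) : 0 ≤ m.discounted E β f s := by
  refine tsum_nonneg fun j => mul_nonneg (pow_nonneg h0 j) ?_
  have := m.stepOp_pow_mono E (f := fun _ => 0) (g := f) hf j s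
  rwa [stepOp_pow_const] at this

theorem discounted_sub {β : ℝ} (h0 : 0 ≤ β) (h1 : β < 1) (f g : State m.k → ℝ) :
    m.discounted E β (f - g) = m.discounted E β f - m.discounted E β g := by
  refine m.eq_of_isFixed E h0 h1 (m.discounted_eq E h0 h1 _) fun s => ?_
  rw [Pi.sub_apply, map_sub, Pi.sub_apply, m.discounted_eq E h0 h1 f s,
    m.discounted_eq E h0 h1 g s, Pi.sub_apply]
  ring

/-! ### Steady states -/

theorem stepOp_eq_sum_trans (f : State m.k → ℝ) (s : State m.k) :
    m.stepOp E f s = ∑ s', m.trans E s' s * f s' := by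
  simp only [trans, Finset.sum_mul]
  rw [Finset.sum_comm, stepOp_apply]
  refine Finset.sum_congr rfl fun x _ => ?_
  rw [Finset.sum_eq_single (s.shift x)]
  · simp
  · intro b _ hb; simp [hb.symm]
  · simp

theorem trans_nonneg (s' s : State m.k) : 0 ≤ m.trans E s' s :=
  Finset.sum_nonneg fun x _ => by
    split_ifs
    exacts [m.nextProb_nonneg E s x, le_rfl]

theorem sum_trans (s : State m.k) : ∑ s', m.trans E s' s = 1 := by
  have := m.stepOp_eq_sum_trans E (fun _ => 1) s
  rw [stepOp_const] at this
  simpa using this.symm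

variable {E m} {μ : State m.k → ℝ}

theorem IsSteadyState.sum_mul_stepOp (h : m.IsSteadyState E μ) (f : State m.k → ℝ) :
    ∑ s, μ s * m.stepOp E f s = ∑ s, μ s * f s := by
  calc ∑ s, μ s * m.stepOp E f s = ∑ s, ∑ s', m.trans E s' s * μ s * f s' := by
        refine Finset.sum_congr rfl fun s _ => ?_
        rw [stepOp_eq_sum_trans, Finset.mul_sum]
        exact Finset.sum_congr rfl fun x _ => by ring
    _ = ∑ s', (∑ s, m.trans E s' s * μ s) * f s' := by
        rw [Finset.sum_comm]
        exact Finset.sum_congr rfl fun s _ => by rw [Finset.sum_mul]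
    _ = ∑ s, μ s * f s := Finset.sum_congr rfl fun s _ => by rw [← h.2 s]

theorem IsSteadyState.nonneg (h : m.IsSteadyState E μ) (s : State m.k) : 0 ≤ μ s := h.1.1 s

theorem IsSteadyState.sum_eq_one (h : m.IsSteadyState E μ) : ∑ s, μ s = 1 := h.1.2

theorem nextProb_le_trans (s : State m.k) (x : Period) :
    m.nextProb E s x ≤ m.trans E (s.shift x) s := by
  have := Finset.single_le_sum (s := Finset.univ)
    (f := fun y => if s.shift y = s.shift x then m.nextProb E s y else 0)
    (fun y _ => by split_ifs; exacts [m.nextProb_nonneg E s y, le_rfl]) (Finset.mem_univ x)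
  simpa [trans] using this

theorem IsSteadyState.pos_shift (h : m.IsSteadyState E μ) {s : State m.k} (hs : 0 < μ s)
    {x : Period} (hx : 0 < m.nextProb E s x) : 0 < μ (s.shift x) := by
  rw [h.2 (s.shift x)]
  have h1 := Finset.single_le_sum (s := Finset.univ)
    (f := fun s' => m.trans E (s.shift x) s' * μ s')
    (fun s' _ => mul_nonneg (m.trans_nonneg E _ _) (h.nonneg s')) (Finset.mem_univ s)
  exact lt_of_lt_of_le (mul_pos (hx.trans_le (nextProb_le_trans s x)) hs) h1

theorem IsSteadyState.isClosedSet (h : m.IsSteadyState E μ) :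
    m.IsClosedSet E {s | 0 < μ s} := fun _ hs _ hx => h.pos_shift hs hx

/-- Recurring states have been entered, so the current period was really drawn by the chain. This
excludes impossible task-game pairs and allows the arrival to be redrawn. -/
theorem IsSteadyState.exists_pred (h : m.IsSteadyState E μ) {s : State m.k} (hs : 0 < μ s) :
    ∃ s' x, 0 < μ s' ∧ 0 < m.nextProb E s' x ∧ s'.shift x = s := by
  rw [h.2 s] at hs
  obtain ⟨s', -, hs'⟩ := Finset.exists_lt_of_sum_lt (s := Finset.univ) (f := fun _ => (0 : ℝ))
    (by simpa using hs)
  have h1 : 0 < μ s' := by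
    refine lt_of_le_of_ne (h.nonneg s') fun h0 => ?_
    rw [← h0] at hs'; simp at hs'
  have h2 : 0 < m.trans E s s' := by
    refine lt_of_le_of_ne (m.trans_nonneg E _ _) fun h0 => ?_
    rw [← h0] at hs'; simp at hs'
  obtain ⟨x, -, hx⟩ := Finset.exists_lt_of_sum_lt (s := Finset.univ) (f := fun _ => (0 : ℝ))
    (by simpa [trans] using h2)
  split_ifs at hx with h3
  · exact ⟨s', x, h1, hx, h3⟩
  · exact absurd hx (lt_irrefl _)

variable (E m)

/-- Every reactive assignment has a steady state. -/
theorem exists_isSteadyState : ∃ μ, m.IsSteadyState E μ := by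
  classical
  let T : Matrix (State m.k) (State m.k) ℝ := fun s s' => m.trans E s' s
  -- A stochastic matrix fixes the constants, so `T - 1` is singular and also has a nonzero left
  -- null vector `v`.
  have hdet : (T - 1).det = 0 := by
    refine Matrix.exists_mulVec_eq_zero_iff.1 ⟨fun _ => 1, ?_, ?_⟩
    · intro h
      exact one_ne_zero (congrFun h fun _ => (Task.tG, none))
    · funext s
      rw [Matrix.sub_mulVec, Matrix.one_mulVec, Pi.sub_apply]
      simp [Matrix.mulVec, dotProduct, T, sum_trans]
  obtain ⟨v, hv0, hv⟩ := Matrix.exists_vecMul_eq_zero_iff.2 hdet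
  have hv' : ∀ s, v s = ∑ s', m.trans E s s' * v s' := by
    intro s
    have := congrFun hv s
    rw [Matrix.vecMul_sub, Matrix.vecMul_one, Pi.sub_apply] at this
    simp only [Matrix.vecMul, dotProduct, T, Pi.zero_apply] at this
    rw [← sub_eq_zero.1 this]
    exact Finset.sum_congr rfl fun _ _ => mul_comm _ _
  -- The vector `|v|` is subinvariant, and both sides have the same total mass; hence `|v|` is
  -- invariant and can be normalized.
  have hle : ∀ s ∈ Finset.univ, |v s| ≤ ∑ s', m.trans E s s' * |v s'| := by
    intro s _
    conv_lhs => rw [hv' s]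
    refine (Finset.abs_sum_le_sum_abs _ _).trans (Finset.sum_le_sum fun s' _ => ?_)
    rw [abs_mul, abs_of_nonneg (m.trans_nonneg E _ _)]
  have hsum : ∑ s, |v s| = ∑ s, ∑ s', m.trans E s s' * |v s'| := by
    rw [Finset.sum_comm]
    refine Finset.sum_congr rfl fun s _ => ?_
    rw [← Finset.sum_mul, sum_trans, one_mul]
  have heq := (Finset.sum_eq_sum_iff_of_le hle).1 hsum
  have hpos : 0 < ∑ s, |v s| := by
    obtain ⟨s, hs⟩ := Function.ne_iff.1 hv0
    exact Finset.sum_pos' (fun _ _ => abs_nonneg _) ⟨s, Finset.mem_univ _, abs_pos.2 hs⟩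
  refine ⟨fun s => |v s| / ∑ s, |v s|, ⟨fun s => by positivity, ?_⟩, fun s => ?_⟩
  · rw [← Finset.sum_div, div_self hpos.ne']
  · simp only
    rw [heq s (Finset.mem_univ _), Finset.sum_div]
    exact Finset.sum_congr rfl fun _ _ => by ring

end ReactiveAssignment

@[simp] theorem State.current_shift {k : ℕ} (s : State k) (x : Period) :
    (s.shift x).current = x := by
  simp [State.current, State.shift]

/-! ### Probabilities of task paths -/

namespace ReactiveAssignment

variable {n : ℕ} (E : Environment n) (m : ReactiveAssignment)

theorem stepOp_congr_of_succ {f g : State m.k → ℝ} {s : State m.k}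
    (h : ∀ x, 0 < m.nextProb E s x → f (s.shift x) = g (s.shift x)) :
    m.stepOp E f s = m.stepOp E g s :=
  le_antisymm (m.stepOp_le_of_succ E fun x hx => (h x hx).le)
    (m.stepOp_le_of_succ E fun x hx => (h x hx).ge)

theorem stepOp_eq_const_of_succ {f : State m.k → ℝ} {s : State m.k} {c : ℝ}
    (h : ∀ x, 0 < m.nextProb E s x → f (s.shift x) = c) : m.stepOp E f s = c :=
  (m.stepOp_congr_of_succ E (g := fun _ => c) h).trans (m.stepOp_const E c s)

theorem pathProb_cons (s : State m.k) (t : Task) (l : List Task) :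
    m.pathProb E s (t :: l) =
      m.stepOp E (fun s' => if s'.current.1 = t then m.pathProb E s' l else 0) s := by
  rw [stepOp_apply, pathProb, Fintype.sum_prod_type, sum_task]
  simp only [State.current_shift]
  cases t <;> simp

theorem pathProb_nil (s : State m.k) : m.pathProb E s [] = 1 := by simp [pathProb]

theorem pathProb_nonneg (l : List Task) (s : State m.k) : 0 ≤ m.pathProb E s l := by
  induction l generalizing s with
  | nil => simp [pathProb_nil]
  | cons t l ih =>
    rw [pathProb_cons, stepOp_apply]
    refine Finset.sum_nonneg fun x _ => mul_nonneg (m.nextProb_nonneg E s x) ?_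
    split_ifs
    exacts [ih _, le_rfl]

theorem pathProb_cons_of_succ {s : State m.k} {t : Task} {l : List Task} {c : ℝ}
    (h : ∀ x, 0 < m.nextProb E s x →
      (s.shift x).current.1 = t ∧ m.pathProb E (s.shift x) l = c) :
    m.pathProb E s (t :: l) = c := by
  rw [pathProb_cons]
  refine m.stepOp_eq_const_of_succ E fun x hx => ?_
  rw [if_pos (h x hx).1, (h x hx).2]

theorem pathProb_succ_nonpos {s : State m.k} {t : Task} {l : List Task}
    (h : m.pathProb E s (t :: l) ≤ 0) {x : Period} (hx : 0 < m.nextProb E s x)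
    (ht : (s.shift x).current.1 = t) : m.pathProb E (s.shift x) l ≤ 0 := by
  rw [pathProb_cons, stepOp_apply] at h
  have h1 := Finset.single_le_sum (s := Finset.univ) (f := fun x => m.nextProb E s x *
      (if (s.shift x).current.1 = t then m.pathProb E (s.shift x) l else 0))
    (fun x _ => mul_nonneg (m.nextProb_nonneg E s x) (by
      split_ifs
      exacts [m.pathProb_nonneg E l _, le_rfl])) (Finset.mem_univ x)
  simp only [if_pos ht] at h1
  nlinarith

/-- The indicator of the states whose current task is the good one. -/
noncomputable def onGood (s : State m.k) : ℝ := if s.current.1 = Task.tG then 1 else 0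

end ReactiveAssignment

/-! ### The potential of a good-task cycle -/

/-- `κ` is the discounted number of future periods on the good task when, after each period on the
good task, the next one comes `N + 1` periods later with probability `θ`, and `N + 2` periods later
otherwise. -/
structure IsCycle (δ κ θ : ℝ) (N : ℕ) : Prop where
  δ_pos : 0 < δ
  δ_lt_one : δ < 1
  κ_pos : 0 < κ
  θ_pos : 0 < θ
  θ_le_one : θ ≤ 1
  eq : κ = (1 + κ) * (θ * δ ^ (N + 1) + (1 - θ) * δ ^ (N + 2))

/-- Every discounted number of future periods below `δ / (1 - δ)` is that of some cycle. -/
theorem exists_isCycle {δ κ : ℝ} (h0 : 0 < δ) (h1 : δ < 1) (hκ : 0 < κ) (hκ' : κ * (1 - δ) < δ) :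
    ∃ N θ, IsCycle δ κ θ N := by
  classical
  -- The cycle equation reads `κ = (1 + κ) ρ`, with `ρ` the expected discount factor until the
  -- return. Choosing `N` minimal puts `ρ` in `(δ ^ (N + 2), δ ^ (N + 1)]`, and `θ` interpolates
  -- between the endpoints.
  set ρ := κ / (1 + κ) with hρ
  have hρ0 : 0 < ρ := by positivity
  have hex : ∃ N : ℕ, δ ^ (N + 2) < ρ := by
    obtain ⟨N, hN⟩ := exists_pow_lt_of_lt_one hρ0 h1
    exact ⟨N, lt_of_le_of_lt (pow_le_pow_of_le_one h0.le h1.le (by omega)) hN⟩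
  set N := Nat.find hex with hNdef
  have hN : δ ^ (N + 2) < ρ := Nat.find_spec hex
  have hN' : ρ ≤ δ ^ (N + 1) := by
    rcases Nat.eq_zero_or_pos N with h | h
    -- Minimality says nothing when `N = 0`; the upper bound `ρ ≤ δ` then comes from `κ (1 - δ) <
    -- δ`.
    · rw [h, zero_add, pow_one, hρ, div_le_iff₀ (by linarith)]
      nlinarith
    · have := Nat.find_min hex (m := N - 1) (by omega)
      rw [not_lt] at this
      rwa [show N - 1 + 2 = N + 1 by omega] at this
  have hlt : δ ^ (N + 2) < δ ^ (N + 1) := hN.trans_le hN'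
  refine ⟨N, (ρ - δ ^ (N + 2)) / (δ ^ (N + 1) - δ ^ (N + 2)), h0, h1, hκ, ?_, ?_, ?_⟩
  · exact div_pos (by linarith) (by linarith)
  · rw [div_le_one (by linarith)]; linarith
  · have h2 : δ ^ (N + 1) - δ ^ (N + 2) ≠ 0 := by linarith
    have h3 : κ = (1 + κ) * ρ := by rw [hρ]; field_simp
    conv_lhs => rw [h3]
    congr 1
    field_simp
    ring

/-- The affine pieces of the potential. -/
noncomputable def line (δ : ℝ) (j : ℕ) (z : ℝ) : ℝ := -(j : ℝ) + (z / δ ^ j - 1) / (1 - δ)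

/-- A concave piecewise affine potential of the discounted number of periods on the good task. -/
noncomputable def potential (δ : ℝ) (N : ℕ) (z : ℝ) : ℝ :=
  (Finset.range (N + 1)).inf' ⟨0, by simp⟩ fun j => line δ j z

section Potential

variable {δ κ θ : ℝ} {N : ℕ}

theorem potential_le_line {j : ℕ} (hj : j ≤ N) (z : ℝ) : potential δ N z ≤ line δ j z :=
  Finset.inf'_le _ (by simp; omega)

theorem le_potential {z c : ℝ} (h : ∀ j ≤ N, c ≤ line δ j z) : c ≤ potential δ N z :=
  Finset.le_inf' _ _ fun j hj => h j (by simp at hj; omega)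

/-- The `j`th piece is the chord through `-j` at `δ ^ j` and `-(j + 1)` at `δ ^ (j + 1)`. A period
on the bad task divides `z` by `δ` in expectation and shortens the wait by one, which moves the
pieces down by one index. -/
theorem line_succ (j : ℕ) (z : ℝ) : line δ (j + 1) z + 1 = line δ j (z / δ) := by
  unfold line
  rw [pow_succ', div_div]
  push_cast; ring

theorem line_zero (z : ℝ) : line δ 0 z = (z - 1) / (1 - δ) := by simp [line]

theorem line_affine (j : ℕ) (z : ℝ) :
    line δ j z = (-(j : ℝ) - 1 / (1 - δ)) + (1 / δ ^ j / (1 - δ)) * z := by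
  unfold line; ring

theorem line_sub (j : ℕ) (z z' : ℝ) :
    line δ j z - line δ j z' = (z - z') / (δ ^ j * (1 - δ)) := by
  rw [line_affine, line_affine]
  rw [div_div]; ring

/-- Bernoulli's inequality for `1 / δ`. Since `line δ 0 1 = 0`, the potential vanishes at `1`. -/
theorem line_one_nonneg (h0 : 0 < δ) (h1 : δ < 1) (j : ℕ) : 0 ≤ line δ j 1 := by
  have h2 : 1 + (j : ℝ) * (1 / δ - 1) ≤ (1 / δ) ^ j := by
    have := one_add_mul_le_pow (a := 1 / δ - 1) (by
      have : 0 < 1 / δ := by positivity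
      linarith) j
    simpa using this
  have h3 : 1 - δ ≤ 1 / δ - 1 := by
    rw [le_sub_iff_add_le, le_div_iff₀ h0]; nlinarith [sq_nonneg (1 - δ)]
  have h4 : (j : ℝ) ≤ (1 / δ ^ j - 1) / (1 - δ) := by
    rw [le_div_iff₀ (by linarith), ← one_div_pow]
    nlinarith [(Nat.cast_nonneg j : (0 : ℝ) ≤ j)]
  unfold line; linarith

theorem line_zero_div_le (h0 : 0 < δ) (h1 : δ < 1) {z : ℝ} (hz : z ≤ δ) :
    line δ 0 (z / δ) ≤ line δ 0 z + 1 := by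
  have h2 : 0 < 1 - δ := by linarith
  rw [line_zero, line_zero, div_add_one h2.ne', div_le_div_iff_of_pos_right h2]
  have h3 : z / δ ≤ 1 := (div_le_one h0).2 hz
  have h4 : z = δ * (z / δ) := by field_simp
  nlinarith

/-- Drift inequality on the bad task. Piece `j + 1` is compared with piece `j` after the step; piece
`0` has no predecessor and needs `z ≤ δ`. -/
theorem potential_div_le (h0 : 0 < δ) (h1 : δ < 1) {z : ℝ} (hz : z ≤ δ) :
    potential δ N (z / δ) ≤ potential δ N z + 1 := by
  rw [← sub_le_iff_le_add]
  refine le_potential fun j hj => ?_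
  rw [sub_le_iff_le_add]
  cases j with
  | zero => exact (potential_le_line (Nat.zero_le _) _).trans (line_zero_div_le h0 h1 hz)
  | succ j => rw [line_succ]; exact potential_le_line (by omega) _

/-- Drift inequality on the good task, where `(z - 1 / (1 + κ)) / δ` is the expected next value. At
`z = 1` it is tight by the cycle equation. Below `1` the left side falls faster than any piece of
the potential, and the difference of slopes from piece `N` is exactly `1 / δ ^ (N + 1)`. Keeping
that slack term later forces `z = 1`. -/
theorem IsCycle.le_potential_good (h : IsCycle δ κ θ N) {z : ℝ} (hz : z ≤ 1) :
    (N + 2 - θ) + line δ N ((z - 1 / (1 + κ)) / δ) + (1 - z) / δ ^ (N + 1) ≤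
      potential δ N z + 1 := by
  have h0 := h.δ_pos
  have h1 := h.δ_lt_one
  have hκ := h.κ_pos
  have h2 : 0 < 1 - δ := by linarith
  rw [← sub_le_iff_le_add]
  refine le_potential fun j hj => ?_
  have e1 : (1 - 1 / (1 + κ)) / δ = θ * δ ^ N + (1 - θ) * δ ^ (N + 1) := by
    have : (1 - 1 / (1 + κ)) = θ * δ ^ (N + 1) + (1 - θ) * δ ^ (N + 2) := by
      have h3 : (1 - 1 / (1 + κ)) = κ / (1 + κ) := by field_simp; ring
      rw [h3, div_eq_iff (by linarith), mul_comm]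
      exact h.eq
    rw [this, div_eq_iff h0.ne']; ring
  have e2 : line δ N ((1 - 1 / (1 + κ)) / δ) = -(N : ℝ) - (1 - θ) := by
    rw [e1, line]
    have : (θ * δ ^ N + (1 - θ) * δ ^ (N + 1)) / δ ^ N = θ + (1 - θ) * δ := by
      rw [div_eq_iff (pow_pos h0 N).ne']; ring
    rw [this]
    field_simp
    ring
  have e3 := line_sub (δ := δ) N ((z - 1 / (1 + κ)) / δ) ((1 - 1 / (1 + κ)) / δ)
  have e4 := line_sub (δ := δ) j z 1
  have e5 := line_one_nonneg h0 h1 j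
  have e6 : ((z - 1 / (1 + κ)) / δ - (1 - 1 / (1 + κ)) / δ) / (δ ^ N * (1 - δ)) =
      -((1 - z) / δ ^ (N + 1) / (1 - δ)) := by
    field_simp; ring
  have e7 : (z - 1) / (δ ^ j * (1 - δ)) = -((1 - z) / δ ^ j / (1 - δ)) := by
    field_simp; ring
  have e8 : (1 - z) / δ ^ j ≤ (1 - z) / δ ^ N :=
    div_le_div_of_nonneg_left (by linarith) (pow_pos h0 N)
      (pow_le_pow_of_le_one h0.le h1.le hj)
  have e9 : (1 - z) / δ ^ N = δ * ((1 - z) / δ ^ (N + 1)) := by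
    rw [pow_succ']; field_simp
  have e10 : (1 - z) / δ ^ j / (1 - δ) ≤ δ * ((1 - z) / δ ^ (N + 1)) / (1 - δ) := by
    rw [← e9]; gcongr
  have e11 : (1 - z) / δ ^ (N + 1) / (1 - δ) - δ * ((1 - z) / δ ^ (N + 1)) / (1 - δ) =
      (1 - z) / δ ^ (N + 1) := by
    field_simp
  rw [e6] at e3
  rw [e7] at e4
  linarith

/-- Pieces `j` and `j + 1` cross at `δ ^ (j + 1)`. -/
theorem le_pow_of_potential_eq_line (h0 : 0 < δ) (h1 : δ < 1) {j : ℕ} (hj : j + 1 ≤ N) {z : ℝ}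
    (h : potential δ N z = line δ (j + 1) z) : z ≤ δ ^ (j + 1) := by
  have h2 : line δ (j + 1) z ≤ line δ j z := h ▸ potential_le_line (by omega) z
  have h3 : 0 < 1 - δ := by linarith
  unfold line at h2
  push_cast at h2
  have h4 : (z / δ ^ (j + 1) - 1) / (1 - δ) - (z / δ ^ j - 1) / (1 - δ) = z / δ ^ (j + 1) := by
    field_simp; ring
  rw [← div_le_one (pow_pos h0 _)]
  linarith

end Potential

/-! ### Assignments with the largest share on the good task -/

section Extremal

variable {n : ℕ} {E : Environment n} {m : ReactiveAssignment} {μ : State m.k → ℝ}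
variable {κ θ : ℝ} {N : ℕ} {w : State m.k → ℝ}

open ReactiveAssignment

/-- In the extremal case the potential is a martingale up to the drift. -/
theorem potential_step_eq (hc : IsCycle E.δ κ θ N) (hμ : m.IsSteadyState E μ)
    (hw : ∀ s, w s = m.onGood s / (1 + κ) + E.δ * m.stepOp E w s)
    (hw1 : ∀ s, 0 < μ s → w s ≤ 1)
    (hshare : 1 ≤ (N + 2 - θ) * ∑ s, μ s * m.onGood s) {s : State m.k} (hs : 0 < μ s) :
    potential E.δ N (w s) + 1 =
      (N + 2 - θ) * m.onGood s + m.stepOp E (fun s' => potential E.δ N (w s')) s := by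
  have h0 := hc.δ_pos
  have h1 := hc.δ_lt_one
  set P : State m.k → ℝ := fun s' => potential E.δ N (w s') with hP
  -- Jensen's inequality for the concave potential, one affine piece at a time.
  have hline : ∀ j ≤ N, ∀ s, m.stepOp E P s ≤ line E.δ j (m.stepOp E w s) := by
    intro j hj s
    rw [line_affine, ← stepOp_affine]
    refine m.stepOp_mono E (fun s' => ?_) s
    rw [← line_affine]
    exact potential_le_line hj _
  have hslack : ∀ s, 0 < μ s → (N + 2 - θ) * m.onGood s + m.stepOp E P s ≤ P s + 1 := by
    intro s hs
    have hws := hw s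
    by_cases hg : s.current.1 = Task.tG
    · have h2 := hc.le_potential_good (hw1 s hs)
      simp only [onGood, if_pos hg] at hws ⊢
      have h3 : (w s - 1 / (1 + κ)) / E.δ = m.stepOp E w s := by
        rw [div_eq_iff h0.ne']; linarith
      rw [h3] at h2
      have h4 := hline N le_rfl s
      have h5 : 0 ≤ (1 - w s) / E.δ ^ (N + 1) :=
        div_nonneg (by linarith [hw1 s hs]) (pow_pos h0 _).le
      simp only [hP]
      linarith
    · simp only [onGood, if_neg hg, zero_div, zero_add] at hws ⊢
      have h3 : w s / E.δ = m.stepOp E w s := by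
        rw [div_eq_iff h0.ne']; linarith
      have hle : m.stepOp E w s ≤ 1 := by
        have := m.stepOp_le_of_succ E (f := w) (g := fun _ => 1) (s := s)
          fun x hx => hw1 _ (hμ.pos_shift hs hx)
        rwa [stepOp_const] at this
      have h4 : m.stepOp E P s ≤ potential E.δ N (w s / E.δ) := by
        rw [h3]; exact le_potential fun j hj => hline j hj s
      have := potential_div_le (N := N) h0 h1 (z := w s) (by nlinarith)
      simp only [hP]
      linarith
  have hnn : ∀ s ∈ Finset.univ, 0 ≤ μ s *
      (P s + 1 - ((N + 2 - θ) * m.onGood s + m.stepOp E P s)) := by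
    intro s _
    rcases (hμ.nonneg s).eq_or_lt with h | h
    · rw [← h]; simp
    · exact mul_nonneg h.le (by linarith [hslack s h])
  -- Under the steady state the potential terms cancel. The total slack is then nonpositive by
  -- `hshare`, while each slack is nonnegative, so all vanish.
  have hsum : ∑ s, μ s * (P s + 1 - ((N + 2 - θ) * m.onGood s + m.stepOp E P s)) =
      1 - (N + 2 - θ) * ∑ s, μ s * m.onGood s := by
    have e : ∀ s, μ s * (P s + 1 - ((N + 2 - θ) * m.onGood s + m.stepOp E P s)) =
        μ s * P s + μ s - (N + 2 - θ) * (μ s * m.onGood s) - μ s * m.stepOp E P s := by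
      intro s; ring
    simp_rw [e]
    rw [Finset.sum_sub_distrib, Finset.sum_sub_distrib, Finset.sum_add_distrib,
      hμ.sum_mul_stepOp, hμ.sum_eq_one, ← Finset.mul_sum]
    ring
  have hzero := (Finset.sum_eq_zero_iff_of_nonneg hnn).1
    (le_antisymm (by rw [hsum]; linarith) (Finset.sum_nonneg hnn)) s (Finset.mem_univ s)
  rcases mul_eq_zero.1 hzero with h | h
  · exact absurd h hs.ne'
  · simp only [hP] at h ⊢; linarith

/-- No drift slack remains: the term in `1 - w s` must vanish, and equality in Jensen's inequality
for piece `N` puts all successors where that piece is active. -/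
theorem extremal_good (hc : IsCycle E.δ κ θ N) (hμ : m.IsSteadyState E μ)
    (hw : ∀ s, w s = m.onGood s / (1 + κ) + E.δ * m.stepOp E w s)
    (hw1 : ∀ s, 0 < μ s → w s ≤ 1)
    (hshare : 1 ≤ (N + 2 - θ) * ∑ s, μ s * m.onGood s) {s : State m.k} (hs : 0 < μ s)
    (hg : s.current.1 = Task.tG) :
    w s = 1 ∧ ∀ x, 0 < m.nextProb E s x →
      potential E.δ N (w (s.shift x)) = line E.δ N (w (s.shift x)) := by
  have h0 := hc.δ_pos
  have h1 := hc.δ_lt_one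
  have hstep := potential_step_eq hc hμ hw hw1 hshare hs
  have hws := hw s
  have h2 := hc.le_potential_good (hw1 s hs)
  simp only [onGood, if_pos hg] at hws hstep
  have h3 : (w s - 1 / (1 + κ)) / E.δ = m.stepOp E w s := by
    rw [div_eq_iff h0.ne']; linarith
  rw [h3, line_affine, ← stepOp_affine] at h2
  have h4 : (fun s' => potential E.δ N (w s')) ≤
      fun s' => -(N : ℝ) - 1 / (1 - E.δ) + 1 / E.δ ^ N / (1 - E.δ) * w s' := fun s' => by
    beta_reduce
    rw [← line_affine]; exact potential_le_line le_rfl _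
  have h5 := m.stepOp_mono E h4 s
  have h6 : 0 ≤ (1 - w s) / E.δ ^ (N + 1) :=
    div_nonneg (by linarith [hw1 s hs]) (pow_pos h0 _).le
  have h7 : (1 - w s) / E.δ ^ (N + 1) = 0 := by linarith
  refine ⟨?_, fun x hx => ?_⟩
  · rcases div_eq_zero_iff.1 h7 with h | h
    · linarith
    · exact absurd h (pow_pos h0 _).ne'
  · have := m.eq_of_stepOp_eq E h4 (s := s) (by linarith) hx
    rw [this, line_affine]

/-- Equality in Jensen's inequality hands an active piece `j + 1` down to piece `j` at all
successors. With piece `0` active, the mean of `w` over the successors is its upper bound `1`, so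
each successor has `w = 1`. -/
theorem extremal_bad (hc : IsCycle E.δ κ θ N) (hμ : m.IsSteadyState E μ)
    (hw : ∀ s, w s = m.onGood s / (1 + κ) + E.δ * m.stepOp E w s)
    (hw1 : ∀ s, 0 < μ s → w s ≤ 1)
    (hshare : 1 ≤ (N + 2 - θ) * ∑ s, μ s * m.onGood s) {s : State m.k} (hs : 0 < μ s)
    (hb : s.current.1 ≠ Task.tG) :
    w s = E.δ * m.stepOp E w s ∧ w s ≤ E.δ ∧
    (∀ j, j + 1 ≤ N → potential E.δ N (w s) = line E.δ (j + 1) (w s) →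
      ∀ x, 0 < m.nextProb E s x →
        potential E.δ N (w (s.shift x)) = line E.δ j (w (s.shift x))) ∧
    (potential E.δ N (w s) = line E.δ 0 (w s) →
      w s = E.δ ∧ ∀ x, 0 < m.nextProb E s x → w (s.shift x) = 1) := by
  have h0 := hc.δ_pos
  have h1 := hc.δ_lt_one
  have hstep := potential_step_eq hc hμ hw hw1 hshare hs
  have hws := hw s
  simp only [onGood, if_neg hb, zero_div, zero_add, mul_zero] at hws hstep
  have h3 : w s / E.δ = m.stepOp E w s := by
    rw [div_eq_iff h0.ne']; linarith
  have hle : m.stepOp E w s ≤ 1 := by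
    have := m.stepOp_le_of_succ E (f := w) (g := fun _ => 1) (s := s)
      fun x hx => hw1 _ (hμ.pos_shift hs hx)
    rwa [stepOp_const] at this
  have hline : ∀ j ≤ N, (fun s' => potential E.δ N (w s')) ≤
      fun s' => -(j : ℝ) - 1 / (1 - E.δ) + 1 / E.δ ^ j / (1 - E.δ) * w s' := fun j hj s' => by
    beta_reduce
    rw [← line_affine]; exact potential_le_line hj _
  refine ⟨hws, by nlinarith, fun j hj hpot x hx => ?_, fun hpot => ?_⟩
  · rw [hpot, line_succ, h3, line_affine, ← stepOp_affine] at hstep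
    have := m.eq_of_stepOp_eq E (hline j (by omega)) hstep.le hx
    rw [this, line_affine]
  · have h4 := m.stepOp_mono E (hline 0 (Nat.zero_le _)) s
    rw [stepOp_affine, ← line_affine, line_zero] at h4
    rw [hpot, line_zero] at hstep
    have h5 : 0 < 1 - E.δ := by linarith
    have h6 : (w s - 1) / (1 - E.δ) + 1 ≤ (m.stepOp E w s - 1) / (1 - E.δ) := by linarith
    rw [div_add_one h5.ne', div_le_div_iff_of_pos_right h5] at h6
    have h7 : m.stepOp E w s = 1 := by nlinarith
    refine ⟨by rw [hws, h7, mul_one], fun x hx => ?_⟩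
    have h8 : ∀ x ∈ Finset.univ, m.nextProb E s x * w (s.shift x) ≤ m.nextProb E s x := by
      intro x _
      rcases (m.nextProb_nonneg E s x).eq_or_lt with h | h
      · rw [← h]; simp
      · have := hw1 _ (hμ.pos_shift hs h)
        nlinarith
    have h9 := (Finset.sum_eq_sum_iff_of_le h8).1 (by
      rw [sum_nextProb]; exact h7) x (Finset.mem_univ x)
    exact mul_left_cancel₀ hx.ne' (h9.trans (mul_one _).symm)

/-- The active piece acts as a countdown. At a positive index `w < 1`, so the task is bad and the
index drops by one. At index `0` the task is good, or it is bad with `w = δ` and the good task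
follows for sure. The last clause computes the mean of `w` when the early return never happens, in
order to exclude that case. -/
theorem extremal_path (hc : IsCycle E.δ κ θ N) (hμ : m.IsSteadyState E μ)
    (hw : ∀ s, w s = m.onGood s / (1 + κ) + E.δ * m.stepOp E w s)
    (hw1 : ∀ s, 0 < μ s → w s ≤ 1)
    (hshare : 1 ≤ (N + 2 - θ) * ∑ s, μ s * m.onGood s) (j : ℕ) (hj : j ≤ N) :
    ∀ s, 0 < μ s → (∀ x, 0 < m.nextProb E s x →
      potential E.δ N (w (s.shift x)) = line E.δ j (w (s.shift x))) →
    m.pathProb E s (List.replicate j .tB) = 1 ∧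
    m.pathProb E s (List.replicate (j + 1) .tB ++ [.tG]) =
      m.pathProb E s (List.replicate (j + 1) .tB) ∧
    (m.pathProb E s (List.replicate j .tB ++ [.tG]) ≤ 0 →
      m.stepOp E w s = E.δ ^ (j + 1)) := by
  have h0 := hc.δ_pos
  have h1 := hc.δ_lt_one
  -- On the bad task `w ≤ δ < 1`.
  have hgood : ∀ s, 0 < μ s → w s = 1 → s.current.1 = Task.tG := by
    intro s hs h
    by_contra hb
    have := (extremal_bad hc hμ hw hw1 hshare hs hb).2.1
    linarith
  induction j with
  | zero =>
    intro s hs hA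
    have hnext : ∀ x, 0 < m.nextProb E s x → (s.shift x).current.1 ≠ Task.tG →
        w (s.shift x) = E.δ ∧ m.pathProb E (s.shift x) [.tG] = 1 := by
      intro x hx hb
      have hsx := hμ.pos_shift hs hx
      obtain ⟨h2, h3⟩ := (extremal_bad hc hμ hw hw1 hshare hsx hb).2.2.2 (hA x hx)
      refine ⟨h2, m.pathProb_cons_of_succ E fun x' hx' => ⟨?_, m.pathProb_nil E _⟩⟩
      exact hgood _ (hμ.pos_shift hsx hx') (h3 x' hx')
    refine ⟨by simp [pathProb_nil], ?_, fun hp => ?_⟩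
    · simp only [zero_add, List.replicate_one, List.cons_append, List.nil_append]
      rw [pathProb_cons, pathProb_cons E m s .tB []]
      refine m.stepOp_congr_of_succ E fun x hx => ?_
      split_ifs with h
      · rw [(hnext x hx (by rw [h]; decide)).2, pathProb_nil]
      · rfl
    · rw [zero_add, pow_one]
      refine m.stepOp_eq_const_of_succ E fun x hx => (hnext x hx fun hg => ?_).1
      have := m.pathProb_succ_nonpos E (by simpa using hp) hx hg
      rw [pathProb_nil] at this
      linarith
  | succ j ih =>
    intro s hs hA
    have hbad : ∀ x, 0 < m.nextProb E s x → (s.shift x).current.1 ≠ Task.tG := by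
      intro x hx hg
      have h2 := le_pow_of_potential_eq_line h0 h1 hj (hA x hx)
      have h3 := (extremal_good hc hμ hw hw1 hshare (hμ.pos_shift hs hx) hg).1
      have h4 := pow_lt_one₀ h0.le h1 (n := j + 1) (Nat.succ_ne_zero j)
      linarith
    have hrec := fun x hx => ih (by omega) _ (hμ.pos_shift hs hx)
      ((extremal_bad hc hμ hw hw1 hshare (hμ.pos_shift hs hx) (hbad x hx)).2.2.1 j hj (hA x hx))
    have htB := fun x hx => Task.eq_tB_of_ne (hbad x hx)
    refine ⟨?_, ?_, fun hp => ?_⟩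
    · rw [List.replicate_succ]
      exact m.pathProb_cons_of_succ E fun x hx => ⟨htB x hx, (hrec x hx).1⟩
    · rw [List.replicate_succ, List.cons_append, pathProb_cons,
        pathProb_cons E m s .tB (List.replicate (j + 1) .tB)]
      refine m.stepOp_congr_of_succ E fun x hx => ?_
      rw [if_pos (htB x hx), if_pos (htB x hx), (hrec x hx).2.1]
    · rw [List.replicate_succ, List.cons_append] at hp
      refine m.stepOp_eq_const_of_succ E fun x hx => ?_
      rw [(extremal_bad hc hμ hw hw1 hshare (hμ.pos_shift hs hx) (hbad x hx)).1,
        (hrec x hx).2.2 (m.pathProb_succ_nonpos E hp hx (htB x hx))]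
      ring

/-- If the discounted number of good periods is at most that of a cycle whenever the team is on the
good task, but the share of the good task is at least that of the cycle, then the team follows the
cycle. -/
theorem extremal_cycle (hc : IsCycle E.δ κ θ N) (hμ : m.IsSteadyState E μ)
    (hw : ∀ s, w s = m.onGood s / (1 + κ) + E.δ * m.stepOp E w s)
    (hw1 : ∀ s, 0 < μ s → w s ≤ 1)
    (hshare : 1 ≤ (N + 2 - θ) * ∑ s, μ s * m.onGood s) {s : State m.k} (hs : 0 < μ s)
    (hg : s.current.1 = Task.tG) :
    w s = 1 ∧ m.pathProb E s (List.replicate N .tB) = 1 ∧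
    0 < m.pathProb E s (List.replicate N .tB ++ [.tG]) ∧
    m.pathProb E s (List.replicate (N + 1) .tB ++ [.tG]) =
      m.pathProb E s (List.replicate (N + 1) .tB) := by
  obtain ⟨h1, h2⟩ := extremal_good hc hμ hw hw1 hshare hs hg
  obtain ⟨h3, h4, h5⟩ := extremal_path hc hμ hw hw1 hshare N le_rfl s hs h2
  refine ⟨h1, h3, ?_, h4⟩
  -- Without an early return, `w s = 1` gives `1 + κ = 1 + (1 + κ) δ ^ (N + 2)`, the cycle equation
  -- for `θ = 0`; this contradicts `0 < θ`.
  by_contra! hp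
  have h6 := hw s
  rw [h1, h5 hp, onGood, if_pos hg] at h6
  have hκ := hc.κ_pos
  have h7 : 1 + κ = 1 + (1 + κ) * E.δ ^ (N + 2) := by
    have h7 : (1 + κ) * 1 = (1 + κ) * (1 / (1 + κ) + E.δ * E.δ ^ (N + 1)) := by rw [← h6]
    rw [mul_one, mul_add, mul_one_div_cancel (by linarith)] at h7
    rw [pow_succ' E.δ (N + 1)]; exact h7
  have h8 : 0 < E.δ ^ (N + 1) := pow_pos hc.δ_pos _
  have h9 : E.δ ^ (N + 2) = E.δ * E.δ ^ (N + 1) := by ring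
  have h10 := hc.eq
  have h11 := hc.θ_pos
  have h12 := hc.δ_lt_one
  have h13 : (1 + κ) * (θ * (E.δ ^ (N + 1) - E.δ ^ (N + 2))) = 0 := by linarith
  have h14 : 0 < (1 + κ) * (θ * (E.δ ^ (N + 1) - E.δ ^ (N + 2))) := by
    have : 0 < E.δ ^ (N + 1) - E.δ ^ (N + 2) := by rw [h9]; nlinarith
    positivity
  linarith

end Extremal

/-! ### Stage games -/

@[simp] theorem allC_apply {n : ℕ} (i : Fin n) : allC n i = .C := rfl

@[simp] theorem allN_apply {n : ℕ} (i : Fin n) : allN n i = .N := rfl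

theorem update_allC_self {n : ℕ} (i : Fin n) : Function.update (allC n) i .C = allC n :=
  Function.update_eq_self i (allC n)

theorem update_allN_self {n : ℕ} (i : Fin n) : Function.update (allN n) i .N = allN n :=
  Function.update_eq_self i (allN n)

/-- By dominance both maxima in `minmax` are attained at `N`. Hence never cooperating secures the
payoff of complete non-cooperation. -/
theorem IsStageGame.payoff_allN_le {n : ℕ} {π : Profile n → Fin n → ℝ} (h : IsStageGame π)
    {a : Profile n} {i : Fin n} (ha : a i = .N) : π (allN n) i ≤ π a i := by
  have h1 := h.minmax a i
  rw [max_eq_right (h.dominant _ _).le, max_eq_right (h.dominant _ _).le, update_allN_self,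
    ← ha, Function.update_eq_self] at h1
  exact h1

theorem IsStageGame.sum_le {n : ℕ} {π : Profile n → Fin n → ℝ} (h : IsStageGame π)
    (a : Profile n) : ∑ i, π a i ≤ ∑ i, π (allC n) i := by
  by_cases ha : a = allC n
  · rw [ha]
  · exact (h.coop_max a ha).le

namespace Environment

variable {n : ℕ} (E : Environment n)

theorem payoff_allC_eq (g : Game) (i : Fin n) :
    E.payoff g (allC n) i = E.payoff g (allC n) E.player := by
  have := (E.isStageGame g).symmetric (Equiv.swap i E.player) (allC n) i
  rwa [Equiv.swap_apply_left] at this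

theorem payoff_allN_eq (g : Game) (i : Fin n) :
    E.payoff g (allN n) i = E.payoff g (allN n) E.player := by
  have := (E.isStageGame g).symmetric (Equiv.swap i E.player) (allN n) i
  rwa [Equiv.swap_apply_left] at this

theorem payoff_deviate_eq (g : Game) (i : Fin n) :
    E.payoff g (Function.update (allC n) i .N) i =
      E.payoff g (Function.update (allC n) E.player .N) E.player := by
  have := (E.isStageGame g).symmetric (Equiv.swap i E.player)
    (Function.update (allC n) E.player .N) i
  rw [Equiv.swap_apply_left] at this
  rw [← this]
  congr 1
  funext j
  by_cases hj : j = i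
  · subst hj; simp
  · have : Equiv.swap i E.player j ≠ E.player := by
      intro h
      exact hj ((Equiv.swap i E.player).injective (h.trans (Equiv.swap_apply_left i E.player).symm))
    simp [Function.update_of_ne hj, Function.update_of_ne this]

theorem payoff_allC_sub (g : Game) (i : Fin n) :
    E.payoff g (allC n) i - E.payoff g (allN n) i = E.c g := by
  rw [payoff_allC_eq, payoff_allN_eq, c]

theorem payoff_deviate (g : Game) (i : Fin n) :
    E.payoff g (Function.update (allC n) i .N) i = E.payoff g (allC n) i + E.d g := by
  rw [payoff_allC_eq, payoff_deviate_eq, d]; ring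

theorem allN_ne_allC (E : Environment n) : allN n ≠ allC n := fun h => by
  have := congrFun h E.player
  simp at this

theorem c_pos (g : Game) : 0 < E.c g := by
  have h := (E.isStageGame g).coop_max _ E.allN_ne_allC
  rw [← sub_pos, ← Finset.sum_sub_distrib] at h
  simp only [payoff_allC_sub, Finset.sum_const, nsmul_eq_mul] at h
  exact pos_of_mul_pos_right h (Nat.cast_nonneg _)

theorem d_pos (g : Game) : 0 < E.d g := by
  have h := (E.isStageGame g).dominant (allC n) E.player
  rw [update_allC_self] at h
  exact sub_pos.2 h

/-- The gain per player from complete cooperation when `o` happens. -/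
noncomputable def benefit : Option Game → ℝ
  | none => 0
  | some g => E.c g

theorem benefit_nonneg (o : Option Game) : 0 ≤ E.benefit o := by
  cases o with
  | none => exact le_rfl
  | some g => exact (E.c_pos g).le

theorem stagePayoff_allC_sub (o : Option Game) (i : Fin n) :
    E.stagePayoff o (allC n) i - E.stagePayoff o (allN n) i = E.benefit o := by
  cases o with
  | none => simp [stagePayoff, benefit]
  | some g => exact E.payoff_allC_sub g i

theorem stagePayoff_allN_le (o : Option Game) {a : Profile n} {i : Fin n} (ha : a i = .N) :
    E.stagePayoff o (allN n) i ≤ E.stagePayoff o a i := by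
  cases o with
  | none => exact le_rfl
  | some g => exact (E.isStageGame g).payoff_allN_le ha

theorem sum_stagePayoff_le (o : Option Game) (a : Profile n) :
    ∑ i, E.stagePayoff o a i ≤ ∑ i, E.stagePayoff o (allC n) i := by
  cases o with
  | none => exact le_rfl
  | some g => exact (E.isStageGame g).sum_le a

theorem exists_abs_stagePayoff_le : ∃ M, ∀ o a i, |E.stagePayoff o a i| ≤ M :=
  ⟨∑ p : Option Game × Profile n × Fin n, |E.stagePayoff p.1 p.2.1 p.2.2|, fun o a i =>
    Finset.single_le_sum
      (f := fun p : Option Game × Profile n × Fin n => |E.stagePayoff p.1 p.2.1 p.2.2|)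
      (fun _ _ => abs_nonneg _) (Finset.mem_univ (o, a, i))⟩

end Environment

/-! ### Behavior at a history -/

section PlayProb

variable {n k : ℕ}

theorem playProb_nonneg (σ : StrategyProfile n k) (h : History n k) (a : Profile n) :
    0 ≤ playProb σ h a := by
  unfold playProb
  split
  · split_ifs <;> norm_num
  · refine Finset.prod_nonneg fun i _ => ?_
    split_ifs
    · exact (σ i h).2.1
    · exact sub_nonneg.2 (σ i h).2.2

theorem playProb_none {σ : StrategyProfile n k} {h : History n k} (hg : h.game = none)
    (a : Profile n) : playProb σ h a = if a = allN n then 1 else 0 := by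
  unfold playProb; rw [hg]

theorem playProb_game {σ : StrategyProfile n k} {h : History n k} (hg : h.game ≠ none)
    (a : Profile n) :
    playProb σ h a = ∏ i, if a i = Action.C then (σ i h : ℝ) else 1 - (σ i h : ℝ) := by
  unfold playProb
  split
  · exact absurd ‹_› hg
  · rfl

theorem sum_playProb (σ : StrategyProfile n k) (h : History n k) :
    ∑ a, playProb σ h a = 1 := by
  by_cases hg : h.game = none
  · simp [playProb_none hg]
  · simp_rw [playProb_game hg]
    have := Finset.prod_univ_sum (fun _ : Fin n => (Finset.univ : Finset Action))
      (fun i x => if x = Action.C then (σ i h : ℝ) else 1 - (σ i h : ℝ))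
    rw [Fintype.piFinset_univ] at this
    rw [← this]
    refine Finset.prod_eq_one fun i _ => ?_
    change ∑ x ∈ ({Action.C, Action.N} : Finset Action), _ = _
    rw [Finset.sum_pair (by decide)]
    simp

theorem eq_allN_of_playProb_pos {σ : StrategyProfile n k} {h : History n k} {a : Profile n}
    (ha : 0 < playProb σ h a) (hg : h.game = none) : a = allN n := by
  rw [playProb_none hg] at ha
  by_contra hne
  simp [hne] at ha

theorem eq_N_of_playProb_pos {σ : StrategyProfile n k} {h : History n k} {a : Profile n}
    (ha : 0 < playProb σ h a) {i : Fin n} (hi : (σ i h : ℝ) = 0) : a i = .N := by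
  by_cases hg : h.game = none
  · rw [eq_allN_of_playProb_pos ha hg]; rfl
  · rw [playProb_game hg] at ha
    by_contra hC
    have hC' : a i = .C := by cases hx : a i <;> simp_all
    exact ha.ne' (Finset.prod_eq_zero (Finset.mem_univ i) (by simp [hC', hi]))

theorem sum_playProb_none {σ : StrategyProfile n k} {h : History n k} (hg : h.game = none)
    (F : Profile n → ℝ) : ∑ a, playProb σ h a * F a = F (allN n) := by
  simp [playProb_none hg]

/-- When the others play pure actions `b`, only the two profiles differing in the action of `i` can
occur. -/
theorem sum_playProb_of_others {σ : StrategyProfile n k} {h : History n k} (hg : h.game ≠ none)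
    {b : Profile n} {i : Fin n}
    (hσ : ∀ j ≠ i, (σ j h : ℝ) = if b j = .C then 1 else 0) (F : Profile n → ℝ) :
    ∑ a, playProb σ h a * F a = (σ i h : ℝ) * F (Function.update b i .C) +
      (1 - (σ i h : ℝ)) * F (Function.update b i .N) := by
  have hne : Function.update b i Action.C ≠ Function.update b i .N := fun h' => by
    simpa using congrFun h' i
  have hval : ∀ x : Action, playProb σ h (Function.update b i x) =
      if x = .C then (σ i h : ℝ) else 1 - (σ i h : ℝ) := by
    intro x
    rw [playProb_game hg, Finset.prod_eq_single i]
    · simp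
    · intro j _ hj
      rw [Function.update_of_ne hj, hσ j hj]
      split_ifs <;> simp
    · simp
  have hzero : ∀ a, a ∉ ({Function.update b i .C, Function.update b i .N} : Finset (Profile n)) →
      playProb σ h a * F a = 0 := by
    intro a ha
    obtain ⟨j, hj, hja⟩ : ∃ j ≠ i, a j ≠ b j := by
      by_contra! hall
      have : a = Function.update b i (a i) := by
        funext j
        by_cases hj : j = i
        · subst hj; simp
        · rw [Function.update_of_ne hj, hall j hj]
      rw [this] at ha
      cases hx : a i <;> simp [hx] at ha
    rw [playProb_game hg, Finset.prod_eq_zero (Finset.mem_univ j), zero_mul]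
    rw [hσ j hj]
    cases hx : a j <;> cases hy : b j <;> simp_all
  rw [← Finset.sum_subset (Finset.subset_univ
    ({Function.update b i .C, Function.update b i .N} : Finset (Profile n)))
    (fun a _ ha => hzero a ha), Finset.sum_pair hne, hval, hval]
  simp

theorem sum_playProb_allC {σ : StrategyProfile n k} {h : History n k} (hg : h.game ≠ none)
    (i : Fin n) (hσ : ∀ j, (σ j h : ℝ) = 1) (F : Profile n → ℝ) :
    ∑ a, playProb σ h a * F a = F (allC n) := by
  rw [sum_playProb_of_others hg (b := allC n) (i := i) (fun j _ => by simp [hσ j]), hσ i,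
    update_allC_self]
  ring

theorem sum_playProb_le {σ : StrategyProfile n k} {h : History n k} {F G : Profile n → ℝ}
    (hFG : ∀ a, 0 < playProb σ h a → F a ≤ G a) :
    ∑ a, playProb σ h a * F a ≤ ∑ a, playProb σ h a * G a := by
  refine Finset.sum_le_sum fun a _ => ?_
  rcases (playProb_nonneg σ h a).eq_or_lt with h0 | h0
  · rw [← h0]; simp
  · exact mul_le_mul_of_nonneg_left (hFG a h0) h0.le

theorem sum_playProb_const (σ : StrategyProfile n k) (h : History n k) (c : ℝ) :
    ∑ a, playProb σ h a * c = c := by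
  rw [← Finset.sum_mul, sum_playProb, one_mul]

end PlayProb

/-! ### Continuation payoffs -/

section Continuation

variable {n : ℕ} (E : Environment n) (m : ReactiveAssignment)

theorem abs_sum_mul_le {ι : Type*} [Fintype ι] {p f : ι → ℝ} {M : ℝ} (hp : ∀ x, 0 ≤ p x)
    (hsum : ∑ x, p x = 1) (hf : ∀ x, |f x| ≤ M) : |∑ x, p x * f x| ≤ M := by
  refine (Finset.abs_sum_le_sum_abs _ _).trans ?_
  calc ∑ x, |p x * f x| ≤ ∑ x, p x * M := Finset.sum_le_sum fun x _ => by
        rw [abs_mul, abs_of_nonneg (hp x)]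
        exact mul_le_mul_of_nonneg_left (hf x) (hp x)
    _ = M := by rw [← Finset.sum_mul, hsum, one_mul]

theorem abs_expectedStage_le {M : ℝ} (hM : ∀ o a i, |E.stagePayoff o a i| ≤ M)
    (σ : StrategyProfile n m.k) (i : Fin n) (j : ℕ) (h : History n m.k) :
    |expectedStage E m σ i j h| ≤ M := by
  induction j generalizing h with
  | zero => exact abs_sum_mul_le (playProb_nonneg σ h) (sum_playProb σ h) fun a => hM _ _ _
  | succ j ih =>
    exact abs_sum_mul_le (playProb_nonneg σ h) (sum_playProb σ h) fun a =>
      abs_sum_mul_le (m.nextProb_nonneg E _) (m.sum_nextProb E _) fun x => ih _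

variable {r : ℝ}

theorem discount_nonneg (hr : r ∈ Set.Icc (0 : ℝ) 1) : 0 ≤ (1 - r) * E.δ :=
  mul_nonneg (sub_nonneg.2 hr.2) E.δ_pos.le

theorem discount_lt_one (hr : r ∈ Set.Icc (0 : ℝ) 1) : (1 - r) * E.δ < 1 := by
  nlinarith [hr.1, E.δ_pos, E.δ_lt_one]

theorem summable_expectedStage (hr : r ∈ Set.Icc (0 : ℝ) 1) (σ : StrategyProfile n m.k)
    (i : Fin n) (h : History n m.k) :
    Summable fun j : ℕ => ((1 - r) * E.δ) ^ j * expectedStage E m σ i j h := by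
  obtain ⟨M, hM⟩ := E.exists_abs_stagePayoff_le
  exact summable_discount (discount_nonneg E hr) (discount_lt_one E hr)
    fun j => abs_expectedStage_le E m hM σ i j h

theorem exists_abs_continuationPayoff_le (hr : r ∈ Set.Icc (0 : ℝ) 1)
    (σ : StrategyProfile n m.k) (i : Fin n) :
    ∃ M, ∀ h, |continuationPayoff E m r σ h i| ≤ M := by
  obtain ⟨M, hM⟩ := E.exists_abs_stagePayoff_le
  have h0 := discount_nonneg E hr
  have h1 := discount_lt_one E hr
  refine ⟨(1 - (1 - r) * E.δ)⁻¹ * M, fun h => ?_⟩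
  rw [← Real.norm_eq_abs]
  refine tsum_of_norm_bounded ((hasSum_geometric_of_lt_one h0 h1).mul_right M) fun j => ?_
  rw [Real.norm_eq_abs, abs_mul, abs_of_nonneg (pow_nonneg h0 j)]
  exact mul_le_mul_of_nonneg_left (abs_expectedStage_le E m hM σ i j h) (pow_nonneg h0 j)

theorem continuationPayoff_eq (hr : r ∈ Set.Icc (0 : ℝ) 1) (σ : StrategyProfile n m.k)
    (h : History n m.k) (i : Fin n) :
    continuationPayoff E m r σ h i = ∑ a, playProb σ h a * (E.stagePayoff h.game a i +
      (1 - r) * E.δ * ∑ x, m.nextProb E h.state x *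
        continuationPayoff E m r σ (h.next a x) i) := by
  set β := (1 - r) * E.δ with hβ
  have hsum := summable_expectedStage E m hr σ i
  rw [continuationPayoff, (hsum h).tsum_eq_zero_add]
  simp only [mul_add, Finset.sum_add_distrib, pow_zero, one_mul]
  congr 1
  simp only [continuationPayoff]
  simp_rw [← tsum_mul_left]
  have h1 : ∀ a, ∑ x, ∑' j : ℕ, m.nextProb E h.state x *
      (β ^ j * expectedStage E m σ i j (h.next a x)) =
      ∑' j : ℕ, ∑ x, m.nextProb E h.state x *
        (β ^ j * expectedStage E m σ i j (h.next a x)) := fun a =>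
    (Summable.tsum_finsetSum fun x _ => (hsum (h.next a x)).mul_left _).symm
  have h2 : ∀ a, Summable fun j : ℕ => ∑ x, m.nextProb E h.state x *
        (β ^ j * expectedStage E m σ i j (h.next a x)) := fun a =>
    summable_sum fun x _ => (hsum (h.next a x)).mul_left _
  simp_rw [← hβ, h1, ← tsum_mul_left]
  rw [← Summable.tsum_finsetSum fun a _ => ((h2 a).mul_left _).mul_left _]
  refine tsum_congr fun j => ?_
  rw [expectedStage, Finset.mul_sum]
  refine Finset.sum_congr rfl fun a _ => ?_
  simp only [Finset.mul_sum]
  exact Finset.sum_congr rfl fun x _ => by ring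

/-- The maximum principle for play on a set of histories that is never left. -/
theorem nonpos_of_le_expectation {β : ℝ} (h0 : 0 ≤ β) (h1 : β < 1) {σ : StrategyProfile n m.k}
    {H : History n m.k → Prop}
    (hH : ∀ h a x, H h → 0 < playProb σ h a → 0 < m.nextProb E h.state x → H (h.next a x))
    {u : History n m.k → ℝ} {M : ℝ} (hM : ∀ h, u h ≤ M)
    (hu : ∀ h, H h → u h ≤ ∑ a, playProb σ h a *
      (β * ∑ x, m.nextProb E h.state x * u (h.next a x)))
    (h : History n m.k) (hh : H h) : u h ≤ 0 := by
  -- There are infinitely many histories and a maximizer need not exist; the crude bound `M` is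
  -- contracted repeatedly instead.
  have key : ∀ j : ℕ, ∀ h, H h → u h ≤ β ^ j * M := by
    intro j
    induction j with
    | zero => intro h _; simpa using hM h
    | succ j ih =>
      intro h hh
      refine (hu h hh).trans ?_
      have : ∀ a, 0 < playProb σ h a →
          β * ∑ x, m.nextProb E h.state x * u (h.next a x) ≤ β ^ (j + 1) * M := by
        intro a ha
        rw [pow_succ', mul_assoc]
        refine mul_le_mul_of_nonneg_left ?_ h0
        calc ∑ x, m.nextProb E h.state x * u (h.next a x)
            ≤ ∑ x, m.nextProb E h.state x * (β ^ j * M) := by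
              refine Finset.sum_le_sum fun x _ => ?_
              rcases (m.nextProb_nonneg E h.state x).eq_or_lt with h2 | h2
              · rw [← h2]; simp
              · exact mul_le_mul_of_nonneg_left (ih _ (hH h a x hh ha h2)) h2.le
          _ = β ^ j * M := by rw [← Finset.sum_mul, m.sum_nextProb, one_mul]
      exact (sum_playProb_le this).trans (sum_playProb_const σ h _).le
  have hlim : Filter.Tendsto (fun j : ℕ => β ^ j * M) Filter.atTop (nhds (0 * M)) :=
    (tendsto_pow_atTop_nhds_zero_of_lt_one h0 h1).mul_const M
  rw [zero_mul] at hlim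
  exact ge_of_tendsto' hlim fun j => key j h hh

/-! ### Comparison of payoffs with super- and subharmonic functions -/

section Comparison

variable {E m} {σ : StrategyProfile n m.k} {H : History n m.k → Prop}

theorem continuationPayoff_le_of_superharmonic (hr : r ∈ Set.Icc (0 : ℝ) 1)
    (hH : ∀ h a x, H h → 0 < playProb σ h a → 0 < m.nextProb E h.state x → H (h.next a x))
    {i : Fin n} {U : History n m.k → ℝ} {M : ℝ} (hM : ∀ h, |U h| ≤ M)
    (hU : ∀ h, H h → ∑ a, playProb σ h a * (E.stagePayoff h.game a i +
      (1 - r) * E.δ * ∑ x, m.nextProb E h.state x * U (h.next a x)) ≤ U h)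
    {h : History n m.k} (hh : H h) : continuationPayoff E m r σ h i ≤ U h := by
  obtain ⟨M', hM'⟩ := exists_abs_continuationPayoff_le E m hr σ i
  rw [← sub_nonpos]
  refine nonpos_of_le_expectation E m (discount_nonneg E hr) (discount_lt_one E hr) hH
    (u := fun h => continuationPayoff E m r σ h i - U h) (M := M' + M)
    (fun h => ?_) (fun h hh => ?_) h hh
  · linarith [(abs_le.1 (hM' h)).2, (abs_le.1 (hM h)).1]
  · have h1 := hU h hh
    have h2 := continuationPayoff_eq E m hr σ h i
    have h3 : ∑ a, playProb σ h a * ((1 - r) * E.δ * ∑ x, m.nextProb E h.state x *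
        (continuationPayoff E m r σ (h.next a x) i - U (h.next a x))) =
        ∑ a, playProb σ h a * (E.stagePayoff h.game a i +
          (1 - r) * E.δ * ∑ x, m.nextProb E h.state x *
            continuationPayoff E m r σ (h.next a x) i) -
        ∑ a, playProb σ h a * (E.stagePayoff h.game a i +
          (1 - r) * E.δ * ∑ x, m.nextProb E h.state x * U (h.next a x)) := by
      rw [← Finset.sum_sub_distrib]
      refine Finset.sum_congr rfl fun a _ => ?_
      simp only [mul_sub, Finset.sum_sub_distrib]
      ring
    linarith

theorem le_continuationPayoff_of_subharmonic (hr : r ∈ Set.Icc (0 : ℝ) 1)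
    (hH : ∀ h a x, H h → 0 < playProb σ h a → 0 < m.nextProb E h.state x → H (h.next a x))
    {i : Fin n} {U : History n m.k → ℝ} {M : ℝ} (hM : ∀ h, |U h| ≤ M)
    (hU : ∀ h, H h → U h ≤ ∑ a, playProb σ h a * (E.stagePayoff h.game a i +
      (1 - r) * E.δ * ∑ x, m.nextProb E h.state x * U (h.next a x)))
    {h : History n m.k} (hh : H h) : U h ≤ continuationPayoff E m r σ h i := by
  obtain ⟨M', hM'⟩ := exists_abs_continuationPayoff_le E m hr σ i
  rw [← sub_nonpos]
  refine nonpos_of_le_expectation E m (discount_nonneg E hr) (discount_lt_one E hr) hH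
    (u := fun h => U h - continuationPayoff E m r σ h i) (M := M + M')
    (fun h => ?_) (fun h hh => ?_) h hh
  · linarith [(abs_le.1 (hM' h)).1, (abs_le.1 (hM h)).2]
  · have h1 := hU h hh
    have h2 := continuationPayoff_eq E m hr σ h i
    have h3 : ∑ a, playProb σ h a * ((1 - r) * E.δ * ∑ x, m.nextProb E h.state x *
        (U (h.next a x) - continuationPayoff E m r σ (h.next a x) i)) =
        ∑ a, playProb σ h a * (E.stagePayoff h.game a i +
          (1 - r) * E.δ * ∑ x, m.nextProb E h.state x * U (h.next a x)) -
        ∑ a, playProb σ h a * (E.stagePayoff h.game a i +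
          (1 - r) * E.δ * ∑ x, m.nextProb E h.state x *
            continuationPayoff E m r σ (h.next a x) i) := by
      rw [← Finset.sum_sub_distrib]
      refine Finset.sum_congr rfl fun a _ => ?_
      simp only [mul_sub, Finset.sum_sub_distrib]
      ring
    linarith

end Comparison

end Continuation

/-! ### Equilibrium payoffs of a single team -/

section Equilibrium

variable {n : ℕ} {E : Environment n} {m : ReactiveAssignment} {r : ℝ} {μ : State m.k → ℝ}
variable {σ : StrategyProfile n m.k}

open ReactiveAssignment

theorem OnPath.isHistory {h : History n m.k} (hh : OnPath E m μ σ h) : IsHistory E m μ h := by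
  induction hh with
  | start s hs => exact .start s hs
  | next h a x _ ha hx ih => exact .next h a x ih (eq_allN_of_playProb_pos ha) hx

theorem IsHistory.next_of_playProb_pos {h : History n m.k} (hh : IsHistory E m μ h)
    {a : Profile n} {x : Period} (ha : 0 < playProb σ h a) (hx : 0 < m.nextProb E h.state x) :
    IsHistory E m μ (h.next a x) :=
  .next h a x hh (eq_allN_of_playProb_pos ha) hx

theorem IsHistory.state_pos (hμ : m.IsSteadyState E μ) {h : History n m.k}
    (hh : IsHistory E m μ h) : 0 < μ h.state := by
  induction hh with
  | start s hs => exact hs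
  | next h a x _ _ hx ih => exact hμ.pos_shift ih hx

variable (E m)

/-- The stage payoff of player `i` when `a` is played in every game. -/
noncomputable def constantPayoff (a : Profile n) (i : Fin n) (s : State m.k) : ℝ :=
  E.stagePayoff s.current.2 a i

/-- The expected discounted gain from complete cooperation in all games after the current period. -/
noncomputable def futureBenefit (β : ℝ) (s : State m.k) : ℝ :=
  β * m.stepOp E (m.discounted E β fun s => E.benefit s.current.2) s

variable {E m}

theorem discounted_allC_sub {β : ℝ} (h0 : 0 ≤ β) (h1 : β < 1) (i : Fin n) :
    m.discounted E β (constantPayoff E m (allC n) i) -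
      m.discounted E β (constantPayoff E m (allN n) i) =
    m.discounted E β fun s => E.benefit s.current.2 := by
  rw [← m.discounted_sub E h0 h1]
  congr 1
  funext s
  exact E.stagePayoff_allC_sub _ i

theorem stepOp_discounted_allC {β : ℝ} (h0 : 0 ≤ β) (h1 : β < 1) (i : Fin n) (s : State m.k) :
    β * m.stepOp E (m.discounted E β (constantPayoff E m (allC n) i)) s =
      β * m.stepOp E (m.discounted E β (constantPayoff E m (allN n) i)) s +
        futureBenefit E m β s := by
  rw [futureBenefit, ← discounted_allC_sub h0 h1 i, map_sub, Pi.sub_apply]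
  ring

theorem futureBenefit_nonneg {β : ℝ} (h0 : 0 ≤ β) (s : State m.k) :
    0 ≤ futureBenefit E m β s :=
  mul_nonneg h0 (by
    rw [stepOp_apply]
    exact Finset.sum_nonneg fun x _ => mul_nonneg (m.nextProb_nonneg E s x)
      (m.discounted_nonneg E h0 (fun s => E.benefit_nonneg _) _))

theorem sum_nextProb_mul_state (u : State m.k → ℝ) (h : History n m.k) (a : Profile n) :
    ∑ x, m.nextProb E h.state x * u (h.next a x).state = m.stepOp E u h.state := rfl

/-- A player who never cooperates gets at least the payoff of complete non-cooperation. -/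
theorem discounted_allN_le_continuationPayoff (hr : r ∈ Set.Icc (0 : ℝ) 1) {i : Fin n}
    (hσ : ∀ h, (σ i h : ℝ) = 0) (h : History n m.k) :
    m.discounted E ((1 - r) * E.δ) (constantPayoff E m (allN n) i) h.state ≤
      continuationPayoff E m r σ h i := by
  obtain ⟨M, hM⟩ := m.exists_abs_le
    (m.discounted E ((1 - r) * E.δ) (constantPayoff E m (allN n) i))
  refine le_continuationPayoff_of_subharmonic hr (H := fun _ => True) (fun _ _ _ _ _ _ => trivial)
    (U := fun h => m.discounted E ((1 - r) * E.δ) (constantPayoff E m (allN n) i) h.state)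
    (M := M) (fun h => hM _) (fun h _ => ?_) trivial
  simp only [sum_nextProb_mul_state]
  rw [m.discounted_eq E (discount_nonneg E hr) (discount_lt_one E hr), ← sum_playProb_const σ h
    (constantPayoff E m (allN n) i h.state + _)]
  refine sum_playProb_le fun a ha => ?_
  gcongr
  exact E.stagePayoff_allN_le _ (eq_N_of_playProb_pos ha (hσ h))

theorem IsSubgamePerfect.discounted_allN_le (hr : r ∈ Set.Icc (0 : ℝ) 1)
    (hσ : IsSubgamePerfect E m r μ σ) {h : History n m.k} (hh : IsHistory E m μ h) (i : Fin n) :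
    m.discounted E ((1 - r) * E.δ) (constantPayoff E m (allN n) i) h.state ≤
      continuationPayoff E m r σ h i :=
  (discounted_allN_le_continuationPayoff hr (σ := Function.update σ i fun _ => 0)
    (fun h => by simp) h).trans (hσ h hh i _)

/-! #### Full cooperation on the equilibrium path -/

variable (E m μ σ) in
/-- All players cooperate in all games on the path of `σ`. -/
def CooperatesOnPath : Prop :=
  ∀ h, OnPath E m μ σ h → h.game ≠ none → ∀ i, (σ i h : ℝ) = 1

theorem CooperatesOnPath.continuationPayoff_eq (hr : r ∈ Set.Icc (0 : ℝ) 1)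
    (hσ : CooperatesOnPath E m μ σ) (i : Fin n) {h : History n m.k} (hh : OnPath E m μ σ h) :
    continuationPayoff E m r σ h i =
      m.discounted E ((1 - r) * E.δ) (constantPayoff E m (allC n) i) h.state := by
  obtain ⟨M, hM⟩ := m.exists_abs_le
    (m.discounted E ((1 - r) * E.δ) (constantPayoff E m (allC n) i))
  have key : ∀ h, OnPath E m μ σ h → ∑ a, playProb σ h a * (E.stagePayoff h.game a i +
      (1 - r) * E.δ * ∑ x, m.nextProb E h.state x *
        m.discounted E ((1 - r) * E.δ) (constantPayoff E m (allC n) i) (h.next a x).state) =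
      m.discounted E ((1 - r) * E.δ) (constantPayoff E m (allC n) i) h.state := by
    intro h hh
    simp only [sum_nextProb_mul_state]
    rw [m.discounted_eq E (discount_nonneg E hr) (discount_lt_one E hr) _ h.state]
    by_cases hg : h.game = none
    · rw [sum_playProb_none hg]
      have hg' : h.state.current.2 = none := hg
      simp [constantPayoff, hg, hg', Environment.stagePayoff]
    · rw [sum_playProb_allC hg i (hσ h hh hg)]
      rfl
  have hH : ∀ h a x, OnPath E m μ σ h → 0 < playProb σ h a → 0 < m.nextProb E h.state x →
      OnPath E m μ σ (h.next a x) := fun h a x hh ha hx => .next h a x hh ha hx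
  exact le_antisymm
    (continuationPayoff_le_of_superharmonic hr hH
      (U := fun h => m.discounted E ((1 - r) * E.δ) (constantPayoff E m (allC n) i) h.state)
      (fun h => hM _) (fun h hh => (key h hh).le) hh)
    (le_continuationPayoff_of_subharmonic hr hH
      (U := fun h => m.discounted E ((1 - r) * E.δ) (constantPayoff E m (allC n) i) h.state)
      (fun h => hM _) (fun h hh => (key h hh).ge) hh)

theorem CooperatesOnPath.deviation_eq (hr : r ∈ Set.Icc (0 : ℝ) 1)
    (hσ : CooperatesOnPath E m μ σ) (i : Fin n) {h : History n m.k} (hh : OnPath E m μ σ h)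
    {g : Game} (hg : h.game = some g) {ρ : Strategy n m.k} (hρ : (ρ h : ℝ) = 0) :
    continuationPayoff E m r (Function.update σ i ρ) h i =
      E.payoff g (allC n) i + E.d g + (1 - r) * E.δ * ∑ x, m.nextProb E h.state x *
        continuationPayoff E m r (Function.update σ i ρ)
          (h.next (Function.update (allC n) i .N) x) i := by
  have hg' : h.game ≠ none := by simp [hg]
  rw [TeamDesign.continuationPayoff_eq E m hr, sum_playProb_of_others hg' (b := allC n) (i := i)]
  · simp only [Function.update_self, hρ, zero_mul, zero_add, sub_zero, one_mul]
    rw [hg]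
    simp only [Environment.stagePayoff, E.payoff_deviate]
  · intro j hj
    simp [Function.update_of_ne hj, hσ h hh hg' j]

/-- The deviation to never cooperating gains `d` at once and secures complete non-cooperation
afterwards, so it loses at most the future benefit. Any recurring state can serve as the initial
history. -/
theorem CooperatesOnPath.d_le_futureBenefit (hr : r ∈ Set.Icc (0 : ℝ) 1)
    (hσ : CooperatesOnPath E m μ σ) (hspe : IsSubgamePerfect E m r μ σ) {s : State m.k}
    (hs : 0 < μ s) {g : Game} (hg : s.current.2 = some g) :
    E.d g ≤ futureBenefit E m ((1 - r) * E.δ) s := by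
  set i := E.player
  have hh : OnPath E m μ σ (.start s) := .start s hs
  have h0 := discount_nonneg E hr
  have h1 := discount_lt_one E hr
  have hdev := hσ.deviation_eq hr i hh (g := g) hg (ρ := fun _ => 0) rfl
  have hle := hspe _ hh.isHistory i fun _ => 0
  rw [hdev, hσ.continuationPayoff_eq hr i hh, m.discounted_eq E h0 h1,
    stepOp_discounted_allC h0 h1] at hle
  have hpun : m.stepOp E (m.discounted E ((1 - r) * E.δ) (constantPayoff E m (allN n) i)) s ≤
      ∑ x, m.nextProb E s x * continuationPayoff E m r (Function.update σ i fun _ => 0)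
        ((History.start s).next (Function.update (allC n) i .N) x) i := by
    rw [stepOp_apply]
    refine Finset.sum_le_sum fun x _ => mul_le_mul_of_nonneg_left ?_ (m.nextProb_nonneg E s x)
    exact discounted_allN_le_continuationPayoff hr (fun h => by simp)
      ((History.start s).next (Function.update (allC n) i .N) x)
  have h2 := mul_le_mul_of_nonneg_left hpun h0
  have h3 : constantPayoff E m (allC n) i s = E.payoff g (allC n) i := by
    simp [constantPayoff, hg, Environment.stagePayoff]
  simp only [History.state] at hle
  rw [h3] at hle
  linarith

/-- The number of periods after the initial one. -/
def History.length {k : ℕ} : History n k → ℕ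
  | .start _ => 0
  | .next h _ _ => h.length + 1

-- Play after `h₀` visits only longer histories, where the altered strategy agrees with the
-- original.
open Classical in
theorem continuationPayoff_update_of_length_lt (hr : r ∈ Set.Icc (0 : ℝ) 1) (i : Fin n)
    (h₀ : History n m.k) (c : Set.Icc (0 : ℝ) 1) {h : History n m.k}
    (hlt : h₀.length < h.length) :
    continuationPayoff E m r (Function.update σ i (Function.update (σ i) h₀ c)) h i =
      continuationPayoff E m r σ h i := by
  set τ := Function.update σ i (Function.update (σ i) h₀ c) with hτ
  obtain ⟨M, hM⟩ := exists_abs_continuationPayoff_le E m hr σ i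
  have hplay : ∀ h : History n m.k, h₀.length < h.length → playProb τ h = playProb σ h := by
    intro h hlt
    have hne : h ≠ h₀ := by rintro rfl; exact lt_irrefl _ hlt
    have : ∀ j, τ j h = σ j h := by
      intro j
      by_cases hj : j = i
      · subst hj; simp [hτ, Function.update_of_ne hne]
      · simp [hτ, Function.update_of_ne hj]
    funext a
    unfold playProb
    simp only [this]
  have hH : ∀ (h : History n m.k) (a : Profile n) (x : Period), h₀.length < h.length →
      0 < playProb τ h a → 0 < m.nextProb E h.state x → h₀.length < (h.next a x).length :=
    fun h a x hlt _ _ => Nat.lt_succ_of_lt hlt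
  have key : ∀ h : History n m.k, h₀.length < h.length → ∑ a, playProb τ h a *
      (E.stagePayoff h.game a i + (1 - r) * E.δ * ∑ x, m.nextProb E h.state x *
        continuationPayoff E m r σ (h.next a x) i) = continuationPayoff E m r σ h i := by
    intro h hlt
    rw [hplay h hlt, ← continuationPayoff_eq E m hr]
  exact le_antisymm
    (continuationPayoff_le_of_superharmonic hr hH hM (fun h hlt => (key h hlt).le) hlt)
    (le_continuationPayoff_of_subharmonic hr hH hM (fun h hlt => (key h hlt).ge) hlt)

/-- Where the incentive constraint binds, players are indifferent. -/
theorem CooperatesOnPath.indifferent (hr : r ∈ Set.Icc (0 : ℝ) 1)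
    (hσ : CooperatesOnPath E m μ σ) (hspe : IsSubgamePerfect E m r μ σ) {h : History n m.k}
    (hh : OnPath E m μ σ h) {g : Game} (hg : h.game = some g)
    (hbind : futureBenefit E m ((1 - r) * E.δ) h.state = E.d g) (i : Fin n) :
    Indifferent E m r σ h i := by
  classical
  have h0 := discount_nonneg E hr
  have h1 := discount_lt_one E hr
  have hone : (1 : Set.Icc (0 : ℝ) 1) = σ i h :=
    Subtype.ext (hσ h hh (by simp [hg]) i).symm
  unfold Indifferent
  have hself : Function.update σ i (Function.update (σ i) h 1) = σ := by
    rw [hone, Function.update_eq_self, Function.update_eq_self]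
  rw [hself]
  -- Equilibrium gives one inequality. For the other, the continuation after the one-period
  -- deviation is again equilibrium play, worth at least complete non-cooperation, and the binding
  -- constraint makes this enough.
  refine le_antisymm ?_ (hspe h hh.isHistory i _)
  rw [hσ.deviation_eq hr i hh hg (ρ := Function.update (σ i) h 0) (by simp),
    hσ.continuationPayoff_eq hr i hh, m.discounted_eq E h0 h1, stepOp_discounted_allC h0 h1, hbind]
  have h3 : constantPayoff E m (allC n) i h.state = E.payoff g (allC n) i := by
    have : h.state.current.2 = some g := hg
    simp [constantPayoff, this, Environment.stagePayoff]
  have hpun : m.stepOp E (m.discounted E ((1 - r) * E.δ) (constantPayoff E m (allN n) i))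
      h.state ≤ ∑ x, m.nextProb E h.state x * continuationPayoff E m r
        (Function.update σ i (Function.update (σ i) h 0))
        (h.next (Function.update (allC n) i .N) x) i := by
    rw [stepOp_apply]
    refine Finset.sum_le_sum fun x _ => ?_
    rcases (m.nextProb_nonneg E h.state x).eq_or_lt with hx | hx
    · rw [← hx]; simp
    · refine mul_le_mul_of_nonneg_left ?_ hx.le
      rw [continuationPayoff_update_of_length_lt hr i h 0 (Nat.lt_succ_self _)]
      exact hspe.discounted_allN_le hr
        (.next h _ x hh.isHistory (fun hn => by simp [hg] at hn) hx) i
  have h2 := mul_le_mul_of_nonneg_left hpun h0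
  rw [h3]
  linarith

/-! #### Grim-trigger strategies -/

/-- Nobody has failed to cooperate in an earlier game. -/
def History.Clean {k : ℕ} : History n k → Prop
  | .start _ => True
  | .next h a _ => h.Clean ∧ (h.game ≠ none → a = allC n)

open Classical in
/-- Cooperate until somebody does not. -/
noncomputable def grim (n k : ℕ) : StrategyProfile n k :=
  fun _ h => if h.Clean then 1 else 0

theorem grim_cooperatesOnPath : CooperatesOnPath E m μ (grim n m.k) := by
  classical
  have hclean : ∀ h, OnPath E m μ (grim n m.k) h → h.Clean := by
    intro h hh
    induction hh with
    | start s hs => trivial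
    | next h a x _ ha _ ih =>
      refine ⟨ih, fun hg => ?_⟩
      by_contra hne
      obtain ⟨j, hj⟩ := Function.ne_iff.1 hne
      have hj' : a j ≠ .C := hj
      rw [playProb_game hg, Finset.prod_eq_zero (Finset.mem_univ j)] at ha
      · exact lt_irrefl _ ha
      · rw [if_neg hj']; simp [grim, ih]
  intro h hh _ i
  simp [grim, hclean h hh]

/-- The candidate value `U` is superharmonic under every unilateral deviation and subharmonic under
`grim`. Comparison therefore handles all deviations at once, without a one-shot deviation principle.
-/
theorem grim_isSubgamePerfect (hr : r ∈ Set.Icc (0 : ℝ) 1) (hμ : m.IsSteadyState E μ)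
    (hIC : ∀ s, 0 < μ s → ∀ g, s.current.2 = some g →
      E.d g ≤ futureBenefit E m ((1 - r) * E.δ) s) :
    IsSubgamePerfect E m r μ (grim n m.k) := by
  classical
  have h0 := discount_nonneg E hr
  have h1 := discount_lt_one E hr
  intro h hh i ρ
  set β := (1 - r) * E.δ with hβ
  set RC := m.discounted E β (constantPayoff E m (allC n) i) with hRC
  set RN := m.discounted E β (constantPayoff E m (allN n) i) with hRN
  have hRCeq : ∀ s, RC s = constantPayoff E m (allC n) i s + β * m.stepOp E RC s :=
    m.discounted_eq E h0 h1 _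
  have hRNeq : ∀ s, RN s = constantPayoff E m (allN n) i s + β * m.stepOp E RN s :=
    m.discounted_eq E h0 h1 _
  let U : History n m.k → ℝ := fun h => if h.Clean then RC h.state else RN h.state
  obtain ⟨M₁, hM₁⟩ := m.exists_abs_le RC
  obtain ⟨M₂, hM₂⟩ := m.exists_abs_le RN
  have hUM : ∀ h, |U h| ≤ max M₁ M₂ := by
    intro h
    simp only [U]
    split_ifs
    exacts [(hM₁ _).trans (le_max_left _ _), (hM₂ _).trans (le_max_right _ _)]
  have hUclean : ∀ (h : History n m.k) a, h.Clean → (h.game ≠ none → a = allC n) →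
      ∑ x, m.nextProb E h.state x * U (h.next a x) = m.stepOp E RC h.state := by
    intro h a hc ha
    rw [stepOp_apply]
    refine Finset.sum_congr rfl fun x _ => ?_
    have : (h.next a x).Clean := ⟨hc, ha⟩
    simp only [U, if_pos this, History.state]
  have hUdirty : ∀ (h : History n m.k) a, ¬ (h.Clean ∧ (h.game ≠ none → a = allC n)) →
      ∑ x, m.nextProb E h.state x * U (h.next a x) = m.stepOp E RN h.state := by
    intro h a hc
    rw [stepOp_apply]
    refine Finset.sum_congr rfl fun x _ => ?_
    have : ¬ (h.next a x).Clean := hc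
    simp only [U, if_neg this, History.state]
  have hnone : ∀ (τ : StrategyProfile n m.k) (h : History n m.k), h.game = none →
      ∑ a, playProb τ h a * (E.stagePayoff h.game a i +
        β * ∑ x, m.nextProb E h.state x * U (h.next a x)) = U h := by
    intro τ h hg
    have hg' : h.state.current.2 = none := hg
    rw [sum_playProb_none hg, hg]
    simp only [Environment.stagePayoff, zero_add]
    by_cases hc : h.Clean
    · rw [hUclean h _ hc fun hn => absurd hg hn]
      simp [U, if_pos hc, hRCeq h.state, constantPayoff, hg', Environment.stagePayoff]
    · rw [hUdirty h _ fun hn => hc hn.1]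
      simp [U, if_neg hc, hRNeq h.state, constantPayoff, hg', Environment.stagePayoff]
  have hplay : ∀ (τ : Strategy n m.k) (h : History n m.k) (g : Game), h.game = some g →
      ∑ a, playProb (Function.update (grim n m.k) i τ) h a * (E.stagePayoff h.game a i +
        β * ∑ x, m.nextProb E h.state x * U (h.next a x)) =
      if h.Clean then (τ h : ℝ) * RC h.state + (1 - (τ h : ℝ)) *
        (E.payoff g (allC n) i + E.d g + β * m.stepOp E RN h.state)
      else (τ h : ℝ) * (E.payoff g (Function.update (allN n) i .C) i +
        β * m.stepOp E RN h.state) + (1 - (τ h : ℝ)) * RN h.state := by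
    intro τ h g hg
    have hg' : h.game ≠ none := by simp [hg]
    have hg2 : h.state.current.2 = some g := hg
    by_cases hc : h.Clean
    · rw [sum_playProb_of_others hg' (b := allC n) (i := i)
        (fun j hj => by simp [Function.update_of_ne hj, grim, hc]), if_pos hc, update_allC_self,
        hUclean h _ hc fun _ => rfl, hUdirty h _ fun hn => by
          have := congrFun (hn.2 hg') i
          simp at this]
      simp only [Function.update_self, hg, Environment.stagePayoff, E.payoff_deviate]
      rw [hRCeq h.state]
      simp only [constantPayoff, hg2, Environment.stagePayoff]
    · rw [sum_playProb_of_others hg' (b := allN n) (i := i)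
        (fun j hj => by simp [Function.update_of_ne hj, grim, hc]), if_neg hc, update_allN_self,
        hUdirty h _ fun hn => hc hn.1, hUdirty h _ fun hn => hc hn.1]
      simp only [Function.update_self, hg, Environment.stagePayoff]
      rw [hRNeq h.state]
      simp only [constantPayoff, hg2, Environment.stagePayoff]
  -- Restricted to feasible histories, since the incentive constraints are given only at states of
  -- positive mass.
  have hup : continuationPayoff E m r (Function.update (grim n m.k) i ρ) h i ≤ U h := by
    refine continuationPayoff_le_of_superharmonic hr (H := IsHistory E m μ)
      (fun h a x hh ha hx => hh.next_of_playProb_pos ha hx) hUM (fun h hh => ?_) hh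
    rw [← hβ]
    rcases hgame : h.game with _ | g
    · rw [← hgame]; exact (hnone _ h hgame).le
    · rw [← hgame, hplay ρ h g hgame]
      have hp := (ρ h).2
      have hg2 : h.state.current.2 = some g := hgame
      by_cases hc : h.Clean
      · simp only [U, if_pos hc]
        have h2 := hIC h.state (hh.state_pos hμ) g hgame
        have h3 := stepOp_discounted_allC (E := E) (m := m) h0 h1 i h.state
        have h4 := hRCeq h.state
        simp only [constantPayoff, hg2, Environment.stagePayoff] at h4
        nlinarith [hp.1, hp.2]
      · simp only [U, if_neg hc]
        have h2 := (E.isStageGame g).dominant (allN n) i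
        rw [update_allN_self] at h2
        have h4 := hRNeq h.state
        simp only [constantPayoff, hg2, Environment.stagePayoff] at h4
        nlinarith [hp.1, hp.2]
  have hlow : U h ≤ continuationPayoff E m r (grim n m.k) h i := by
    refine le_continuationPayoff_of_subharmonic hr (H := fun _ => True)
      (fun _ _ _ _ _ _ => trivial) hUM (fun h _ => ?_) trivial
    rw [← hβ]
    rcases hgame : h.game with _ | g
    · rw [← hgame]; exact (hnone _ h hgame).ge
    · have h2 := hplay (grim n m.k i) h g hgame
      rw [Function.update_eq_self] at h2
      rw [← hgame, h2]
      by_cases hc : h.Clean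
      · simp [U, if_pos hc, grim, hc]
      · simp [U, if_neg hc, grim, hc]
  exact hup.trans hlow

/-! #### Player-optimality of full cooperation -/

variable (E m) in
/-- The shortfall of aggregate payoffs from those of complete cooperation. -/
noncomputable def shortfall (r : ℝ) (σ : StrategyProfile n m.k) (h : History n m.k) : ℝ :=
  ∑ i, (m.discounted E ((1 - r) * E.δ) (constantPayoff E m (allC n) i) h.state -
    continuationPayoff E m r σ h i)

theorem shortfall_eq (hr : r ∈ Set.Icc (0 : ℝ) 1) (σ : StrategyProfile n m.k)
    (h : History n m.k) :
    shortfall E m r σ h = ∑ a, playProb σ h a *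
      ((∑ i, E.stagePayoff h.game (allC n) i - ∑ i, E.stagePayoff h.game a i) +
        (1 - r) * E.δ * ∑ x, m.nextProb E h.state x * shortfall E m r σ (h.next a x)) := by
  have h0 := discount_nonneg E hr
  have h1 := discount_lt_one E hr
  have hi : ∀ i, m.discounted E ((1 - r) * E.δ) (constantPayoff E m (allC n) i) h.state -
      continuationPayoff E m r σ h i = ∑ a, playProb σ h a *
      ((E.stagePayoff h.game (allC n) i - E.stagePayoff h.game a i) +
        (1 - r) * E.δ * ∑ x, m.nextProb E h.state x *
        (m.discounted E ((1 - r) * E.δ) (constantPayoff E m (allC n) i) (h.next a x).state -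
          continuationPayoff E m r σ (h.next a x) i)) := by
    intro i
    rw [m.discounted_eq E h0 h1, continuationPayoff_eq E m hr, ← sum_playProb_const σ h
      (constantPayoff E m (allC n) i h.state + _), ← Finset.sum_sub_distrib]
    refine Finset.sum_congr rfl fun a _ => ?_
    simp only [mul_sub, Finset.sum_sub_distrib, sum_nextProb_mul_state, constantPayoff,
      History.game, mul_add]
    ring
  simp only [shortfall]
  simp_rw [hi]
  rw [Finset.sum_comm]
  refine Finset.sum_congr rfl fun a _ => ?_
  rw [← Finset.mul_sum, Finset.sum_add_distrib, Finset.sum_sub_distrib, ← Finset.mul_sum,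
    Finset.sum_comm (s := Finset.univ) (t := Finset.univ)
      (f := fun (i : Fin n) (x : Period) => m.nextProb E h.state x * _)]
  simp only [Finset.mul_sum]

theorem shortfall_nonneg (hr : r ∈ Set.Icc (0 : ℝ) 1) (σ : StrategyProfile n m.k)
    (h : History n m.k) : 0 ≤ shortfall E m r σ h := by
  have hb : ∃ M, ∀ h, -shortfall E m r σ h ≤ M := by
    have h2 : ∀ i, ∃ M, ∀ h : History n m.k,
        -(m.discounted E ((1 - r) * E.δ) (constantPayoff E m (allC n) i) h.state -
          continuationPayoff E m r σ h i) ≤ M := by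
      intro i
      obtain ⟨M₁, hM₁⟩ := m.exists_abs_le
        (m.discounted E ((1 - r) * E.δ) (constantPayoff E m (allC n) i))
      obtain ⟨M₂, hM₂⟩ := exists_abs_continuationPayoff_le E m hr σ i
      exact ⟨M₁ + M₂, fun h => by
        linarith [(abs_le.1 (hM₁ h.state)).1, (abs_le.1 (hM₂ h)).2]⟩
    choose M hM using h2
    refine ⟨∑ i, M i, fun h => ?_⟩
    rw [shortfall, ← Finset.sum_neg_distrib]
    exact Finset.sum_le_sum fun i _ => hM i h
  obtain ⟨M, hM⟩ := hb
  rw [← neg_nonpos]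
  refine nonpos_of_le_expectation E m (discount_nonneg E hr) (discount_lt_one E hr) (σ := σ)
    (H := fun _ => True) (fun _ _ _ _ _ _ => trivial) (u := fun h => -shortfall E m r σ h)
    hM (fun h _ => ?_) h trivial
  rw [shortfall_eq hr, ← Finset.sum_neg_distrib]
  refine Finset.sum_le_sum fun a _ => ?_
  rw [← mul_neg]
  refine mul_le_mul_of_nonneg_left ?_ (playProb_nonneg σ h a)
  have := E.sum_stagePayoff_le h.game a
  simp only [mul_neg, Finset.sum_neg_distrib]
  linarith

/-- The shortfall is an average of nonnegative stage losses and discounted shortfalls. If it is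
zero, each part vanishes; `r < 1` makes the future count. -/
theorem shortfall_eq_zero_step (hr : r ∈ Set.Icc (0 : ℝ) 1) (hr1 : r < 1) {h : History n m.k}
    (hz : shortfall E m r σ h = 0) {a : Profile n} (ha : 0 < playProb σ h a) :
    (h.game ≠ none → a = allC n) ∧
      ∀ x, 0 < m.nextProb E h.state x → shortfall E m r σ (h.next a x) = 0 := by
  have hβ : 0 < (1 - r) * E.δ := mul_pos (by linarith) E.δ_pos
  have hnn : ∀ b x, 0 ≤ m.nextProb E h.state x * shortfall E m r σ (h.next b x) := fun b x =>
    mul_nonneg (m.nextProb_nonneg E _ x) (shortfall_nonneg hr σ _)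
  have hcont : ∀ b, 0 ≤ (1 - r) * E.δ * ∑ x, m.nextProb E h.state x *
      shortfall E m r σ (h.next b x) := fun b =>
    mul_nonneg hβ.le (Finset.sum_nonneg fun x _ => hnn b x)
  rw [shortfall_eq hr] at hz
  have hterm := (Finset.sum_eq_zero_iff_of_nonneg fun b _ => mul_nonneg (playProb_nonneg σ h b)
    (add_nonneg (sub_nonneg.2 (E.sum_stagePayoff_le h.game b)) (hcont b))).1 hz a
    (Finset.mem_univ a)
  have hterm' := (mul_eq_zero.1 hterm).resolve_left ha.ne'
  have hstage := E.sum_stagePayoff_le h.game a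
  have hc := hcont a
  refine ⟨fun hg => ?_, fun x hx => ?_⟩
  · obtain ⟨g, hg⟩ := Option.ne_none_iff_exists'.1 hg
    by_contra hne
    have := (E.isStageGame g).coop_max a hne
    rw [hg] at hterm'
    simp only [Environment.stagePayoff] at hterm'
    linarith
  · have h2 : (1 - r) * E.δ * ∑ x, m.nextProb E h.state x * shortfall E m r σ (h.next a x) = 0 := by
      linarith
    have h3 := (Finset.sum_eq_zero_iff_of_nonneg fun x _ => hnn a x).1
      ((mul_eq_zero.1 h2).resolve_left hβ.ne') x (Finset.mem_univ x)
    exact (mul_eq_zero.1 h3).resolve_left hx.ne'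

theorem eq_one_of_forall_eq_allC {k : ℕ} {σ : StrategyProfile n k} {h : History n k}
    (hg : h.game ≠ none) (hall : ∀ a, 0 < playProb σ h a → a = allC n) (i : Fin n) :
    (σ i h : ℝ) = 1 := by
  classical
  by_contra hne
  -- If `i` may fail to cooperate, this profile has positive probability: each other player takes an
  -- action used with positive probability.
  let a : Profile n := fun j => if j = i then .N else if 0 < (σ j h : ℝ) then .C else .N
  have ha : 0 < playProb σ h a := by
    rw [playProb_game hg]
    refine Finset.prod_pos fun j _ => ?_
    by_cases hj : j = i
    · subst hj
      have : (σ j h : ℝ) < 1 := lt_of_le_of_ne (σ j h).2.2 hne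
      simp [a, this]
    · by_cases hp : 0 < (σ j h : ℝ)
      · simp only [a, if_neg hj, if_pos hp, if_true]; exact hp
      · have : (σ j h : ℝ) = 0 := le_antisymm (not_lt.1 hp) (σ j h).2.1
        have haj : a j = .N := by simp only [a, if_neg hj, if_neg hp]
        rw [haj, if_neg (by decide), this]; norm_num
  have := congrFun (hall a ha) i
  simp [a] at this

theorem totalPayoff_eq (r : ℝ) (μ : State m.k → ℝ) (σ : StrategyProfile n m.k) :
    totalPayoff E m r μ σ =
      ∑ s, μ s * ∑ i, m.discounted E ((1 - r) * E.δ) (constantPayoff E m (allC n) i) s -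
        ∑ s, μ s * shortfall E m r σ (.start s) := by
  rw [totalPayoff, ← Finset.sum_sub_distrib]
  refine Finset.sum_congr rfl fun s _ => ?_
  rw [shortfall, Finset.sum_sub_distrib]
  simp only [History.state]
  ring

/-- An assignment under which the grim-trigger incentive constraints hold is fully cooperative. -/
theorem fullyCooperative_of_incentives (hr : r ∈ Set.Icc (0 : ℝ) 1) (hr1 : r < 1)
    (hμ : m.IsSteadyState E μ)
    (hIC : ∀ s, 0 < μ s → ∀ g, s.current.2 = some g →
      E.d g ≤ futureBenefit E m ((1 - r) * E.δ) s) :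
    FullyCooperative E m r μ := by
  have hgrim := grim_isSubgamePerfect hr hμ hIC
  have hnn : ∀ (σ : StrategyProfile n m.k) s, 0 ≤ μ s * shortfall E m r σ (.start s) :=
    fun σ s => mul_nonneg (hμ.nonneg s) (shortfall_nonneg hr σ _)
  -- Grim trigger attains the upper bound on total payoffs. Every player-optimal equilibrium must do
  -- so too, and its zero shortfall propagates along the path.
  have hzero : ∑ s, μ s * shortfall E m r (grim n m.k) (.start s) = 0 := by
    refine Finset.sum_eq_zero fun s _ => ?_
    rcases (hμ.nonneg s).eq_or_lt with h | h
    · rw [← h, zero_mul]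
    · rw [shortfall, Finset.sum_eq_zero fun i _ => ?_, mul_zero]
      rw [grim_cooperatesOnPath.continuationPayoff_eq hr i (.start s h), sub_self]
  refine ⟨⟨grim n m.k, hgrim, fun σ' _ => ?_⟩, fun σ hσ h hh hg i => ?_⟩
  · rw [totalPayoff_eq, totalPayoff_eq, hzero]
    linarith [Finset.sum_nonneg fun s (_ : s ∈ Finset.univ) => hnn σ' s]
  · have h1 := hσ.2 _ hgrim
    rw [totalPayoff_eq, totalPayoff_eq, hzero] at h1
    have h2 := (Finset.sum_eq_zero_iff_of_nonneg fun s _ => hnn σ s).1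
      (le_antisymm (by linarith) (Finset.sum_nonneg fun s _ => hnn σ s))
    have h3 : ∀ h, OnPath E m μ σ h → shortfall E m r σ h = 0 := by
      intro h hh
      induction hh with
      | start s hs =>
        exact (mul_eq_zero.1 (h2 s (Finset.mem_univ s))).resolve_left hs.ne'
      | next h a x _ ha hx ih => exact (shortfall_eq_zero_step hr hr1 ih ha).2 x hx
    exact eq_one_of_forall_eq_allC hg
      (fun a ha => (shortfall_eq_zero_step hr hr1 (h3 h hh) ha).1 hg) i

/-! #### Teams that are reshuffled every period -/

theorem continuationPayoff_one (σ : StrategyProfile n m.k) (h : History n m.k) (i : Fin n) :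
    continuationPayoff E m 1 σ h i = ∑ a, playProb σ h a * E.stagePayoff h.game a i := by
  rw [continuationPayoff_eq E m ⟨zero_le_one, le_rfl⟩]
  simp

theorem continuationPayoff_one_noncoop {h : History n m.k} {i : Fin n}
    (hσ : h.game ≠ none → ∀ j ≠ i, (σ j h : ℝ) = 0) :
    continuationPayoff E m 1 σ h i = match h.game with
      | none => 0
      | some g => (σ i h : ℝ) * E.payoff g (Function.update (allN n) i .C) i +
        (1 - (σ i h : ℝ)) * E.payoff g (allN n) i := by
  rw [continuationPayoff_one]
  rcases hg : h.game with _ | g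
  · rw [sum_playProb_none hg]; simp [Environment.stagePayoff]
  · rw [sum_playProb_of_others (by simp [hg]) (b := allN n) (i := i), update_allN_self]
    · simp [Environment.stagePayoff]
    · intro j hj
      simp [hσ (by simp [hg]) j hj]

theorem sum_profile_split (i : Fin n) (f : Profile n → ℝ) :
    ∑ a, f a = ∑ a ∈ Finset.univ.filter fun a : Profile n => a i = .N,
      (f (Function.update a i .C) + f (Function.update a i .N)) := by
  rw [← Finset.sum_filter_add_sum_filter_not Finset.univ (fun a : Profile n => a i = .N),
    Finset.sum_add_distrib, add_comm]
  congr 1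
  · refine Finset.sum_nbij' (fun a => Function.update a i .N) (fun a => Function.update a i .C)
      (fun a _ => by simp) (fun a _ => by simp) (fun a ha => ?_) (fun a ha => ?_) (fun a ha => ?_)
    all_goals
      simp only [Finset.mem_filter, Finset.mem_univ, true_and] at ha
      try have hC : a i = .C := by cases hx : a i <;> simp_all
    · rw [Function.update_idem, ← hC, Function.update_eq_self]
    · rw [Function.update_idem, ← ha, Function.update_eq_self]
    · rw [Function.update_idem, ← hC, Function.update_eq_self]
  · refine Finset.sum_congr rfl fun a ha => ?_
    simp only [Finset.mem_filter, Finset.mem_univ, true_and] at ha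
    rw [← ha, Function.update_eq_self]

/-- The probability that the players other than `i` act as in `a`. -/
noncomputable def othersProb {k : ℕ} (σ : StrategyProfile n k) (h : History n k) (i : Fin n)
    (a : Profile n) : ℝ :=
  ∏ j ∈ Finset.univ.erase i, if a j = Action.C then (σ j h : ℝ) else 1 - (σ j h : ℝ)

theorem othersProb_nonneg {k : ℕ} (σ : StrategyProfile n k) (h : History n k) (i : Fin n)
    (a : Profile n) : 0 ≤ othersProb σ h i a :=
  Finset.prod_nonneg fun j _ => by
    split_ifs
    exacts [(σ j h).2.1, sub_nonneg.2 (σ j h).2.2]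

theorem sum_playProb_split {k : ℕ} {σ : StrategyProfile n k} {h : History n k}
    (hg : h.game ≠ none) (i : Fin n) (F : Profile n → ℝ) :
    ∑ a, playProb σ h a * F a = ∑ a ∈ Finset.univ.filter fun a : Profile n => a i = .N,
      othersProb σ h i a * ((σ i h : ℝ) * F (Function.update a i .C) +
        (1 - (σ i h : ℝ)) * F (Function.update a i .N)) := by
  rw [sum_profile_split i]
  refine Finset.sum_congr rfl fun a _ => ?_
  have hval : ∀ x : Action, playProb σ h (Function.update a i x) =
      (if x = .C then (σ i h : ℝ) else 1 - (σ i h : ℝ)) * othersProb σ h i a := by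
    intro x
    rw [playProb_game hg, ← Finset.mul_prod_erase _ _ (Finset.mem_univ i), othersProb,
      Function.update_self]
    congr 1
    exact Finset.prod_congr rfl fun j hj => by
      rw [Function.update_of_ne (Finset.ne_of_mem_erase hj)]
  rw [hval, hval]
  simp only [if_true, reduceCtorEq, if_false]
  ring

/-- Without a future, nobody ever cooperates. -/
theorem fullyNonCooperative_one (hμ : m.IsSteadyState E μ) : FullyNonCooperative E m 1 μ := by
  classical
  have hdom : ∀ (g : Game) (i : Fin n) (p : ℝ), 0 ≤ p →
      p * E.payoff g (Function.update (allN n) i .C) i + (1 - p) * E.payoff g (allN n) i ≤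
        E.payoff g (allN n) i := by
    intro g i p hp
    have h2 := (E.isStageGame g).dominant (allN n) i
    rw [update_allN_self] at h2
    nlinarith
  have hspe : IsSubgamePerfect E m 1 μ (fun _ _ => 0) := by
    intro h hh i ρ
    rw [continuationPayoff_one_noncoop (fun _ j hj => by simp [Function.update_of_ne hj]),
      continuationPayoff_one_noncoop (fun _ j hj => by simp)]
    rcases h.game with _ | g
    · exact le_rfl
    · simpa using hdom g i _ (ρ h).2.1
  -- Only the current stage counts. Strict dominance is averaged over the actions of the others, at
  -- least one combination of which has positive weight.
  have hunique : ∀ σ, IsSubgamePerfect E m 1 μ σ → ∀ h, IsHistory E m μ h → h.game ≠ none →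
      ∀ i, (σ i h : ℝ) = 0 := by
    intro σ hσ h hh hg i
    obtain ⟨g, hg'⟩ := Option.ne_none_iff_exists'.1 hg
    by_contra hne
    have hp : 0 < (σ i h : ℝ) := lt_of_le_of_ne (σ i h).2.1 (Ne.symm hne)
    have hle := hσ h hh i (Function.update (σ i) h 0)
    rw [continuationPayoff_one, continuationPayoff_one] at hle
    refine absurd hle (not_le.2 ?_)
    have hi0 : ((Function.update σ i (Function.update (σ i) h 0)) i h : ℝ) = 0 := by simp
    rw [sum_playProb_split hg i, sum_playProb_split hg i, hi0, hg']
    have hw : ∀ a : Profile n, othersProb (Function.update σ i (Function.update (σ i) h 0)) h i a =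
        othersProb σ h i a := fun a =>
      Finset.prod_congr rfl fun j hj => by
        rw [Function.update_of_ne (Finset.ne_of_mem_erase hj)]
    simp only [hw, Environment.stagePayoff]
    have hdom' : ∀ a : Profile n, (σ i h : ℝ) * E.payoff g (Function.update a i .C) i +
        (1 - (σ i h : ℝ)) * E.payoff g (Function.update a i .N) i <
        0 * E.payoff g (Function.update a i .C) i +
          (1 - 0) * E.payoff g (Function.update a i .N) i := by
      intro a
      have := (E.isStageGame g).dominant a i
      nlinarith
    refine Finset.sum_lt_sum (fun a _ =>
      mul_le_mul_of_nonneg_left (hdom' a).le (othersProb_nonneg σ h i a)) ?_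
    have hsum := sum_playProb_split (σ := σ) hg i fun _ => 1
    rw [sum_playProb_const] at hsum
    obtain ⟨a, ha, hpos⟩ := Finset.exists_lt_of_sum_lt
      (s := Finset.univ.filter fun a : Profile n => a i = .N) (f := fun _ => (0 : ℝ))
      (g := fun a => othersProb σ h i a * ((σ i h : ℝ) * 1 + (1 - (σ i h : ℝ)) * 1))
      (by rw [← hsum]; simp)
    refine ⟨a, ha, mul_lt_mul_of_pos_left (hdom' a) ?_⟩
    refine lt_of_le_of_ne (othersProb_nonneg σ h i a) fun h0 => ?_
    rw [← h0, zero_mul] at hpos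
    exact lt_irrefl _ hpos
  refine ⟨⟨fun _ _ => 0, hspe, fun σ' hσ' => ?_⟩, fun σ hσ h hh hg i =>
    hunique σ hσ.1 h hh.isHistory hg i⟩
  refine Finset.sum_le_sum fun s _ => ?_
  by_cases hs : 0 < μ s
  · refine mul_le_mul_of_nonneg_left (Finset.sum_le_sum fun i _ => ?_) hs.le
    have hz := hunique σ' hσ' (.start s) (.start s hs)
    rw [continuationPayoff_one_noncoop (fun hg j _ => hz hg j),
      continuationPayoff_one_noncoop (fun _ j hj => by simp)]
    rcases hgame : (History.start (n := n) s).game with _ | g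
    · exact le_rfl
    · simp [hz (by simp [hgame]) i]
  · have : μ s = 0 := le_antisymm (not_lt.1 hs) (hμ.nonneg s)
    simp [this]

end Equilibrium

/-! ### Incentive constraints in terms of time on the good task -/

section Incentives

variable {n : ℕ} {E : Environment n} {m : ReactiveAssignment} {r : ℝ} {μ : State m.k → ℝ}

open ReactiveAssignment

theorem ReactiveAssignment.stepOp_onGood (s : State m.k) :
    m.stepOp E m.onGood s = m.taskProb s .tG := by
  rw [stepOp_apply, sum_nextProb_mul]
  simp [onGood, E.sum_outcomeProb]

/-- Arrivals depend only on the task drawn, so next-period expectations are affine in the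
probability of the good task. -/
theorem ReactiveAssignment.stepOp_outcome (f : Option Game → ℝ) (hf : f none = 0)
    (s : State m.k) :
    m.stepOp E (fun s => f s.current.2) s = E.arr .tB * f (some .B) +
      (E.arr .tG * f (some .G) - E.arr .tB * f (some .B)) * m.stepOp E m.onGood s := by
  rw [stepOp_onGood, stepOp_apply, sum_nextProb_mul]
  simp only [State.current_shift, E.sum_outcomeProb_mul, hf, Task.game]
  have : m.taskProb s .tB = 1 - m.taskProb s .tG := by linarith [m.taskProb_sum s]
  rw [this]; ring

theorem ReactiveAssignment.IsSteadyState.sum_outcome (hμ : m.IsSteadyState E μ)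
    (f : Option Game → ℝ) (hf : f none = 0) :
    ∑ s, μ s * f s.current.2 = E.arr .tB * f (some .B) +
      (E.arr .tG * f (some .G) - E.arr .tB * f (some .B)) * ∑ s, μ s * m.onGood s := by
  rw [← hμ.sum_mul_stepOp (fun s => f s.current.2), ← hμ.sum_mul_stepOp m.onGood]
  simp_rw [stepOp_outcome f hf, mul_add, Finset.sum_add_distrib, ← Finset.sum_mul, hμ.sum_eq_one,
    one_mul, Finset.mul_sum]
  congr 1
  exact Finset.sum_congr rfl fun s _ => by ring

theorem ReactiveAssignment.IsSteadyState.game_eq (hμ : m.IsSteadyState E μ) {s : State m.k}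
    (hs : 0 < μ s) {g : Game} (hg : s.current.2 = some g) : g = s.current.1.game := by
  obtain ⟨s', x, -, hx, rfl⟩ := hμ.exists_pred hs
  rw [State.current_shift] at hg ⊢
  by_contra hne
  rw [nextProb, hg] at hx
  simp [Environment.outcomeProb, hne] at hx

/-- The discounted number of periods on the good task, including the current one. -/
noncomputable def goodTime (E : Environment n) (m : ReactiveAssignment) (β : ℝ) :
    State m.k → ℝ :=
  m.discounted E β m.onGood

/-- Each future period is worth `b` in expectation, less `b - g` if it is on the good task. The
current arrival is already realized, so the Bellman equations are compared only after one
application of `stepOp`. -/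
theorem futureBenefit_eq {β : ℝ} (h0 : 0 ≤ β) (h1 : β < 1) (s : State m.k) :
    futureBenefit E m β s = β / (1 - β) * (E.arr .tB * E.c .B) -
      (E.arr .tB * E.c .B - E.arr .tG * E.c .G) * (β * m.stepOp E (goodTime E m β) s) := by
  have h2 : 1 - β ≠ 0 := by linarith
  set f : State m.k → ℝ := fun s => E.benefit s.current.2 with hf
  set y := goodTime E m β with hy
  set b := E.arr .tB * E.c .B
  set g := E.arr .tG * E.c .G
  have hstep : ∀ u v : State m.k → ℝ, (∀ s, u s = v s + β * m.stepOp E u s) →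
      ∀ s, m.stepOp E u s = m.stepOp E v s + β * m.stepOp E (m.stepOp E u) s := by
    intro u v huv s
    have : u = v + β • m.stepOp E u := funext fun s => by simpa using huv s
    conv_lhs => rw [this]
    rw [map_add, map_smul]; simp
  have hu := hstep _ f (m.discounted_eq E h0 h1 f)
  have hv := hstep y _ (m.discounted_eq E h0 h1 m.onGood)
  have hfix := m.eq_of_isFixed E h0 h1 hu (v := fun s => b / (1 - β) + (-(b - g)) *
      m.stepOp E y s) fun s => by
    rw [stepOp_affine, hf, stepOp_outcome E.benefit rfl]
    rw [hv s]
    simp only [Environment.benefit]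
    have : b / (1 - β) = b + β * (b / (1 - β)) := by field_simp; ring
    linear_combination this
  rw [futureBenefit, hfix]
  ring

theorem goodTime_le {β : ℝ} (h0 : 0 ≤ β) (h1 : β < 1) (s : State m.k) :
    goodTime E m β s ≤ 1 / (1 - β) := by
  refine m.le_of_isFixed E h0 h1 (m.discounted_eq E h0 h1 m.onGood)
    (v := fun _ => 1 / (1 - β)) (g := fun _ => 1) (fun s => ?_) (fun s => ?_) s
  · have : 1 - β ≠ 0 := by linarith
    rw [stepOp_const]; field_simp; ring
  · unfold onGood; split_ifs <;> norm_num

theorem le_futureBenefit {β : ℝ} (h0 : 0 ≤ β) (h1 : β < 1)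
    (hgb : E.arr .tG * E.c .G ≤ E.arr .tB * E.c .B) (s : State m.k) :
    β / (1 - β) * (E.arr .tG * E.c .G) ≤ futureBenefit E m β s := by
  rw [futureBenefit_eq h0 h1]
  have h2 := m.stepOp_mono E (f := goodTime E m β) (g := fun _ => 1 / (1 - β))
    (fun s => goodTime_le h0 h1 s) s
  rw [stepOp_const] at h2
  have h3 : β * m.stepOp E (goodTime E m β) s ≤ β / (1 - β) := by
    rw [← mul_one_div]; exact mul_le_mul_of_nonneg_left h2 h0
  nlinarith

/-- Reshuffling costs the factor `1 - r` on the first step; on later steps the smaller discount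
factor can only lower a stream of nonnegative benefits. -/
theorem futureBenefit_le (hr : r ∈ Set.Icc (0 : ℝ) 1) (s : State m.k) :
    futureBenefit E m ((1 - r) * E.δ) s ≤ (1 - r) * futureBenefit E m E.δ s := by
  have h0 := discount_nonneg E hr
  have h1 := discount_lt_one E hr
  set f : State m.k → ℝ := fun s => E.benefit s.current.2 with hf
  have hnn := m.discounted_nonneg E h0 (f := f) fun s => E.benefit_nonneg _
  have hPnn : ∀ s, 0 ≤ m.stepOp E (m.discounted E ((1 - r) * E.δ) f) s := fun s => by
    have := m.stepOp_mono E (f := fun _ => 0) (fun s => hnn s) s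
    rwa [stepOp_const] at this
  have hle : ∀ s, m.discounted E ((1 - r) * E.δ) f s - m.discounted E E.δ f s ≤ 0 := fun s =>
    m.nonpos_of_le_stepOp E (m.isClosedSet_univ E) E.δ_pos.le E.δ_lt_one
      (u := m.discounted E ((1 - r) * E.δ) f - m.discounted E E.δ f) (fun s _ => by
        rw [map_sub, Pi.sub_apply, Pi.sub_apply, m.discounted_eq E h0 h1 f s,
          m.discounted_eq E E.δ_pos.le E.δ_lt_one f s]
        have := mul_nonneg (mul_nonneg hr.1 E.δ_pos.le) (hPnn s)
        linarith) s (Set.mem_univ _)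
  rw [futureBenefit, futureBenefit, mul_assoc]
  refine mul_le_mul_of_nonneg_left (mul_le_mul_of_nonneg_left ?_ E.δ_pos.le)
    (sub_nonneg.2 hr.2)
  exact m.stepOp_mono E (fun s => by linarith [hle s]) s

/-! #### Unobserved good games -/

/-- The states that the designer cannot tell apart. -/
def SameObservations {k : ℕ} (badObserved : Prop) (s s' : State k) : Prop :=
  ∀ j, (s j).1 = (s' j).1 ∧ (badObserved → ((s j).2 = some Game.B ↔ (s' j).2 = some Game.B))

theorem SameObservations.shift {k : ℕ} {badObserved : Prop} {s s' : State k}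
    (h : SameObservations badObserved s s') {x x' : Period} (ht : x.1 = x'.1)
    (hx : badObserved → (x.2 = some Game.B ↔ x'.2 = some Game.B)) :
    SameObservations badObserved (s.shift x) (s'.shift x') := by
  intro j
  refine Fin.lastCases ?_ (fun j => ?_) j
  · simpa [State.shift] using ⟨ht, hx⟩
  · simpa [State.shift] using h j.succ

theorem SameObservations.refl {k : ℕ} (badObserved : Prop) (s : State k) :
    SameObservations badObserved s s := fun _ => ⟨rfl, fun _ => Iff.rfl⟩

theorem stepOp_congr_of_sameObservations {badObserved : Prop}
    (hm : m.IgnoresGoodGames badObserved) {f : State m.k → ℝ}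
    (hf : ∀ s s', SameObservations badObserved s s' → f s = f s') {s s' : State m.k}
    (h : SameObservations badObserved s s') : m.stepOp E f s = m.stepOp E f s' := by
  rw [stepOp_apply, stepOp_apply]
  refine Finset.sum_congr rfl fun x _ => ?_
  rw [hf _ _ (h.shift rfl fun _ => Iff.rfl), nextProb, nextProb, taskProb, taskProb, hm s s' h]

/-- Both the task indicator and future assignments are functions of the observations. -/
theorem goodTime_congr {badObserved : Prop} (hm : m.IgnoresGoodGames badObserved) {β : ℝ}
    {s s' : State m.k} (h : SameObservations badObserved s s') :
    goodTime E m β s = goodTime E m β s' := by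
  refine tsum_congr fun j => ?_
  congr 1
  induction j generalizing s s' with
  | zero =>
    have hcur : s.current.1 = s'.current.1 := (h (Fin.last m.k)).1
    simp only [pow_zero, Module.End.one_apply]
    unfold onGood
    rw [hcur]
  | succ j ih =>
    rw [pow_succ', Module.End.mul_apply]
    exact stepOp_congr_of_sameObservations hm (fun s s' hss => ih hss) h

/-- Redraw the current arrival: a good game has positive probability, and no bad game can have been
observed on the good task. -/
theorem exists_sameObservations_good {badObserved : Prop} (hμ : m.IsSteadyState E μ)
    {s : State m.k} (hs : 0 < μ s) (hg : s.current.1 = Task.tG) :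
    ∃ s', 0 < μ s' ∧ s'.current = (Task.tG, some Game.G) ∧
      SameObservations badObserved s s' := by
  obtain ⟨s₀, x, hs₀, hx, rfl⟩ := hμ.exists_pred hs
  rw [State.current_shift] at hg
  have htask : 0 < m.taskProb s₀ .tG := by
    refine lt_of_le_of_ne (m.taskProb_nonneg s₀ _) fun h => ?_
    rw [nextProb, hg, ← h, zero_mul] at hx
    exact lt_irrefl _ hx
  refine ⟨s₀.shift (.tG, some .G), hμ.pos_shift hs₀ ?_, State.current_shift _ _,
    (SameObservations.refl _ s₀).shift hg fun _ => ?_⟩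
  · simpa [nextProb, Environment.outcomeProb, Task.game] using mul_pos htask (E.arr_pos .tG)
  · refine ⟨fun h => ?_, fun h => by simp at h⟩
    rw [nextProb, hg, h] at hx
    simp [Environment.outcomeProb, Task.game] at hx

end Incentives

/-! ### The most frequent good task in a fully cooperative assignment -/

/-- The conditions on the primitives. -/
structure IsDesignProblem {n : ℕ} (E : Environment n) (κ : ℝ) : Prop where
  le : E.arr .tG * E.c .G < E.arr .tB * E.c .B
  κ_eq : (E.arr .tB * E.c .B - E.arr .tG * E.c .G) * κ =
    E.δ / (1 - E.δ) * (E.arr .tB * E.c .B) - E.d .G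
  d_bad_le : E.d .B ≤ E.δ / (1 - E.δ) * (E.arr .tG * E.c .G)

section Cooperative

variable {n : ℕ} {E : Environment n} {m : ReactiveAssignment} {r : ℝ} {μ : State m.k → ℝ}
variable {κ θ : ℝ} {N : ℕ}

open ReactiveAssignment

theorem goodTime_eq (s : State m.k) :
    goodTime E m E.δ s = m.onGood s + E.δ * m.stepOp E (goodTime E m E.δ) s :=
  m.discounted_eq E E.δ_pos.le E.δ_lt_one _ s

/-- The meaning of `κ`: the good-game constraint at discount factor `δ` binds exactly when the good
time, current period included, is `1 + κ`. -/
theorem IsDesignProblem.futureBenefit_sub_d (hE : IsDesignProblem E κ) {s : State m.k}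
    (hg : s.current.1 = Task.tG) :
    futureBenefit E m E.δ s - E.d .G = (E.arr .tB * E.c .B - E.arr .tG * E.c .G) *
      (1 + κ - goodTime E m E.δ s) := by
  rw [futureBenefit_eq E.δ_pos.le E.δ_lt_one, goodTime_eq s, onGood, if_pos hg]
  linear_combination -hE.κ_eq

/-- Indistinguishability carries the constraint from states with a good game to all recurring states
on the good task. On the bad task, good time is the discounted mean over successors, so the maximum
principle extends the bound. Positive reshuffling wastes future benefit, so it must exceed `d_G`
strictly. -/
theorem IsDesignProblem.goodTime_le_of_incentives (hE : IsDesignProblem E κ) (hκ : 0 < κ)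
    {badObserved : Prop} (hm : m.IgnoresGoodGames badObserved) (hμ : m.IsSteadyState E μ)
    (hr : r ∈ Set.Icc (0 : ℝ) 1)
    (hIC : ∀ s, 0 < μ s → ∀ g, s.current.2 = some g →
      E.d g ≤ futureBenefit E m ((1 - r) * E.δ) s) :
    (∀ s, 0 < μ s → goodTime E m E.δ s ≤ 1 + κ) ∧
    (r ≠ 0 → ∀ s, 0 < μ s → s.current.1 = Task.tG → goodTime E m E.δ s < 1 + κ) := by
  have hb : 0 < E.arr .tB * E.c .B - E.arr .tG * E.c .G := by linarith [hE.le]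
  have hgood : ∀ s, 0 < μ s → s.current.1 = Task.tG →
      E.d .G ≤ (1 - r) * futureBenefit E m E.δ s := by
    intro s hs hg
    obtain ⟨s', hs', hc, hobs⟩ := exists_sameObservations_good (badObserved := badObserved) hμ hs hg
    have h1 := (hIC s' hs' .G (by rw [hc])).trans (futureBenefit_le hr s')
    have h2 := hE.futureBenefit_sub_d (m := m) hg
    have h3 := hE.futureBenefit_sub_d (m := m) (s := s') (by rw [hc])
    rw [goodTime_congr hm hobs, ← h3] at h2
    rwa [sub_left_inj.1 h2]
  have hle : ∀ s, 0 < μ s → s.current.1 = Task.tG → goodTime E m E.δ s ≤ 1 + κ := by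
    intro s hs hg
    have h1 := hgood s hs hg
    have h2 := hE.futureBenefit_sub_d (m := m) hg
    have h3 := futureBenefit_nonneg (E := E) (m := m) E.δ_pos.le s
    have h4 : 0 ≤ (E.arr .tB * E.c .B - E.arr .tG * E.c .G) * (1 + κ - goodTime E m E.δ s) := by
      rw [← h2]; nlinarith [hr.1]
    linarith [nonneg_of_mul_nonneg_right h4 hb]
  refine ⟨fun s hs => ?_, fun hr0 s hs hg => ?_⟩
  · have h1 := m.nonpos_of_le_stepOp E hμ.isClosedSet E.δ_pos.le E.δ_lt_one
      -- The positive part vanishes at recurring good-task states, so its inequality is needed only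
      -- on the bad task.
      (u := fun s => max (goodTime E m E.δ s - (1 + κ)) 0) (fun s hs => ?_) s hs
    · linarith [le_max_left (goodTime E m E.δ s - (1 + κ)) 0]
    · have hnn : 0 ≤ m.stepOp E (fun s => max (goodTime E m E.δ s - (1 + κ)) 0) s := by
        have := m.stepOp_mono E (f := fun _ => 0)
          (g := fun s => max (goodTime E m E.δ s - (1 + κ)) 0) (fun s => le_max_right _ _) s
        rwa [stepOp_const] at this
      refine max_le ?_ (mul_nonneg E.δ_pos.le hnn)
      by_cases hg : s.current.1 = Task.tG
      · linarith [hle s hs hg, mul_nonneg E.δ_pos.le hnn]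
      · have h2 := m.stepOp_mono E (f := fun s => -(1 + κ) + 1 * goodTime E m E.δ s)
          (g := fun s => max (goodTime E m E.δ s - (1 + κ)) 0)
          (fun s => le_trans (by simp only; linarith) (le_max_left _ _)) s
        rw [stepOp_affine] at h2
        have h3 := goodTime_eq (E := E) s
        rw [onGood, if_neg hg] at h3
        have h4 := mul_le_mul_of_nonneg_left h2 E.δ_pos.le
        nlinarith [E.δ_lt_one]
  · have h1 := hgood s hs hg
    have h2 := hE.futureBenefit_sub_d (m := m) hg
    have hr' : 0 < r := lt_of_le_of_ne hr.1 (Ne.symm hr0)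
    have hd := E.d_pos .G
    have h3 : E.d .G < futureBenefit E m E.δ s := by
      have h5 := futureBenefit_nonneg (E := E) (m := m) E.δ_pos.le s
      rcases h5.eq_or_lt with h6 | h6
      · rw [← h6, mul_zero] at h1; linarith
      · nlinarith
    have h4 : 0 < (E.arr .tB * E.c .B - E.arr .tG * E.c .G) * (1 + κ - goodTime E m E.δ s) := by
      rw [← h2]; linarith
    linarith [pos_of_mul_pos_right h4 hb.le]

/-- Fully cooperative assignments with at least the cycle's share of the good task are cycles with
binding incentive constraints. -/
theorem IsDesignProblem.cycle_of_incentives (hE : IsDesignProblem E κ)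
    (hc : IsCycle E.δ κ θ N) {badObserved : Prop} (hm : m.IgnoresGoodGames badObserved)
    (hμ : m.IsSteadyState E μ) (hr : r ∈ Set.Icc (0 : ℝ) 1)
    (hIC : ∀ s, 0 < μ s → ∀ g, s.current.2 = some g →
      E.d g ≤ futureBenefit E m ((1 - r) * E.δ) s)
    (hshare : 1 ≤ (N + 2 - θ) * ∑ s, μ s * m.onGood s) {s : State m.k} (hs : 0 < μ s)
    (hg : s.current.1 = Task.tG) :
    futureBenefit E m ((1 - r) * E.δ) s = E.d .G ∧
    m.pathProb E s (List.replicate N .tB) = 1 ∧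
    0 < m.pathProb E s (List.replicate N .tB ++ [.tG]) ∧
    m.pathProb E s (List.replicate (N + 1) .tB ++ [.tG]) =
      m.pathProb E s (List.replicate (N + 1) .tB) := by
  have hκ := hc.κ_pos
  have hκ1 : 0 < 1 + κ := by linarith
  obtain ⟨hle, hlt⟩ := hE.goodTime_le_of_incentives hκ hm hμ hr hIC
  obtain ⟨h1, h2⟩ := extremal_cycle hc hμ (w := fun s => 0 + 1 / (1 + κ) * goodTime E m E.δ s)
    (fun s => by
      rw [stepOp_affine]
      have := goodTime_eq (E := E) s
      rw [this]; ring)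
    (fun s hs => by
      rw [zero_add, one_div_mul_eq_div, div_le_one hκ1]; exact hle s hs) hshare hs hg
  rw [zero_add, one_div_mul_eq_div, div_eq_one_iff_eq hκ1.ne'] at h1
  have hr0 : r = 0 := by
    by_contra hr0
    exact absurd h1 (hlt hr0 s hs hg).ne
  refine ⟨?_, h2⟩
  have h3 := hE.futureBenefit_sub_d (m := m) hg
  rw [h1, sub_self, mul_zero] at h3
  rw [hr0, sub_zero, one_mul]
  linarith

end Cooperative

/-! ### Particular assignments -/

/-- The distribution over tasks that puts probability `p` on the good task. -/
noncomputable def mixedTask (p : Set.Icc (0 : ℝ) 1) : stdSimplex ℝ Task :=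
  ⟨fun t => match t with
    | .tG => p
    | .tB => 1 - p, by
    intro t
    cases t
    exacts [p.2.1, sub_nonneg.2 p.2.2], by
    rw [sum_task]; ring⟩

section Assignments

variable {n : ℕ} {E : Environment n}

open ReactiveAssignment

theorem exists_constantAssignment (badObserved : Prop) (k : ℕ) (p : Set.Icc (0 : ℝ) 1) :
    ∃ m : ReactiveAssignment, m.k = k ∧ m.IgnoresGoodGames badObserved ∧
      ∀ s, m.taskProb s .tG = p :=
  ⟨⟨k, fun _ => mixedTask p⟩, rfl, fun _ _ _ => rfl, fun _ => rfl⟩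

theorem ReactiveAssignment.IsSteadyState.share_eq_of_constant {m : ReactiveAssignment}
    {μ : State m.k → ℝ} (hμ : m.IsSteadyState E μ) {p : ℝ} (hm : ∀ s, m.taskProb s .tG = p) :
    ∑ s, μ s * m.onGood s = p := by
  rw [← hμ.sum_mul_stepOp]
  simp_rw [stepOp_onGood, hm]
  rw [← Finset.sum_mul, hμ.sum_eq_one, one_mul]

/-- The last `j` periods were all on the bad task. -/
def BadRun {k : ℕ} (s : State k) (j : ℕ) : Prop :=
  ∀ i : Fin (k + 1), k + 1 ≤ i + j → (s i).1 = Task.tB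

theorem BadRun.mono {k : ℕ} {s : State k} {i j : ℕ} (h : BadRun s j) (hij : i ≤ j) :
    BadRun s i := fun l hl => h l (by omega)

theorem badRun_zero {k : ℕ} (s : State k) : BadRun s 0 := fun i hi => by
  have := i.2; omega

theorem badRun_one_iff {k : ℕ} (s : State k) : BadRun s 1 ↔ s.current.1 = Task.tB := by
  refine ⟨fun h => h (Fin.last k) (by simp), fun h i hi => ?_⟩
  have : i = Fin.last k := Fin.ext (by have := i.2; simp; omega)
  rw [this]; exact h

/-- The bound `j ≤ k` ensures that the oldest entry, which the shift forgets, is not needed. -/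
theorem badRun_shift_succ_iff {k : ℕ} {s : State k} {x : Period} {j : ℕ} (hj : j ≤ k) :
    BadRun (s.shift x) (j + 1) ↔ x.1 = Task.tB ∧ BadRun s j := by
  constructor
  · intro h
    refine ⟨by simpa [State.shift] using h (Fin.last k) (by simp), fun i hi => ?_⟩
    obtain ⟨i, rfl⟩ := Fin.exists_succ_eq.2 (show i ≠ 0 by rintro rfl; simp at hi; omega)
    have := h i.castSucc (by simp at hi ⊢; omega)
    simpa [State.shift] using this
  · rintro ⟨hx, h⟩ i
    refine Fin.lastCases (fun _ => ?_) (fun i hi => ?_) i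
    · simpa [State.shift] using hx
    · simpa [State.shift] using h i.succ (by simp at hi ⊢; omega)

open Classical in
/-- The number of periods, up to `N + 1`, since the team was last on the good task. -/
noncomputable def run {k : ℕ} (N : ℕ) (s : State k) : ℕ := Nat.findGreatest (BadRun s) (N + 1)

open Classical in
theorem run_le {k : ℕ} (N : ℕ) (s : State k) : run N s ≤ N + 1 := Nat.findGreatest_le _

open Classical in
theorem badRun_run {k : ℕ} (N : ℕ) (s : State k) : BadRun s (run N s) :=
  Nat.findGreatest_spec (P := BadRun s) (Nat.zero_le (N + 1)) (badRun_zero s)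

theorem run_eq_zero_iff {k : ℕ} (N : ℕ) (s : State k) :
    run N s = 0 ↔ s.current.1 = Task.tG := by
  classical
  constructor
  · intro h
    by_contra hne
    have h1 := Nat.le_findGreatest (P := BadRun s) (n := N + 1) (by omega : 1 ≤ N + 1)
      ((badRun_one_iff s).2 (Task.eq_tB_of_ne hne))
    unfold run at h
    omega
  · intro h
    by_contra hne
    have h1 := (badRun_one_iff s).1 ((badRun_run N s).mono (by omega))
    rw [h] at h1
    exact absurd h1 (by decide)

theorem run_shift_tG {k : ℕ} (N : ℕ) (s : State k) (o : Option Game) :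
    run N (s.shift (.tG, o)) = 0 := by
  rw [run_eq_zero_iff, State.current_shift]

theorem run_shift_tB {k N : ℕ} (hN : N ≤ k) (s : State k) (o : Option Game) :
    run N (s.shift (.tB, o)) = min (run N s + 1) (N + 1) := by
  classical
  rw [run, Nat.findGreatest_eq_iff]
  refine ⟨min_le_right _ _, fun _ => ?_, fun j hj hj' hrun => ?_⟩
  · rw [Nat.add_min_add_right, badRun_shift_succ_iff ((min_le_right _ _).trans hN)]
    exact ⟨rfl, (badRun_run N s).mono (min_le_left _ _)⟩
  · obtain ⟨j, rfl⟩ : ∃ i, j = i + 1 := ⟨j - 1, by omega⟩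
    rw [badRun_shift_succ_iff (by omega)] at hrun
    have := Nat.le_findGreatest (P := BadRun s) (n := N + 1) (by omega : j ≤ N + 1) hrun.2
    unfold run at hj
    omega

theorem run_congr {k : ℕ} (N : ℕ) {s s' : State k} (h : ∀ j, (s j).1 = (s' j).1) :
    run N s = run N s' := by
  have : BadRun s = BadRun s' := by
    funext j
    simp only [BadRun, h]
  unfold run
  congr 1

/-- The probability of the good task after `τ` periods on the bad one, in an assignment that returns
to the good task with probability `θ` after `N` periods, and for sure one period later. -/
noncomputable def returnProb (N : ℕ) (θ : Set.Icc (0 : ℝ) 1) (τ : ℕ) : Set.Icc (0 : ℝ) 1 :=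
  if τ < N then 0 else if τ = N then θ else 1

theorem exists_cycleAssignment (badObserved : Prop) (k N : ℕ) (θ : Set.Icc (0 : ℝ) 1) :
    ∃ m : ReactiveAssignment, m.k = k ∧ m.IgnoresGoodGames badObserved ∧
      ∀ s, m.taskProb s .tG = returnProb N θ (run N s) := by
  refine ⟨⟨k, fun s => mixedTask (returnProb N θ (run N s))⟩, rfl, fun s s' h => ?_, fun _ => rfl⟩
  change mixedTask _ = mixedTask _
  congr 2
  exact run_congr N fun j => (h j).1

variable {m : ReactiveAssignment} {N : ℕ} {θ : Set.Icc (0 : ℝ) 1} {μ : State m.k → ℝ}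

/-- The chain lumps: under a cycle the run length is itself a Markov chain on `0, ..., N + 1`. -/
theorem stepOp_run_of_cycle (hm : ∀ s, m.taskProb s .tG = returnProb N θ (run N s))
    (hN : N ≤ m.k) (F : ℕ → ℝ) (s : State m.k) :
    m.stepOp E (fun s => F (run N s)) s =
      if run N s < N then F (run N s + 1)
      else if run N s = N then θ * F 0 + (1 - θ) * F (N + 1) else F 0 := by
  have hB : m.taskProb s .tB = 1 - m.taskProb s .tG := by linarith [m.taskProb_sum s]
  rw [stepOp_apply, sum_nextProb_mul, hB, hm, returnProb]
  simp_rw [run_shift_tG, run_shift_tB hN, ← Finset.sum_mul, E.sum_outcomeProb, one_mul]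
  have := run_le N s
  split_ifs with h2 h3
  · rw [min_eq_left (by omega)]; simp
  · rw [h3, min_self]
  · simp

theorem ReactiveAssignment.IsSteadyState.share_eq_of_cycle (hμ : m.IsSteadyState E μ)
    (hm : ∀ s, m.taskProb s .tG = returnProb N θ (run N s)) (hN : N ≤ m.k) :
    ((N : ℝ) + 2 - θ) * ∑ s, μ s * m.onGood s = 1 := by
  -- `R` is the expected time to the next good period, and `F` is the same but zero on the good
  -- task. Thus `R = 1 + E[F]`, and stationarity gives Kac's formula: share times mean return time
  -- `N + 2 - θ` is one.
  let R : ℕ → ℝ := fun τ => if τ ≤ N then (N : ℝ) - τ + 2 - θ else 1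
  let F : ℕ → ℝ := fun τ => if τ = 0 then 0 else R τ
  have hstep : ∀ s, m.stepOp E (fun s => F (run N s)) s = R (run N s) - 1 := by
    intro s
    rw [stepOp_run_of_cycle hm hN]
    have := run_le N s
    split_ifs with h1 h2
    · simp only [F, R, if_neg (Nat.succ_ne_zero _), if_pos h1.le,
        if_pos (show run N s + 1 ≤ N from h1)]
      push_cast; ring
    · simp [F, R, h2]; ring
    · have : run N s = N + 1 := by omega
      simp [F, R, this]
  have hgood : ∀ s : State m.k, R (run N s) - F (run N s) = ((N : ℝ) + 2 - θ) * m.onGood s := by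
    intro s
    by_cases hg : s.current.1 = Task.tG
    · rw [(run_eq_zero_iff N s).2 hg, onGood, if_pos hg]
      simp [F, R]
    · have := mt (run_eq_zero_iff N s).1 hg
      rw [onGood, if_neg hg]
      simp [F, this]
  have h1 := hμ.sum_mul_stepOp fun s => F (run N s)
  simp_rw [hstep, mul_sub, Finset.sum_sub_distrib, mul_one] at h1
  rw [hμ.sum_eq_one] at h1
  calc ((N : ℝ) + 2 - θ) * ∑ s, μ s * m.onGood s
      = ∑ s, (μ s * R (run N s) - μ s * F (run N s)) := by
        rw [Finset.mul_sum]
        refine Finset.sum_congr rfl fun s _ => ?_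
        rw [← mul_sub, hgood]; ring
    _ = 1 := by rw [Finset.sum_sub_distrib]; linarith

theorem goodTime_eq_of_cycle {κ : ℝ} (hc : IsCycle E.δ κ θ N)
    (hm : ∀ s, m.taskProb s .tG = returnProb N θ (run N s)) (hN : N ≤ m.k) {s : State m.k}
    (hg : s.current.1 = Task.tG) : goodTime E m E.δ s = 1 + κ := by
  -- `η` is the expected discount factor until the next good period. `Y` is the resulting guess for
  -- the good time, confirmed by uniqueness of the Bellman solution.
  let η : ℕ → ℝ := fun τ =>
    if τ ≤ N then E.δ ^ (N - τ) * (θ * E.δ + (1 - θ) * E.δ ^ 2) else E.δ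
  let Y : ℕ → ℝ := fun τ => (1 + κ) * if τ = 0 then 1 else η τ
  have hη0 : 1 + (1 + κ) * η 0 = 1 + κ := by
    simp only [η, if_pos (Nat.zero_le N), Nat.sub_zero]
    linear_combination -hc.eq
  have hstep : ∀ s, E.δ * m.stepOp E (fun s => Y (run N s)) s = (1 + κ) * η (run N s) := by
    intro s
    rw [stepOp_run_of_cycle hm hN]
    have hle := run_le N s
    split_ifs with h1 h2
    · have h3 : N - run N s = (N - (run N s + 1)) + 1 := by omega
      simp only [Y, η, if_neg (Nat.succ_ne_zero _), if_pos h1.le,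
        if_pos (show run N s + 1 ≤ N from h1)]
      rw [h3]; ring
    · simp only [Y, η, h2, if_true, if_neg (Nat.succ_ne_zero _), le_refl, Nat.sub_self,
        if_neg (Nat.not_succ_le_self N)]
      ring
    · have h3 : run N s = N + 1 := by omega
      simp only [Y, η, h3, if_true, if_neg (Nat.not_succ_le_self N)]
      ring
  have hfix := m.eq_of_isFixed E E.δ_pos.le E.δ_lt_one
    (goodTime_eq (E := E)) (v := fun s => Y (run N s)) fun s => by
      rw [hstep]
      by_cases hs : s.current.1 = Task.tG
      · rw [onGood, if_pos hs, (run_eq_zero_iff N s).2 hs, hη0]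
        simp [Y]
      · rw [onGood, if_neg hs, zero_add]
        simp only [Y, if_neg (mt (run_eq_zero_iff N s).1 hs)]
  rw [hfix]
  simp only [Y]
  rw [(run_eq_zero_iff N s).2 hg]
  simp

theorem fullyCooperative_of_cycle {κ : ℝ} (hE : IsDesignProblem E κ)
    (hc : IsCycle E.δ κ θ N) (hμ : m.IsSteadyState E μ)
    (hm : ∀ s, m.taskProb s .tG = returnProb N θ (run N s)) (hN : N ≤ m.k) :
    FullyCooperative E m 0 μ := by
  refine fullyCooperative_of_incentives ⟨le_rfl, zero_le_one⟩ zero_lt_one hμ fun s hs g hg => ?_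
  rw [sub_zero, one_mul]
  have hgame := hμ.game_eq hs hg
  by_cases ht : s.current.1 = Task.tG
  · rw [ht] at hgame
    subst hgame
    have h1 := hE.futureBenefit_sub_d (m := m) ht
    rw [goodTime_eq_of_cycle hc hm hN ht, sub_self, mul_zero] at h1
    exact (sub_eq_zero.1 h1).ge
  · rw [Task.eq_tB_of_ne ht] at hgame
    subst hgame
    exact hE.d_bad_le.trans (le_futureBenefit E.δ_pos.le E.δ_lt_one hE.le.le s)

end Assignments

/-! ### Task shares and social values -/

section Values

variable {n : ℕ} {E : Environment n} {m : ReactiveAssignment} {r : ℝ} {μ : State m.k → ℝ}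

open ReactiveAssignment

theorem taskShare_tG (μ : State m.k → ℝ) : taskShare m μ .tG = ∑ s, μ s * m.onGood s := by
  simp [taskShare, onGood]

theorem ReactiveAssignment.IsSteadyState.taskShare_tB (hμ : m.IsSteadyState E μ) :
    taskShare m μ .tB = 1 - taskShare m μ .tG := by
  rw [eq_sub_iff_add_eq, ← hμ.sum_eq_one, taskShare, taskShare, ← Finset.sum_add_distrib]
  refine Finset.sum_congr rfl fun s _ => ?_
  cases h : s.current.1 <;> simp

theorem ReactiveAssignment.IsSteadyState.taskShare_nonneg (hμ : m.IsSteadyState E μ) (t : Task) :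
    0 ≤ taskShare m μ t :=
  Finset.sum_nonneg fun s _ => by
    split_ifs
    exacts [hμ.nonneg s, le_rfl]

theorem ReactiveAssignment.IsSteadyState.taskShare_pos (hμ : m.IsSteadyState E μ) {s : State m.k}
    (hs : 0 < μ s) {t : Task} (ht : s.current.1 = t) : 0 < taskShare m μ t :=
  Finset.sum_pos' (fun s _ => by
    split_ifs
    exacts [hμ.nonneg s, le_rfl]) ⟨s, Finset.mem_univ s, by rwa [if_pos ht]⟩

theorem FullyCooperative.teamValue_eq (h : FullyCooperative E m r μ)
    (hμ : m.IsSteadyState E μ) :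
    teamValue E m r μ = E.arr .tB * E.V .B +
      (E.arr .tG * E.V .G - E.arr .tB * E.V .B) * taskShare m μ .tG := by
  have hsum := hμ.sum_outcome E.socialValue rfl
  rw [taskShare_tG]
  simp only [Environment.socialValue] at hsum
  rw [← hsum, teamValue]
  refine Finset.sum_congr rfl fun s _ => ?_
  rcases hg : s.current.2 with _ | g
  · simp [Environment.socialValue]
  · rw [if_pos ⟨h.1, fun σ hσ h' hh hs => h.2 σ hσ h' hh (by
      rw [History.game, hs, hg]; exact Option.some_ne_none g)⟩]
    simp [Environment.socialValue]

theorem FullyNonCooperative.teamValue_eq_zero (h : FullyNonCooperative E m r μ)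
    (hμ : m.IsSteadyState E μ) : teamValue E m r μ = 0 := by
  refine Finset.sum_eq_zero fun s _ => ?_
  split_ifs with hc
  · rcases hg : s.current.2 with _ | g
    · simp [Environment.socialValue]
    · rcases (hμ.nonneg s).eq_or_lt with h0 | h0
      · rw [← h0, zero_mul]
      · obtain ⟨σ, hσ⟩ := h.1
        have h1 := h.2 σ hσ (.start s) (.start s h0) (by
          simp [History.game, History.state, hg]) E.player
        have h2 := hc.2 σ hσ (.start s) (.start s h0) rfl E.player
        rw [h1] at h2
        exact absurd h2 zero_ne_one
  · rfl

end Values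

/-! ### Modified team structures -/

namespace TeamStructure

variable {n : ℕ} {E : Environment n} {badObserved : Prop} {Λ : TeamStructure}

open ReactiveAssignment

/-- An assignment with its reshuffling rate and steady state that may be part of a structure. -/
structure IsComponent (E : Environment n) (badObserved : Prop) (m : ReactiveAssignment) (r : ℝ)
    (μ : State m.k → ℝ) : Prop where
  rate_mem : r ∈ Set.Icc (0 : ℝ) 1
  steady : m.IsSteadyState E μ
  observable : m.IgnoresGoodGames badObserved

theorem IsFeasible.isComponent (hΛ : Λ.IsFeasible E badObserved) {m : ReactiveAssignment}
    (hm : m ∈ Λ.weight.support) : IsComponent E badObserved m (Λ.rate m) (Λ.steady m) :=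
  ⟨hΛ.rate_mem m hm, hΛ.steady m hm, hΛ.observable m hm⟩

/-- The weights of a structure can be changed and two assignments be added. -/
theorem exists_modification (Λ : TeamStructure) {w : ReactiveAssignment →₀ ℝ}
    (hsupp : w.support ⊆ Λ.weight.support) (hw : ∀ m, 0 ≤ w m) {m₁ m₂ : ReactiveAssignment}
    (h₁ : m₁ ∉ Λ.weight.support) (h₂ : m₂ ∉ Λ.weight.support) (hne : m₁ ≠ m₂) (r₁ r₂ : ℝ)
    (μ₁ : State m₁.k → ℝ) (μ₂ : State m₂.k → ℝ) {a b : ℝ} (ha : 0 ≤ a) (hb : 0 ≤ b) :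
    ∃ Λ' : TeamStructure, (∀ m, 0 ≤ Λ'.weight m) ∧
      (∀ F : (m : ReactiveAssignment) → ℝ → (State m.k → ℝ) → ℝ,
        ∑ m ∈ Λ'.weight.support, Λ'.weight m * F m (Λ'.rate m) (Λ'.steady m) =
          ∑ m ∈ Λ.weight.support, w m * F m (Λ.rate m) (Λ.steady m) +
            a * F m₁ r₁ μ₁ + b * F m₂ r₂ μ₂) ∧
      ∀ P : (m : ReactiveAssignment) → ℝ → (State m.k → ℝ) → Prop,
        (∀ m ∈ w.support, P m (Λ.rate m) (Λ.steady m)) → P m₁ r₁ μ₁ → P m₂ r₂ μ₂ →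
          ∀ m ∈ Λ'.weight.support, P m (Λ'.rate m) (Λ'.steady m) := by
  classical
  have hw₁ : w m₁ = 0 := Finsupp.notMem_support_iff.1 fun h => h₁ (hsupp h)
  have hw₂ : w m₂ = 0 := Finsupp.notMem_support_iff.1 fun h => h₂ (hsupp h)
  set W : ReactiveAssignment →₀ ℝ := w + Finsupp.single m₁ a + Finsupp.single m₂ b with hW
  set R := Function.update (Function.update Λ.rate m₁ r₁) m₂ r₂ with hR
  set S := Function.update (Function.update Λ.steady m₁ μ₁) m₂ μ₂ with hS
  have hR₁ : R m₁ = r₁ := by simp [hR, Function.update_of_ne hne]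
  have hR₂ : R m₂ = r₂ := by simp [hR]
  have hS₁ : S m₁ = μ₁ := by simp [hS, Function.update_of_ne hne]
  have hS₂ : S m₂ = μ₂ := by simp [hS]
  have hold : ∀ m, m ≠ m₁ → m ≠ m₂ → R m = Λ.rate m ∧ S m = Λ.steady m ∧ W m = w m := by
    intro m hm₁ hm₂
    refine ⟨by simp [hR, Function.update_of_ne hm₁, Function.update_of_ne hm₂],
      by simp [hS, Function.update_of_ne hm₁, Function.update_of_ne hm₂], ?_⟩
    simp [hW, hm₁.symm, hm₂.symm]
  have hW₁ : W m₁ = a := by simp [hW, hw₁, hne.symm]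
  have hW₂ : W m₂ = b := by simp [hW, hw₂, hne]
  refine ⟨⟨W, R, S⟩, fun m => ?_, fun F => ?_, fun P hP hP₁ hP₂ m hm => ?_⟩
  · by_cases hm₁ : m = m₁
    · subst hm₁; exact hW₁ ▸ ha
    · by_cases hm₂ : m = m₂
      · subst hm₂; exact hW₂ ▸ hb
      · change 0 ≤ W m
        rw [(hold m hm₁ hm₂).2.2]; exact hw m
  · have hsub : W.support ⊆ insert m₂ (insert m₁ Λ.weight.support) := by
      intro m hm
      by_contra hnot
      simp only [Finset.mem_insert, not_or] at hnot
      refine Finsupp.mem_support_iff.1 hm ?_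
      rw [(hold m hnot.2.1 hnot.1).2.2]
      exact Finsupp.notMem_support_iff.1 fun h => hnot.2.2 (hsupp h)
    have h3 : m₂ ∉ insert m₁ Λ.weight.support := by
      simp only [Finset.mem_insert, not_or]
      exact ⟨hne.symm, h₂⟩
    change ∑ m ∈ W.support, W m * F m (R m) (S m) = _
    rw [Finset.sum_subset hsub fun m _ hm => by
      rw [Finsupp.notMem_support_iff.1 hm, zero_mul], Finset.sum_insert h3,
      Finset.sum_insert h₁, hW₁, hW₂, hR₁, hR₂, hS₁, hS₂]
    have : ∑ m ∈ Λ.weight.support, W m * F m (R m) (S m) =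
        ∑ m ∈ Λ.weight.support, w m * F m (Λ.rate m) (Λ.steady m) := by
      refine Finset.sum_congr rfl fun m hm => ?_
      obtain ⟨e1, e2, e3⟩ := hold m (fun h => h₁ (h ▸ hm)) (fun h => h₂ (h ▸ hm))
      rw [e1, e2, e3]
    rw [this]; ring
  · change P m (R m) (S m)
    by_cases hm₁ : m = m₁
    · subst hm₁; rwa [hR₁, hS₁]
    · by_cases hm₂ : m = m₂
      · subst hm₂; rwa [hR₂, hS₂]
      · obtain ⟨e1, e2, e3⟩ := hold m hm₁ hm₂
        rw [e1, e2]
        refine hP m (Finsupp.mem_support_iff.2 ?_)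
        rw [← e3]
        exact Finsupp.mem_support_iff.1 hm

/-- Since the shares of the two tasks add up to one, balancing total mass and the good task balances
the bad task as well. -/
theorem exists_feasible_modification (hΛ : Λ.IsFeasible E badObserved)
    {w : ReactiveAssignment →₀ ℝ} (hsupp : w.support ⊆ Λ.weight.support) (hw : ∀ m, 0 ≤ w m)
    {m₁ m₂ : ReactiveAssignment} (h₁ : m₁ ∉ Λ.weight.support) (h₂ : m₂ ∉ Λ.weight.support)
    (hne : m₁ ≠ m₂) {r₁ r₂ : ℝ} {μ₁ : State m₁.k → ℝ} {μ₂ : State m₂.k → ℝ}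
    (hc₁ : IsComponent E badObserved m₁ r₁ μ₁) (hc₂ : IsComponent E badObserved m₂ r₂ μ₂)
    {a b : ℝ} (ha : 0 ≤ a) (hb : 0 ≤ b)
    (hsum : ∑ m ∈ Λ.weight.support, w m + a + b = 1)
    (htask : ∑ m ∈ Λ.weight.support, w m * taskShare m (Λ.steady m) .tG +
      a * taskShare m₁ μ₁ .tG + b * taskShare m₂ μ₂ .tG = E.q .tG) :
    ∃ Λ' : TeamStructure, Λ'.IsFeasible E badObserved ∧
      Λ'.value E = ∑ m ∈ Λ.weight.support, w m * teamValue E m (Λ.rate m) (Λ.steady m) +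
        a * teamValue E m₁ r₁ μ₁ + b * teamValue E m₂ r₂ μ₂ ∧
      ∀ P : (m : ReactiveAssignment) → ℝ → (State m.k → ℝ) → Prop,
        (∀ m ∈ w.support, P m (Λ.rate m) (Λ.steady m)) → P m₁ r₁ μ₁ → P m₂ r₂ μ₂ →
          ∀ m ∈ Λ'.weight.support, P m (Λ'.rate m) (Λ'.steady m) := by
  obtain ⟨Λ', hnn, hF, hP⟩ := exists_modification Λ hsupp hw h₁ h₂ hne r₁ r₂ μ₁ μ₂ ha hb
  have hcomp := hP (IsComponent E badObserved) (fun m hm => hΛ.isComponent (hsupp hm)) hc₁ hc₂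
  have hone : ∑ m ∈ Λ'.weight.support, Λ'.weight m = 1 := by
    have := hF fun _ _ _ => 1
    simp only [mul_one] at this
    rw [this, hsum]
  have hgood : ∑ m ∈ Λ'.weight.support, Λ'.weight m * taskShare m (Λ'.steady m) .tG = E.q .tG := by
    rw [hF fun m _ μ => taskShare m μ .tG, htask]
  refine ⟨Λ', ⟨hnn, hone, fun m hm => (hcomp m hm).rate_mem, fun m hm => (hcomp m hm).steady,
    fun m hm => (hcomp m hm).observable, fun t => ?_⟩, hF fun m r μ => teamValue E m r μ, hP⟩
  cases t with
  | tG => exact hgood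
  | tB =>
    have : ∑ m ∈ Λ'.weight.support, Λ'.weight m * taskShare m (Λ'.steady m) .tB =
        ∑ m ∈ Λ'.weight.support, (Λ'.weight m - Λ'.weight m * taskShare m (Λ'.steady m) .tG) :=
      Finset.sum_congr rfl fun m hm => by rw [(hcomp m hm).steady.taskShare_tB]; ring
    rw [this, Finset.sum_sub_distrib, hone, hgood]
    linarith [E.q_sum]

/-- A structure records one rate and one steady state per assignment, so added assignments must be
new. A memory longer than all those in use guarantees this. -/
theorem exists_fresh_memory (Λ : TeamStructure) (K : ℕ) :
    ∃ k, K ≤ k ∧ ∀ m ∈ Λ.weight.support, m.k < k :=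
  ⟨K + (∑ m ∈ Λ.weight.support, m.k) + 1, by omega, fun m hm => by
    have := Finset.single_le_sum (f := fun m : ReactiveAssignment => m.k)
      (fun m _ => Nat.zero_le m.k) hm
    omega⟩

theorem exists_idle_component (E : Environment n) (badObserved : Prop) (k : ℕ) (t : Task) :
    ∃ (m : ReactiveAssignment) (μ : State m.k → ℝ), m.k = k ∧ IsComponent E badObserved m 1 μ ∧
      FullyNonCooperative E m 1 μ ∧ taskShare m μ .tG = if t = .tG then 1 else 0 := by
  obtain ⟨m, hk, hm, hp⟩ := exists_constantAssignment badObserved k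
    (if t = .tG then 1 else 0)
  obtain ⟨μ, hμ⟩ := m.exists_isSteadyState E
  refine ⟨m, μ, hk, ⟨⟨zero_le_one, le_rfl⟩, hμ, hm⟩, fullyNonCooperative_one hμ, ?_⟩
  rw [taskShare_tG, hμ.share_eq_of_constant hp]
  split_ifs <;> rfl

/-- Fully cooperative assignments in an optimal structure have at least the cycle's share of the
good task: otherwise a mixture of the cycle and of idleness on the bad task would be better. -/
theorem IsOptimal.one_le_share {κ θ : ℝ} {N : ℕ} (hE : IsDesignProblem E κ)
    (hc : IsCycle E.δ κ θ N) (hΛ : Λ.IsOptimal E badObserved) {m : ReactiveAssignment}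
    (hm : m ∈ Λ.weight.support)
    (hfc : FullyCooperative E m (Λ.rate m) (Λ.steady m)) :
    1 ≤ (N + 2 - θ) * ∑ s, Λ.steady m s * m.onGood s := by
  classical
  obtain ⟨hfeas, hopt⟩ := hΛ
  have hμ := hfeas.steady m hm
  rw [← taskShare_tG]
  by_contra! hlt
  obtain ⟨k, hk, hfresh⟩ := exists_fresh_memory Λ N
  let θ' : Set.Icc (0 : ℝ) 1 := ⟨θ, hc.θ_pos.le, hc.θ_le_one⟩
  obtain ⟨m₁, hk₁, hm₁, hp₁⟩ := exists_cycleAssignment badObserved k N θ'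
  obtain ⟨μ₁, hμ₁⟩ := m₁.exists_isSteadyState E
  obtain ⟨m₂, μ₂, hk₂, hc₂, hnc₂, hs₂⟩ := exists_idle_component E badObserved (k + 1) .tB
  have hfc₁ := fullyCooperative_of_cycle (θ := θ') hE hc hμ₁ hp₁ (by omega)
  have hs₁ := hμ₁.share_eq_of_cycle hp₁ (by omega)
  rw [← taskShare_tG] at hs₁
  change ((N : ℝ) + 2 - θ) * taskShare m₁ μ₁ .tG = 1 at hs₁
  have h₁ : m₁ ∉ Λ.weight.support := fun h => by have := hfresh _ h; omega
  have h₂ : m₂ ∉ Λ.weight.support := fun h => by have := hfresh _ h; omega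
  have hne : m₁ ≠ m₂ := fun h => by rw [h] at hk₁; omega
  set x := taskShare m (Λ.steady m) .tG with hx
  set x₁ := taskShare m₁ μ₁ .tG with hx₁
  set v := Λ.weight m with hv
  -- The weight on the cycle that reproduces the good-task share `x`; it is below one by `hlt`.
  set α := (N + 2 - θ) * x with hα
  have hD : 0 < (N : ℝ) + 2 - θ := by
    have := hc.θ_le_one
    have : (0 : ℝ) ≤ N := Nat.cast_nonneg N
    linarith
  have hx0 : 0 ≤ x := hμ.taskShare_nonneg _
  have hα0 : 0 ≤ α := mul_nonneg hD.le hx0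
  have hv0 : 0 < v := lt_of_le_of_ne (hfeas.weight_nonneg m)
    (Ne.symm (Finsupp.mem_support_iff.1 hm))
  have hαx : α * x₁ = x := by
    rw [hα]; linear_combination x * hs₁
  have herase : ∀ f : ReactiveAssignment → ℝ,
      ∑ m' ∈ Λ.weight.support, (Λ.weight.erase m) m' * f m' =
        ∑ m' ∈ Λ.weight.support, Λ.weight m' * f m' - v * f m := by
    intro f
    rw [← Finset.add_sum_erase _ _ hm, ← Finset.add_sum_erase _ (fun m' => Λ.weight m' * f m') hm,
      Finsupp.erase_same, zero_mul, zero_add, add_sub_cancel_left]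
    exact Finset.sum_congr rfl fun m' hm' => by
      rw [Finsupp.erase_ne (Finset.ne_of_mem_erase hm')]
  obtain ⟨Λ', hfeas', hval', -⟩ := exists_feasible_modification hfeas (w := Λ.weight.erase m)
    (by rw [Finsupp.support_erase]; exact Finset.erase_subset _ _)
    (fun m' => by
      rw [Finsupp.erase_apply]
      split_ifs
      exacts [le_rfl, hfeas.weight_nonneg m'])
    h₁ h₂ hne ⟨⟨le_rfl, zero_le_one⟩, hμ₁, hm₁⟩ hc₂ (a := v * α) (b := v * (1 - α))
    (by positivity) (mul_nonneg hv0.le (by linarith))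
    (by
      have := herase fun _ => 1
      simp only [mul_one] at this
      rw [this, hfeas.weight_sum]; ring)
    (by
      rw [herase fun m => taskShare m (Λ.steady m) .tG, hfeas.tasks, hs₂, if_neg (by decide),
        ← hx, ← hx₁]
      linear_combination v * hαx)
  have hle := hopt Λ' hfeas'
  rw [hval', herase fun m => teamValue E m (Λ.rate m) (Λ.steady m), hfc.teamValue_eq hμ,
    hfc₁.teamValue_eq hμ₁, hnc₂.teamValue_eq_zero hc₂.steady, TeamStructure.value, ← hx, ← hx₁]
    at hle
  have h5 : v * (α * (E.arr .tB * E.V .B + (E.arr .tG * E.V .G - E.arr .tB * E.V .B) * x₁) -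
      (E.arr .tB * E.V .B + (E.arr .tG * E.V .G - E.arr .tB * E.V .B) * x)) ≤ 0 := by
    linarith
  -- With equal good shares, the gain is exactly the harmful bad cooperation avoided by the idle
  -- fraction `1 - α`.
  have h6 : α * (E.arr .tB * E.V .B + (E.arr .tG * E.V .G - E.arr .tB * E.V .B) * x₁) -
      (E.arr .tB * E.V .B + (E.arr .tG * E.V .G - E.arr .tB * E.V .B) * x) =
      (1 - α) * -(E.arr .tB * E.V .B) := by
    linear_combination (E.arr .tG * E.V .G - E.arr .tB * E.V .B) * hαx
  rw [h6] at h5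
  have h7 : 0 < -(E.arr .tB * E.V .B) := by
    have := mul_pos (E.arr_pos .tB) (neg_pos.2 E.V_bad)
    linarith
  have h8 : 0 < v * ((1 - α) * -(E.arr .tB * E.V .B)) :=
    mul_pos hv0 (mul_pos (by linarith) h7)
  linarith

/-- If an optimal structure has no positive value, complete idleness is optimal as well. -/
theorem IsOptimal.exists_idle (hΛ : Λ.IsOptimal E badObserved) (hval : Λ.value E ≤ 0) :
    ∃ Λ' : TeamStructure, Λ'.IsOptimal E badObserved ∧
      ∀ m ∈ Λ'.weight.support, FullyNonCooperative E m (Λ'.rate m) (Λ'.steady m) := by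
  obtain ⟨hfeas, hopt⟩ := hΛ
  obtain ⟨k, -, hfresh⟩ := exists_fresh_memory Λ 0
  obtain ⟨m₁, μ₁, hk₁, hc₁, hnc₁, hs₁⟩ := exists_idle_component E badObserved k .tG
  obtain ⟨m₂, μ₂, hk₂, hc₂, hnc₂, hs₂⟩ := exists_idle_component E badObserved (k + 1) .tB
  obtain ⟨Λ', hfeas', hval', hP⟩ := exists_feasible_modification hfeas (w := 0) (by simp)
    (by simp) (fun h => by have := hfresh _ h; omega) (fun h => by have := hfresh _ h; omega)
    (fun h => by rw [h] at hk₁; omega) hc₁ hc₂ (E.q_nonneg .tG) (E.q_nonneg .tB)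
    (by simpa using E.q_sum) (by rw [hs₁, hs₂]; simp)
  refine ⟨Λ', ⟨hfeas', fun Λ'' h'' => (hopt Λ'' h'').trans (hval.trans ?_)⟩,
    hP (FullyNonCooperative E) (by simp) hnc₁ hnc₂⟩
  rw [hval', hnc₁.teamValue_eq_zero hc₁.steady, hnc₂.teamValue_eq_zero hc₂.steady]
  simp

/-- In an optimal structure of positive value there is no idleness on both tasks: otherwise the
other teams could be scaled up. -/
theorem IsOptimal.value_nonpos_of_idle (hΛ : Λ.IsOptimal E badObserved)
    (hidle : ∀ t, ∃ m ∈ Λ.weight.support,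
      FullyNonCooperative E m (Λ.rate m) (Λ.steady m) ∧ 0 < taskShare m (Λ.steady m) t) :
    Λ.value E ≤ 0 := by
  classical
  obtain ⟨hfeas, hopt⟩ := hΛ
  by_contra! hpos
  obtain ⟨k, -, hfresh⟩ := exists_fresh_memory Λ 0
  obtain ⟨m₁, μ₁, hk₁, hc₁, hnc₁, hs₁⟩ := exists_idle_component E badObserved k .tG
  obtain ⟨m₂, μ₂, hk₂, hc₂, hnc₂, hs₂⟩ := exists_idle_component E badObserved (k + 1) .tB
  let p : ReactiveAssignment → Prop := fun m =>
    ¬ FullyNonCooperative E m (Λ.rate m) (Λ.steady m)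
  -- Totals over the idle teams only.
  let I : (ReactiveAssignment → ℝ) → ℝ := fun f =>
    ∑ m ∈ Λ.weight.support, if p m then 0 else Λ.weight m * f m
  have hIpos : ∀ t, 0 < I fun m => taskShare m (Λ.steady m) t := by
    intro t
    obtain ⟨m, hm, hnc, hs⟩ := hidle t
    refine Finset.sum_pos' (fun m hm => ?_) ⟨m, hm, ?_⟩
    · split_ifs
      exacts [le_rfl, mul_nonneg (hfeas.weight_nonneg m)
        ((hfeas.steady m hm).taskShare_nonneg t)]
    · rw [if_neg (not_not.2 hnc)]
      exact mul_pos (lt_of_le_of_ne (hfeas.weight_nonneg m)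
        (Ne.symm (Finsupp.mem_support_iff.1 hm))) hs
  have hIone : I (fun _ => 1) = I (fun m => taskShare m (Λ.steady m) .tG) +
      I fun m => taskShare m (Λ.steady m) .tB := by
    simp only [I]
    rw [← Finset.sum_add_distrib]
    refine Finset.sum_congr rfl fun m hm => ?_
    rw [(hfeas.steady m hm).taskShare_tB]
    split_ifs <;> ring
  have hIval : I (fun m => teamValue E m (Λ.rate m) (Λ.steady m)) = 0 := by
    refine Finset.sum_eq_zero fun m hm => ?_
    split_ifs with hp
    · rfl
    · beta_reduce
      rw [(not_not.1 hp).teamValue_eq_zero (hfeas.steady m hm), mul_zero]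
  set x := I fun m => taskShare m (Λ.steady m) .tG with hx
  set y := I fun m => taskShare m (Λ.steady m) .tB with hy
  -- Scaling the non-idle teams by `1 + ε` leaves idle masses `(1 + ε) x - ε q_G` and `(1 + ε) y - ε
  -- q_B`. These are nonnegative because both `q` are at most one; the value is multiplied by `1 +
  -- ε`.
  set ε := min x y with hε
  have hε0 : 0 < ε := lt_min (hIpos _) (hIpos _)
  have hεx : ε ≤ x := min_le_left _ _
  have hεy : ε ≤ y := min_le_right _ _
  set w : ReactiveAssignment →₀ ℝ := (1 + ε) • Λ.weight.filter p with hw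
  have hwsum : ∀ f : ReactiveAssignment → ℝ, ∑ m ∈ Λ.weight.support, w m * f m =
      (1 + ε) * (∑ m ∈ Λ.weight.support, Λ.weight m * f m - I f) := by
    intro f
    rw [← Finset.sum_sub_distrib, Finset.mul_sum]
    refine Finset.sum_congr rfl fun m _ => ?_
    rw [hw, Finsupp.smul_apply, Finsupp.filter_apply, smul_eq_mul]
    split_ifs <;> ring
  have hqG := E.q_nonneg .tG
  have hqB := E.q_nonneg .tB
  have hq := E.q_sum
  obtain ⟨Λ', hfeas', hval', -⟩ := exists_feasible_modification hfeas (w := w)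
    (fun m hm => by
      rw [Finsupp.mem_support_iff, hw, Finsupp.smul_apply, Finsupp.filter_apply, smul_eq_mul] at hm
      rw [Finsupp.mem_support_iff]
      intro h0
      simp [h0] at hm)
    (fun m => by
      rw [hw, Finsupp.smul_apply, Finsupp.filter_apply, smul_eq_mul]
      split_ifs
      · exact mul_nonneg (by linarith) (hfeas.weight_nonneg m)
      · simp)
    (fun h => by have := hfresh _ h; omega) (fun h => by have := hfresh _ h; omega)
    (fun h => by rw [h] at hk₁; omega) hc₁ hc₂ (a := (1 + ε) * x - ε * E.q .tG)
    (b := (1 + ε) * y - ε * E.q .tB) (by nlinarith) (by nlinarith)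
    (by
      have := hwsum fun _ => 1
      simp only [mul_one] at this
      rw [this, hfeas.weight_sum, hIone]
      linear_combination -ε * hq)
    (by
      rw [hwsum fun m => taskShare m (Λ.steady m) .tG, hfeas.tasks, hs₁, hs₂, ← hx, if_pos rfl,
        if_neg (by decide)]
      ring)
  have hle := hopt Λ' hfeas'
  rw [hval', hwsum fun m => teamValue E m (Λ.rate m) (Λ.steady m), hIval,
    hnc₁.teamValue_eq_zero hc₁.steady, hnc₂.teamValue_eq_zero hc₂.steady] at hle
  unfold TeamStructure.value at hle hpos
  nlinarith

end TeamStructure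

end TeamDesign

/-! ### The proposition -/

theorem proposition5 {n : ℕ} (E : TeamDesign.Environment n) (badObserved : Prop)
    (hG : E.δ / (1 - E.δ) * E.arr .tG * E.c .G < E.d .G)
    (hmax : max (E.d .G) (E.d .B) < E.δ / (1 - E.δ) * E.arr .tB * E.c .B)
    (hB : E.d .B < E.δ / (1 - E.δ) * E.arr .tG * E.c .G) :
    (∃ NB : ℕ, ∀ Λ : TeamDesign.TeamStructure, Λ.IsOptimal E badObserved →
      ∀ m ∈ Λ.weight.support,
        TeamDesign.FullyCooperative E m (Λ.rate m) (Λ.steady m) →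
        (∀ σ, TeamDesign.IsPlayerOptimal E m (Λ.rate m) (Λ.steady m) σ →
          ∀ h, TeamDesign.OnPath E m (Λ.steady m) σ h → h.game = some TeamDesign.Game.G →
            ∀ i, TeamDesign.Indifferent E m (Λ.rate m) σ h i) ∧
        (∀ s : TeamDesign.State m.k, 0 < Λ.steady m s → s.current.1 = TeamDesign.Task.tG →
          m.pathProb E s (List.replicate NB .tB) = 1 ∧
          0 < m.pathProb E s (List.replicate NB .tB ++ [.tG]) ∧
          m.pathProb E s (List.replicate (NB + 1) .tB ++ [.tG]) =
            m.pathProb E s (List.replicate (NB + 1) .tB))) ∧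
    (∀ Λ : TeamDesign.TeamStructure, Λ.IsOptimal E badObserved →
      (∃ Λ' : TeamDesign.TeamStructure, Λ'.IsOptimal E badObserved ∧
        ∀ m ∈ Λ'.weight.support,
          TeamDesign.FullyNonCooperative E m (Λ'.rate m) (Λ'.steady m)) ∨
      (∃ t : TeamDesign.Task, ∀ m ∈ Λ.weight.support,
        TeamDesign.FullyNonCooperative E m (Λ.rate m) (Λ.steady m) →
          ∀ s : TeamDesign.State m.k, 0 < Λ.steady m s → s.current.1 = t)) := by
  open TeamDesign in
  refine ⟨?_, fun Λ hΛ => ?_⟩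
  · have hδ : 0 < 1 - E.δ := sub_pos.2 E.δ_lt_one
    have hρ : 0 < E.δ / (1 - E.δ) := div_pos E.δ_pos hδ
    rw [mul_assoc] at hG hmax hB
    have hD := (le_max_left _ _).trans_lt hmax
    have hb : E.arr .tG * E.c .G < E.arr .tB * E.c .B :=
      lt_of_mul_lt_mul_left (hG.trans hD) hρ.le
    set b := E.arr .tB * E.c .B
    set g := E.arr .tG * E.c .G
    -- The largest discounted future time on the good task that sustains cooperation. It is positive
    -- because permanent bad tasks suffice as incentive, and below `δ / (1 - δ)` because permanent
    -- good tasks do not.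
    set κ := (E.δ / (1 - E.δ) * b - E.d .G) / (b - g) with hκ
    have hκmul : (b - g) * κ = E.δ / (1 - E.δ) * b - E.d .G :=
      mul_div_cancel₀ _ (sub_pos.2 hb).ne'
    have hκlt : κ < E.δ / (1 - E.δ) := by
      rw [hκ, div_lt_iff₀ (sub_pos.2 hb)]; linarith
    obtain ⟨N, θ, hc⟩ := exists_isCycle E.δ_pos E.δ_lt_one
      (div_pos (sub_pos.2 hD) (sub_pos.2 hb)) ((lt_div_iff₀ hδ).1 hκlt)
    have hE : IsDesignProblem E κ := ⟨hb, hκmul, hB.le⟩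
    refine ⟨N, fun Λ hΛ m hm hfc => ?_⟩
    have hμ := hΛ.1.steady m hm
    have hr := hΛ.1.rate_mem m hm
    obtain ⟨σ₀, hσ₀⟩ := hfc.1
    have hcycle := fun s hs hg => hE.cycle_of_incentives hc (hΛ.1.observable m hm) hμ hr
      (fun s hs g hg => CooperatesOnPath.d_le_futureBenefit hr (hfc.2 σ₀ hσ₀) hσ₀.1 hs hg)
      (hΛ.one_le_share hE hc hm hfc) (s := s) hs hg
    refine ⟨fun σ hσ h hh hg i => ?_, fun s hs hg => (hcycle s hs hg).2⟩
    have hs := hh.isHistory.state_pos hμ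
    have htask : h.state.current.1 = Task.tG := by
      by_contra hne
      have := hμ.game_eq hs hg
      rw [Task.eq_tB_of_ne hne] at this
      exact absurd this (by decide)
    exact CooperatesOnPath.indifferent hr (hfc.2 σ hσ) hσ.1 hh hg (hcycle _ hs htask).1 i
  · by_cases ht : ∃ t : Task, ∀ m ∈ Λ.weight.support,
        FullyNonCooperative E m (Λ.rate m) (Λ.steady m) →
          ∀ s : State m.k, 0 < Λ.steady m s → s.current.1 = t
    · exact Or.inr ht
    -- If idle teams share no single task, refuting each task in turn yields idleness on the other
    -- one.
    · refine Or.inl (hΛ.exists_idle (hΛ.value_nonpos_of_idle fun t => ?_))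
      push Not at ht
      cases t with
      | tG =>
        obtain ⟨m, hm, hnc, s, hs, hne⟩ := ht .tB
        refine ⟨m, hm, hnc, (hΛ.1.steady m hm).taskShare_pos hs ?_⟩
        by_contra hG
        exact hne (Task.eq_tB_of_ne hG)
      | tB =>
        obtain ⟨m, hm, hnc, s, hs, hne⟩ := ht .tG
        exact ⟨m, hm, hnc, (hΛ.1.steady m hm).taskShare_pos hs (Task.eq_tB_of_ne hne)⟩
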